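/- **Theorem 1.2.** Let $a\neq 0$ and let $n\ge 0$ be an integer. For real polynomials $f,g$ in two variables of degree at most $n$ consider $$\dot x=-y(x+a)^2+\varepsilon f(x,y),\qquad \dot y=x(x+a)^2+\varepsilon g(x,y),\tag{$*$}$$ whose unperturbed system ($\varepsilon=0$) has the period annulus $0<\sqrt{x^2+y^2}<|a|$ around the origin, filled by the circles $L_r=\{x^2+y^2=r^2\}$, and let $$f^0(r)=\int_0^{2\pi}\frac{f(r\cos\theta,r\sin\theta)\cos\theta+g(r\cos\theta,r\sin\theta)\sin\theta}{(r\cos\theta+a)^2}\,d\theta ,\qquad 0<r<|a|,$$ be its first order averaged function. A limit cycle is a periodic orbit that is isolated among the periodic orbits. Then the maximum number of limit cycles of $(*)$ bifurcating from the period annulus, up to first order averaging, is exactly $n$: 1. For all $f,g$ of degree at most $n$ with $f^0\not\equiv0$ on $(0,|a|)$, the function $f^0$ has at most $n$ zeros in $(0,|a|)$; and for all $0<\rho_1<\rho_2<|a|$ and all sufficiently small $|\varepsilon|>0$ (depending on $f,g,\rho_1,\rho_2$), the system $(*)$ has at most $n$ limit cycles contained in the annulus $\rho_1\le\sqrt{x^2+y^2}\le\rho_2$.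 2. There are $f,g$ of degree at most $n$ with $f^0\not\equiv 0$ on $(0,|a|)$ such that $f^0$ has exactly $n$ zeros $r_1<\dots<r_n$ in $(0,|a|)$, all of them simple, and, for all sufficiently small $|\varepsilon|>0$, the system $(*)$ has $n$ distinct limit cycles $\Gamma_1(\varepsilon),\dots,\Gamma_n(\varepsilon)$ with $\Gamma_i(\varepsilon)\to L_{r_i}$ in the Hausdorff distance as $\varepsilon\to0$. Moreover, whenever $0<\rho_1<\rho_2<|a|$ and all $r_i$ lie in $(\rho_1,\rho_2)$, for all sufficiently small $|\varepsilon|>0$ (depending on $\rho_1,\rho_2$) the system $(*)$ has exactly $n$ limit cycles contained in the annulus $\rho_1\le\sqrt{x^2+y^2}\le\rho_2$. -/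

import Mathlib

open Set Filter Topology

noncomputable section

namespace CubicDL

/-- `γ` is a solution, defined for all times, of the autonomous planar system `γ' = X(γ)`. -/
def IsSolution (X : ℝ × ℝ → ℝ × ℝ) (γ : ℝ → ℝ × ℝ) : Prop :=
  ∀ t : ℝ, HasDerivAt γ (X (γ t)) t

/-- `Γ` is a periodic orbit of `X`: the image of a non-constant periodic solution. -/
def IsPeriodicOrbit (X : ℝ × ℝ → ℝ × ℝ) (Γ : Set (ℝ × ℝ)) : Prop :=
  ∃ (γ : ℝ → ℝ × ℝ) (T : ℝ), 0 < T ∧ IsSolution X γ ∧ (∀ t, γ (t + T) = γ t) ∧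
    (∃ t, γ t ≠ γ 0) ∧ Γ = range γ

/-- `Γ` is a limit cycle of `X`: a periodic orbit that is isolated among the periodic orbits,
i.e. some neighbourhood of `Γ` contains no other periodic orbit. -/
def IsLimitCycle (X : ℝ × ℝ → ℝ × ℝ) (Γ : Set (ℝ × ℝ)) : Prop :=
  IsPeriodicOrbit X Γ ∧
    ∃ U : Set (ℝ × ℝ), IsOpen U ∧ Γ ⊆ U ∧
      ∀ Γ' : Set (ℝ × ℝ), IsPeriodicOrbit X Γ' → Γ' ⊆ U → Γ' = Γ

/-- The value at `(x, y)` of a real polynomial in two variables. -/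
def evalAt (f : MvPolynomial (Fin 2) ℝ) (x y : ℝ) : ℝ :=
  MvPolynomial.eval ![x, y] f

/-- The perturbed cubic system
`x' = -y (x + a)^2 + ε f(x, y)`, `y' = x (x + a)^2 + ε g(x, y)`. -/
def field (a : ℝ) (f g : MvPolynomial (Fin 2) ℝ) (ε : ℝ) (p : ℝ × ℝ) : ℝ × ℝ :=
  (-p.2 * (p.1 + a) ^ 2 + ε * evalAt f p.1 p.2,
    p.1 * (p.1 + a) ^ 2 + ε * evalAt g p.1 p.2)

/-- The first order averaged function of the perturbed system: in polar coordinates the system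
reads `dr/dθ = ε F(θ, r) + O(ε^2)`, and this is `∫ F(θ, r) dθ` over one turn. It is
meaningful for `0 < r < |a|`, where the denominator has no zero. -/
def averaged (a : ℝ) (f g : MvPolynomial (Fin 2) ℝ) (r : ℝ) : ℝ :=
  ∫ θ in (0 : ℝ)..(2 * Real.pi),
    (evalAt f (r * Real.cos θ) (r * Real.sin θ) * Real.cos θ
      + evalAt g (r * Real.cos θ) (r * Real.sin θ) * Real.sin θ) / (r * Real.cos θ + a) ^ 2

/-- The circle of radius `r` around the origin. For `0 < r < |a|` these are the periodic orbits
that make up the period annulus of the unperturbed system. -/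
def circle (r : ℝ) : Set (ℝ × ℝ) := {p | p.1 ^ 2 + p.2 ^ 2 = r ^ 2}

/-- The closed annulus `ρ₁ ≤ √(x² + y²) ≤ ρ₂` (for `0 ≤ ρ₁` and `0 ≤ ρ₂`). -/
def annulus (ρ₁ ρ₂ : ℝ) : Set (ℝ × ℝ) :=
  {p | ρ₁ ^ 2 ≤ p.1 ^ 2 + p.2 ^ 2 ∧ p.1 ^ 2 + p.2 ^ 2 ≤ ρ₂ ^ 2}

/-- The limit cycles of the perturbed system that lie in the annulus `ρ₁ ≤ √(x² + y²) ≤ ρ₂`. -/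
def limitCyclesIn (a : ℝ) (f g : MvPolynomial (Fin 2) ℝ) (ε ρ₁ ρ₂ : ℝ) : Set (Set (ℝ × ℝ)) :=
  {Γ | IsLimitCycle (field a f g ε) Γ ∧ Γ ⊆ annulus ρ₁ ρ₂}

end CubicDL

end

noncomputable section

namespace CubicDL

theorem add_mul_cos_pos {a r : ℝ} (h : |r| < a) (θ : ℝ) : 0 < r * Real.cos θ + a := by
  have h1 : |r * Real.cos θ| ≤ |r| := by
    rw [abs_mul]; exact mul_le_of_le_one_right (abs_nonneg _) (Real.abs_cos_le_one θ)
  linarith [neg_abs_le (r * Real.cos θ)]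

theorem mul_cos_add_ne_zero {a r : ℝ} (h : |r| < |a|) (θ : ℝ) : r * Real.cos θ + a ≠ 0 := by
  rcases abs_cases a with ⟨e, -⟩ | ⟨e, -⟩
  · exact (add_mul_cos_pos (e ▸ h) θ).ne'
  · have := add_mul_cos_pos (a := -a) (r := -r) (by rw [abs_neg]; exact e ▸ h) θ
    intro h0; linarith

theorem sq_sub_sq_pos {a r : ℝ} (h : |r| < |a|) : 0 < a ^ 2 - r ^ 2 :=
  sub_pos.2 (sq_lt_sq.2 h)

theorem integral_inv_mul_cos_add_of_pos {a r : ℝ} (h : |r| < a) :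
    ∫ θ in (0 : ℝ)..(2 * Real.pi), (r * Real.cos θ + a)⁻¹ = 2 * Real.pi / √(a ^ 2 - r ^ 2) := by
  have ha : 0 < a := (abs_nonneg r).trans_lt h
  have hpos := sq_sub_sq_pos (a := a) (r := r) (by rwa [abs_of_pos ha])
  set w := √(a ^ 2 - r ^ 2) with hw
  have hw0 : 0 < w := Real.sqrt_pos.2 hpos
  have hw2 : w ^ 2 = a ^ 2 - r ^ 2 := Real.sq_sqrt hpos.le
  have hd : ∀ θ, HasDerivAt (fun θ => (θ - 2 * Real.arctan
      (r * Real.sin θ / (r * Real.cos θ + (a + w)))) / w) ((r * Real.cos θ + a)⁻¹) θ := by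
    intro θ
    have h1 := add_mul_cos_pos h θ
    have h2 : 0 < r * Real.cos θ + (a + w) := by linarith
    have e1 := ((Real.hasDerivAt_sin θ).const_mul r).div
      (((Real.hasDerivAt_cos θ).const_mul r).add_const (a + w)) h2.ne'
    have e2 := ((hasDerivAt_id θ).sub (e1.arctan.const_mul 2)).div_const w
    refine HasDerivAt.congr_deriv e2 ?_
    have hs := Real.sin_sq_add_cos_sq θ
    have key : (r * Real.cos θ + (a + w)) ^ 2 + (r * Real.sin θ) ^ 2
        = 2 * (a + w) * (r * Real.cos θ + a) := by
      linear_combination r ^ 2 * hs + hw2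
    have e3 : 1 + (r * Real.sin θ / (r * Real.cos θ + (a + w))) ^ 2
        = 2 * (a + w) * (r * Real.cos θ + a) / (r * Real.cos θ + (a + w)) ^ 2 := by
      rw [← key]; field_simp
    simp only [Pi.div_apply]
    rw [e3]
    have h3 : 0 < a + w := by linarith
    field_simp
    linear_combination (-(r ^ 2)) * hs - hw2
  rw [intervalIntegral.integral_eq_sub_of_hasDerivAt (fun θ _ => hd θ)]
  · simp
  · refine Continuous.intervalIntegrable ?_ _ _
    exact Continuous.inv₀ (by fun_prop) (fun θ => (add_mul_cos_pos h θ).ne')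

theorem integral_inv_mul_cos_add {a r : ℝ} (h : |r| < |a|) :
    ∫ θ in (0 : ℝ)..(2 * Real.pi), (r * Real.cos θ + a)⁻¹
      = |a| / a * (2 * Real.pi / √(a ^ 2 - r ^ 2)) := by
  have ha : a ≠ 0 := abs_pos.1 ((abs_nonneg r).trans_lt h)
  rcases abs_cases a with ⟨e, -⟩ | ⟨e, -⟩
  · rw [integral_inv_mul_cos_add_of_pos (e ▸ h), e, div_self ha, one_mul]
  · have := integral_inv_mul_cos_add_of_pos (a := -a) (r := -r) (by rw [abs_neg]; exact e ▸ h)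
    rw [e, neg_div, div_self ha, ← neg_sq a, ← neg_sq r, neg_one_mul, ← this,
      ← intervalIntegral.integral_neg]
    congr 1; ext θ
    rw [← inv_neg]; congr 1; ring

theorem continuous_div_mul_cos_add_sq {a r : ℝ} (h : |r| < |a|) {φ : ℝ → ℝ} (hφ : Continuous φ) :
    Continuous fun θ => φ θ / (r * Real.cos θ + a) ^ 2 :=
  hφ.div (by fun_prop) fun θ => pow_ne_zero 2 (mul_cos_add_ne_zero h θ)

theorem integral_inv_mul_cos_add_sq {a r : ℝ} (h : |r| < |a|) :
    ∫ θ in (0 : ℝ)..(2 * Real.pi), 1 / (r * Real.cos θ + a) ^ 2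
      = |a| * (2 * Real.pi) / √(a ^ 2 - r ^ 2) ^ 3 := by
  have ha : a ≠ 0 := abs_pos.1 ((abs_nonneg r).trans_lt h)
  have hpos := sq_sub_sq_pos h
  set w := √(a ^ 2 - r ^ 2) with hw
  have hw0 : 0 < w := Real.sqrt_pos.2 hpos
  have hw2 : w ^ 2 = a ^ 2 - r ^ 2 := Real.sq_sqrt hpos.le
  have hd : ∀ θ, HasDerivAt (fun θ => r * Real.sin θ / (r * Real.cos θ + a))
      (a * (r * Real.cos θ + a)⁻¹ - w ^ 2 * (1 / (r * Real.cos θ + a) ^ 2)) θ := by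
    intro θ
    have h1 := mul_cos_add_ne_zero h θ
    have e1 := ((Real.hasDerivAt_sin θ).const_mul r).div
      (((Real.hasDerivAt_cos θ).const_mul r).add_const a) h1
    refine HasDerivAt.congr_deriv e1 ?_
    have hs := Real.sin_sq_add_cos_sq θ
    field_simp
    linear_combination r ^ 2 * hs + hw2
  have i1 : Continuous fun θ => (r * Real.cos θ + a)⁻¹ :=
    Continuous.inv₀ (by fun_prop) (fun θ => mul_cos_add_ne_zero h θ)
  have i2 := continuous_div_mul_cos_add_sq h (continuous_const (y := (1 : ℝ)))
  have hint := intervalIntegral.integral_eq_sub_of_hasDerivAt (a := 0) (b := 2 * Real.pi)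
    (fun θ _ => hd θ) (Continuous.intervalIntegrable (by fun_prop) _ _)
  rw [intervalIntegral.integral_sub (Continuous.intervalIntegrable (by fun_prop) _ _)
    (Continuous.intervalIntegrable (by fun_prop) _ _), intervalIntegral.integral_const_mul,
    intervalIntegral.integral_const_mul, integral_inv_mul_cos_add h, ← hw] at hint
  simp only [Real.sin_two_pi, Real.sin_zero, mul_zero, zero_div, sub_zero] at hint
  rw [eq_div_iff (by positivity)]
  field_simp at hint
  linear_combination -hint

open Polynomial

/-- The integral of `x ^ i * y ^ j / (x + a) ^ 2` over the circle of radius `r`. -/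
def circleIntegral (a : ℝ) (i j : ℕ) (r : ℝ) : ℝ :=
  ∫ θ in (0 : ℝ)..(2 * Real.pi),
    (r * Real.cos θ) ^ i * (r * Real.sin θ) ^ j / (r * Real.cos θ + a) ^ 2

/-- The polynomials `W` of degree at most `N`, without linear term, and vanishing at `|a|`
if `b` holds. -/
structure IsAdmissible (a : ℝ) (N : ℕ) (b : Prop) (W : ℝ[X]) : Prop where
  natDegree_le : W.natDegree ≤ N
  coeff_one : W.coeff 1 = 0
  eval_abs : b → W.eval |a| = 0

theorem IsAdmissible.mono {a : ℝ} {N N' : ℕ} {b b' : Prop} {W : ℝ[X]} (h : IsAdmissible a N b W)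
    (hN : N ≤ N') (hb : b' → b) : IsAdmissible a N' b' W :=
  ⟨h.1.trans hN, h.2, fun hb' => h.3 (hb hb')⟩

theorem IsAdmissible.add {a : ℝ} {N : ℕ} {b : Prop} {W W' : ℝ[X]} (h : IsAdmissible a N b W)
    (h' : IsAdmissible a N b W') : IsAdmissible a N b (W + W') :=
  ⟨natDegree_add_le_of_degree_le h.1 h'.1, by simp [h.2, h'.2],
    fun hb => by simp [h.3 hb, h'.3 hb]⟩

theorem IsAdmissible.const_mul {a : ℝ} {N : ℕ} {b : Prop} {W : ℝ[X]} (h : IsAdmissible a N b W)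
    (c : ℝ) : IsAdmissible a N b (C c * W) :=
  ⟨(natDegree_C_mul_le c W).trans h.1, by simp [h.2], fun hb => by simp [h.3 hb]⟩

theorem IsAdmissible.sub {a : ℝ} {N : ℕ} {b : Prop} {W W' : ℝ[X]} (h : IsAdmissible a N b W)
    (h' : IsAdmissible a N b W') : IsAdmissible a N b (W - W') :=
  ⟨(natDegree_sub_le_of_le h.1 h'.1).trans (max_self N).le, by simp [h.2, h'.2],
    fun hb => by simp [h.3 hb, h'.3 hb]⟩

theorem isAdmissible_zero {a : ℝ} {N : ℕ} {b : Prop} : IsAdmissible a N b 0 :=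
  ⟨by simp, by simp, by simp⟩

theorem integral_cos_pow_odd (k : ℕ) :
    ∫ θ in (0 : ℝ)..(2 * Real.pi), Real.cos θ ^ (2 * k + 1) = 0 := by
  induction k with
  | zero => simp
  | succ k ih =>
    rw [show 2 * (k + 1) + 1 = (2 * k + 1) + 2 by ring, integral_cos_pow, ih]; simp

theorem IsAdmissible.sq_sub_mul {a : ℝ} {N : ℕ} {b : Prop} {W : ℝ[X]} (h : IsAdmissible a N b W) :
    IsAdmissible a (N + 2) True ((C (a ^ 2) - X ^ 2) * W) := by
  refine ⟨?_, ?_, fun _ => by simp⟩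
  · refine natDegree_mul_le.trans ?_
    have : (C (a ^ 2) - X ^ 2 : ℝ[X]).natDegree ≤ 2 := by compute_degree
    have := h.1
    omega
  · rw [sub_mul, coeff_sub, coeff_C_mul, h.2, coeff_X_pow_mul']
    simp

theorem exists_isAdmissible_integral_pow (a : ℝ) (m : ℕ) :
    ∃ W : ℝ[X], IsAdmissible a (m + 3) (1 ≤ m) W ∧ (m = 0 → W.eval |a| = 2 * Real.pi * |a| ^ 3) ∧
      ∀ r, |r| < |a| → √(a ^ 2 - r ^ 2) ^ 3 *
        (∫ θ in (0 : ℝ)..(2 * Real.pi), (r * Real.cos θ) ^ m) = W.eval √(a ^ 2 - r ^ 2) := by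
  have hI : ∀ r : ℝ, ∫ θ in (0 : ℝ)..(2 * Real.pi), (r * Real.cos θ) ^ m
      = r ^ m * ∫ θ in (0 : ℝ)..(2 * Real.pi), Real.cos θ ^ m := fun r => by
    simp_rw [mul_pow]; exact intervalIntegral.integral_const_mul _ _
  rcases Nat.even_or_odd' m with ⟨k, rfl | rfl⟩
  · refine ⟨C (∫ θ in (0 : ℝ)..(2 * Real.pi), Real.cos θ ^ (2 * k)) *
      ((C (a ^ 2) - X ^ 2) ^ k * X ^ 3), ?_, ?_, ?_⟩
    · refine IsAdmissible.const_mul ?_ _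
      refine ⟨?_, ?_, ?_⟩
      · refine natDegree_mul_le.trans (add_le_add ?_ (natDegree_X_pow_le 3))
        refine natDegree_pow_le.trans ?_
        have : (C (a ^ 2) - X ^ 2 : ℝ[X]).natDegree ≤ 2 := by compute_degree
        nlinarith
      · rw [coeff_mul_X_pow']; simp
      · intro hk
        have : k ≠ 0 := by omega
        simp [this]
    · intro hk
      have : k = 0 := by omega
      subst this
      simp
    · intro r hr
      rw [hI]
      simp only [eval_mul, eval_C, eval_pow, eval_sub, eval_X]
      rw [Real.sq_sqrt (sq_sub_sq_pos hr).le, sub_sub_cancel, pow_mul]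
      ring
  · refine ⟨0, isAdmissible_zero, by simp, fun r _ => ?_⟩
    rw [hI, integral_cos_pow_odd]; simp

theorem circleIntegral_one {a r : ℝ} (hr : |r| < |a|) :
    circleIntegral a 1 0 r = (∫ θ in (0 : ℝ)..(2 * Real.pi), (r * Real.cos θ + a)⁻¹)
      - a * ∫ θ in (0 : ℝ)..(2 * Real.pi), 1 / (r * Real.cos θ + a) ^ 2 := by
  have i1 : Continuous fun θ => (r * Real.cos θ + a)⁻¹ :=
    Continuous.inv₀ (by fun_prop) (fun θ => mul_cos_add_ne_zero hr θ)
  have i2 := continuous_div_mul_cos_add_sq hr (continuous_const (y := (1 : ℝ)))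
  rw [← intervalIntegral.integral_const_mul, ← intervalIntegral.integral_sub
    (Continuous.intervalIntegrable (by fun_prop) _ _)
    (Continuous.intervalIntegrable (by fun_prop) _ _)]
  unfold circleIntegral
  congr 1; ext θ
  have := mul_cos_add_ne_zero hr θ
  field_simp; ring

theorem circleIntegral_add_two {a r : ℝ} (hr : |r| < |a|) (i : ℕ) :
    circleIntegral a (i + 2) 0 r = (∫ θ in (0 : ℝ)..(2 * Real.pi), (r * Real.cos θ) ^ i)
      - 2 * a * circleIntegral a (i + 1) 0 r - a ^ 2 * circleIntegral a i 0 r := by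
  unfold circleIntegral
  rw [← intervalIntegral.integral_const_mul, ← intervalIntegral.integral_const_mul,
    ← intervalIntegral.integral_sub, ← intervalIntegral.integral_sub]
  · congr 1; ext θ
    have := mul_cos_add_ne_zero hr θ
    field_simp; ring
  all_goals
    refine Continuous.intervalIntegrable ?_ _ _
    first
    | fun_prop
    | exact continuous_const.mul (continuous_div_mul_cos_add_sq hr (by fun_prop))
    | exact Continuous.sub (by fun_prop)
        (continuous_const.mul (continuous_div_mul_cos_add_sq hr (by fun_prop)))

theorem exists_isAdmissible_circleIntegral_zero {a : ℝ} (ha : a ≠ 0) (i : ℕ) :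
    ∃ W : ℝ[X], IsAdmissible a (i + 1) (1 ≤ i) W ∧ (i = 0 → W.eval |a| = 2 * Real.pi * |a|) ∧
      ∀ r, |r| < |a| → √(a ^ 2 - r ^ 2) ^ 3 * circleIntegral a i 0 r
        = W.eval √(a ^ 2 - r ^ 2) := by
  induction i using Nat.twoStepInduction with
  | zero =>
    refine ⟨C (2 * Real.pi * |a|), ⟨(natDegree_C _).trans_le (by simp), coeff_C_of_ne_zero one_ne_zero,
      by simp⟩, by simp, fun r hr => ?_⟩
    have hw := Real.sqrt_pos.2 (sq_sub_sq_pos hr)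
    simp only [circleIntegral, pow_zero, one_mul]
    rw [integral_inv_mul_cos_add_sq hr, eval_C]
    field_simp
  | one =>
    refine ⟨C (2 * Real.pi) * (C (|a| / a) * X ^ 2 - C (a * |a|)), ⟨?_, ?_, ?_⟩, by simp,
      fun r hr => ?_⟩
    · compute_degree
    · rw [coeff_C_mul, coeff_sub, coeff_C_mul_X_pow, coeff_C]; simp
    · intro _
      simp only [eval_mul, eval_C, eval_pow, eval_sub, eval_X, sq_abs]
      field_simp; ring
    · have hw := Real.sqrt_pos.2 (sq_sub_sq_pos hr)
      rw [circleIntegral_one hr, integral_inv_mul_cos_add hr, integral_inv_mul_cos_add_sq hr]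
      simp only [eval_mul, eval_C, eval_pow, eval_sub, eval_X]
      field_simp
  | more i ih0 ih1 =>
    obtain ⟨W0, h0, v0, e0⟩ := ih0
    obtain ⟨W1, h1, -, e1⟩ := ih1
    obtain ⟨K, hK, vK, eK⟩ := exists_isAdmissible_integral_pow a i
    refine ⟨K - C (2 * a) * W1 - C (a ^ 2) * W0, ⟨?_, ?_, ?_⟩, by simp, fun r hr => ?_⟩
    · have := h0.1; have := h1.1; have := hK.1
      have := natDegree_C_mul_le (2 * a) W1
      have := natDegree_C_mul_le (a ^ 2) W0
      refine (natDegree_sub_le _ _).trans (max_le ((natDegree_sub_le _ _).trans (max_le ?_ ?_)) ?_)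
      all_goals omega
    · rw [coeff_sub, coeff_sub, coeff_C_mul, coeff_C_mul, h0.2, h1.2, hK.2]; ring
    · intro _
      simp only [eval_sub, eval_mul, eval_C, h1.3 (by omega)]
      rcases Nat.eq_zero_or_pos i with rfl | hi
      · rw [v0 rfl, vK rfl, ← sq_abs a]; ring
      · rw [h0.3 hi, hK.3 hi]; ring
    · simp only [eval_sub, eval_mul, eval_C]
      rw [← e0 r hr, ← e1 r hr, ← eK r hr]
      rw [circleIntegral_add_two hr]; ring

theorem circleIntegral_odd {a : ℝ} (i : ℕ) (r : ℝ) : circleIntegral a i 1 r = 0 := by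
  have h := intervalIntegral.integral_comp_sub_left (a := 0) (b := 2 * Real.pi)
    (fun θ => (r * Real.cos θ) ^ i * (r * Real.sin θ) ^ 1 / (r * Real.cos θ + a) ^ 2)
    (2 * Real.pi)
  simp only [Real.cos_two_pi_sub, Real.sin_two_pi_sub, sub_self, sub_zero, mul_neg, pow_one,
    neg_div, intervalIntegral.integral_neg] at h
  simp only [circleIntegral, pow_one]
  linarith

theorem exists_isAdmissible_circleIntegral {a : ℝ} (ha : a ≠ 0) (j : ℕ) :
    ∀ i, ∃ W : ℝ[X], IsAdmissible a (i + j + 1) (1 ≤ i + j) W ∧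
      ∀ r, |r| < |a| → √(a ^ 2 - r ^ 2) ^ 3 * circleIntegral a i j r
        = W.eval √(a ^ 2 - r ^ 2) := by
  induction j using Nat.twoStepInduction with
  | zero =>
    intro i
    obtain ⟨W, h, -, e⟩ := exists_isAdmissible_circleIntegral_zero ha i
    exact ⟨W, h, e⟩
  | one => exact fun i => ⟨0, isAdmissible_zero, fun r _ => by simp [circleIntegral_odd]⟩
  | more j ih _ =>
    intro i
    obtain ⟨W0, h0, e0⟩ := ih i
    obtain ⟨W1, h1, e1⟩ := ih (i + 2)
    refine ⟨(C (a ^ 2) - X ^ 2) * W0 - W1, (h0.sq_sub_mul.mono (by omega) (by simp)).sub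
      (h1.mono (by omega) (by omega)), fun r hr => ?_⟩
    simp only [eval_sub, eval_mul, eval_C, eval_pow, eval_X]
    rw [Real.sq_sqrt (sq_sub_sq_pos hr).le, ← e0 r hr, ← e1 r hr]
    have e : circleIntegral a i (j + 2) r = r ^ 2 * circleIntegral a i j r
        - circleIntegral a (i + 2) j r := by
      unfold circleIntegral
      rw [← intervalIntegral.integral_const_mul, ← intervalIntegral.integral_sub]
      · congr 1; ext θ
        have := mul_cos_add_ne_zero hr θ
        have hs := Real.sin_sq_add_cos_sq θ
        field_simp
        rw [← sub_eq_zero]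
        have : Real.sin θ ^ 2 = 1 - Real.cos θ ^ 2 := by linarith
        rw [pow_add (r * Real.sin θ), mul_pow r _ 2, this]
        ring
      all_goals
        refine Continuous.intervalIntegrable ?_ _ _
        first
        | exact continuous_const.mul (continuous_div_mul_cos_add_sq hr (by fun_prop))
        | exact (continuous_div_mul_cos_add_sq hr (by fun_prop))
    rw [e]; ring

end CubicDL

end

noncomputable section

namespace CubicDL

open Polynomial

theorem card_filter_roots_le {a : ℝ} (ha : a ≠ 0) {n : ℕ} {W : ℝ[X]} (hW : W ≠ 0)
    (h : IsAdmissible a (n + 2) True W) :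
    (W.roots.filter (fun w => w ∈ Ioo 0 |a|)).card ≤ n := by
  classical
  by_contra! hc
  have ha' : 0 < |a| := abs_pos.2 ha
  have hmem : |a| ∈ W.roots := (mem_roots hW).2 (h.3 trivial)
  have h1 : |a| ::ₘ W.roots.filter (fun w => w ∈ Ioo 0 |a|) ≤ W.roots.filter (fun w => 0 < w) := by
    rw [Multiset.le_iff_count]
    intro z
    by_cases hz : z = |a|
    · subst hz
      rw [Multiset.count_cons_self, Multiset.count_filter, Multiset.count_filter, if_neg (by simp),
        if_pos ha']
      exact Multiset.one_le_count_iff_mem.2 hmem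
    · rw [Multiset.count_cons_of_ne hz, Multiset.count_filter, Multiset.count_filter]
      by_cases hz2 : z ∈ Ioo 0 |a|
      · rw [if_pos hz2, if_pos hz2.1]
      · rw [if_neg hz2]; exact Nat.zero_le _
  have h2 := Multiset.card_le_card h1
  rw [Multiset.card_cons] at h2
  have h3 := Multiset.card_le_card (Multiset.filter_le (fun w => 0 < w) W.roots)
  have h4 := W.card_roots'
  have h5 := h.1
  have h6 : W.roots.filter (fun w => 0 < w) = W.roots :=
    Multiset.eq_of_le_of_card_le (Multiset.filter_le _ _) (by omega)
  have hpos : ∀ z ∈ W.roots, 0 < z := Multiset.filter_eq_self.1 h6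
  have hs : W.Splits := splits_iff_card_roots.2 (by omega)
  have h0 : W.eval 0 ≠ 0 := fun h0 => lt_irrefl _ (hpos 0 ((mem_roots hW).2 h0))
  have hd := hs.eval_derivative_div_eval_of_ne_zero h0
  rw [← coeff_zero_eq_eval_zero, coeff_derivative, zero_add, h.2, zero_mul, zero_div] at hd
  obtain ⟨t, ht⟩ := Multiset.exists_cons_of_mem hmem
  rw [ht, Multiset.map_cons, Multiset.sum_cons] at hd
  have h7 : 0 ≤ (t.map fun z => -(1 / (0 - z))).sum := by
    apply Multiset.sum_nonneg
    intro y hy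
    obtain ⟨z, hz, rfl⟩ := Multiset.mem_map.1 hy
    have := hpos z (ht ▸ Multiset.mem_cons_of_mem hz)
    rw [zero_sub, div_neg, neg_neg]; positivity
  rw [Multiset.sum_map_neg] at h7
  have : 1 / (0 - |a|) < 0 := by rw [zero_sub, div_neg]; simpa using ha
  linarith

/-- The integral of `h / (x + a) ^ 2` over the circle of radius `r`. -/
def polyIntegral (a : ℝ) (h : MvPolynomial (Fin 2) ℝ) (r : ℝ) : ℝ :=
  ∫ θ in (0 : ℝ)..(2 * Real.pi),
    evalAt h (r * Real.cos θ) (r * Real.sin θ) / (r * Real.cos θ + a) ^ 2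

/-- The polynomial `x f + y g`. -/
def radial (f g : MvPolynomial (Fin 2) ℝ) : MvPolynomial (Fin 2) ℝ :=
  MvPolynomial.X 0 * f + MvPolynomial.X 1 * g

theorem mul_averaged (a : ℝ) (f g : MvPolynomial (Fin 2) ℝ) (r : ℝ) :
    r * averaged a f g r = polyIntegral a (radial f g) r := by
  unfold averaged polyIntegral
  rw [← intervalIntegral.integral_const_mul]
  congr 1; ext θ
  simp only [radial, evalAt, map_add, map_mul, MvPolynomial.eval_X, Matrix.cons_val_zero,
    Matrix.cons_val_one]
  ring

theorem evalAt_eq_sum (h : MvPolynomial (Fin 2) ℝ) (x y : ℝ) :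
    evalAt h x y = ∑ d ∈ h.support, h.coeff d * (x ^ d 0 * y ^ d 1) := by
  rw [evalAt, MvPolynomial.eval_eq']
  simp

theorem continuous_evalAt (h : MvPolynomial (Fin 2) ℝ) :
    Continuous fun p : ℝ × ℝ => evalAt h p.1 p.2 := by
  simp_rw [evalAt_eq_sum]; fun_prop

theorem continuous_evalAt_circle (h : MvPolynomial (Fin 2) ℝ) (r : ℝ) :
    Continuous fun θ : ℝ => evalAt h (r * Real.cos θ) (r * Real.sin θ) := by
  simp_rw [evalAt_eq_sum]; fun_prop

theorem polyIntegral_eq_sum {a r : ℝ} (hr : |r| < |a|) (h : MvPolynomial (Fin 2) ℝ) :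
    polyIntegral a h r = ∑ d ∈ h.support, h.coeff d * circleIntegral a (d 0) (d 1) r := by
  unfold polyIntegral circleIntegral
  simp_rw [← intervalIntegral.integral_const_mul]
  rw [← intervalIntegral.integral_finsetSum]
  · congr 1; ext θ
    rw [evalAt_eq_sum, Finset.sum_div]
    exact Finset.sum_congr rfl fun d _ => by ring
  · intro d _
    exact Continuous.intervalIntegrable
      (continuous_const.mul (continuous_div_mul_cos_add_sq hr (by fun_prop))) _ _

theorem exists_isAdmissible_polyIntegral {a : ℝ} (ha : a ≠ 0) {N : ℕ}
    (h : MvPolynomial (Fin 2) ℝ) (hN : h.totalDegree ≤ N) (h0 : h.coeff 0 = 0) :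
    ∃ W : ℝ[X], IsAdmissible a (N + 1) True W ∧ ∀ r, |r| < |a| →
      √(a ^ 2 - r ^ 2) ^ 3 * polyIntegral a h r = W.eval √(a ^ 2 - r ^ 2) := by
  choose W hW eW using fun d : Fin 2 →₀ ℕ => exists_isAdmissible_circleIntegral ha (d 1) (d 0)
  refine ⟨∑ d ∈ h.support, C (h.coeff d) * W d, ?_, fun r hr => ?_⟩
  · refine Finset.sum_induction _ (IsAdmissible a (N + 1) True) (fun _ _ => IsAdmissible.add)
      isAdmissible_zero fun d hd => ?_
    have h1 := (MvPolynomial.le_totalDegree hd).trans hN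
    rw [Finsupp.sum_fintype _ _ (by simp), Fin.sum_univ_two] at h1
    refine ((hW d).mono (by omega) fun _ => ?_).const_mul _
    by_contra hlt
    have : d = 0 := by
      ext i; fin_cases i <;> simp <;> omega
    exact MvPolynomial.mem_support_iff.1 hd (this ▸ h0)
  · rw [polyIntegral_eq_sum hr, Finset.mul_sum, eval_finsetSum]
    refine Finset.sum_congr rfl fun d _ => ?_
    rw [eval_mul, eval_C, ← eW d r hr]; ring

theorem totalDegree_radial_le {f g : MvPolynomial (Fin 2) ℝ} {n : ℕ} (hf : f.totalDegree ≤ n)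
    (hg : g.totalDegree ≤ n) : (radial f g).totalDegree ≤ n + 1 := by
  refine (MvPolynomial.totalDegree_add _ _).trans (max_le ?_ ?_) <;>
  · refine (MvPolynomial.totalDegree_mul _ _).trans ?_
    rw [MvPolynomial.totalDegree_X]; omega

/-- The function `w ↦ w³ r f⁰(r)`, where `w² + r² = a²`, is the polynomial `W`. -/
def Represents (a : ℝ) (f g : MvPolynomial (Fin 2) ℝ) (W : ℝ[X]) : Prop :=
  ∀ r, |r| < |a| → √(a ^ 2 - r ^ 2) ^ 3 * (r * averaged a f g r) = W.eval √(a ^ 2 - r ^ 2)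

theorem exists_represents {a : ℝ} (ha : a ≠ 0) {n : ℕ} {f g : MvPolynomial (Fin 2) ℝ}
    (hf : f.totalDegree ≤ n) (hg : g.totalDegree ≤ n) :
    ∃ W : ℝ[X], IsAdmissible a (n + 2) True W ∧ Represents a f g W := by
  obtain ⟨W, h, e⟩ := exists_isAdmissible_polyIntegral ha (radial f g)
    (totalDegree_radial_le hf hg) (by simp [radial, MvPolynomial.coeff_X_mul'])
  exact ⟨W, h, fun r hr => by rw [mul_averaged]; exact e r hr⟩

theorem averaged_add {a r : ℝ} (hr : |r| < |a|) (f g f' g' : MvPolynomial (Fin 2) ℝ) :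
    averaged a (f + f') (g + g') r = averaged a f g r + averaged a f' g' r := by
  unfold averaged
  rw [← intervalIntegral.integral_add]
  · congr 1; ext θ
    simp only [evalAt, map_add]; ring
  all_goals
    refine Continuous.intervalIntegrable (continuous_div_mul_cos_add_sq hr ?_) _ _
    have := continuous_evalAt_circle f r
    have := continuous_evalAt_circle g r
    have := continuous_evalAt_circle f' r
    have := continuous_evalAt_circle g' r
    fun_prop

theorem averaged_const_mul (a r c : ℝ) (f g : MvPolynomial (Fin 2) ℝ) :
    averaged a (MvPolynomial.C c * f) (MvPolynomial.C c * g) r = c * averaged a f g r := by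
  unfold averaged
  rw [← intervalIntegral.integral_const_mul]
  congr 1; ext θ
  simp only [evalAt, map_mul, MvPolynomial.eval_C]; ring

/-- The polynomial `W` is represented by a perturbation of degree at most `n`. -/
def IsRealizable (a : ℝ) (n : ℕ) (W : ℝ[X]) : Prop :=
  ∃ f g : MvPolynomial (Fin 2) ℝ, f.totalDegree ≤ n ∧ g.totalDegree ≤ n ∧ Represents a f g W

theorem IsRealizable.mono {a : ℝ} {n n' : ℕ} {W : ℝ[X]} (h : IsRealizable a n W) (hn : n ≤ n') :
    IsRealizable a n' W := by
  obtain ⟨f, g, hf, hg, h⟩ := h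
  exact ⟨f, g, hf.trans hn, hg.trans hn, h⟩

theorem IsRealizable.add_const_mul {a : ℝ} {n : ℕ} {W W' : ℝ[X]} (h : IsRealizable a n W)
    (h' : IsRealizable a n W') (c : ℝ) : IsRealizable a n (W + C c * W') := by
  obtain ⟨f, g, hf, hg, h⟩ := h
  obtain ⟨f', g', hf', hg', h'⟩ := h'
  have hc : ∀ q : MvPolynomial (Fin 2) ℝ, q.totalDegree ≤ n →
      (MvPolynomial.C c * q).totalDegree ≤ n := fun q hq => by
    refine (MvPolynomial.totalDegree_mul _ _).trans ?_
    rwa [MvPolynomial.totalDegree_C, zero_add]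
  refine ⟨f + MvPolynomial.C c * f', g + MvPolynomial.C c * g',
    (MvPolynomial.totalDegree_add _ _).trans (max_le hf (hc _ hf')),
    (MvPolynomial.totalDegree_add _ _).trans (max_le hg (hc _ hg')), fun r hr => ?_⟩
  rw [averaged_add hr, averaged_const_mul, eval_add, eval_mul, eval_C, ← h r hr, ← h' r hr]
  ring

/-- The polynomial `x² + y²`. -/
def sqNorm : MvPolynomial (Fin 2) ℝ := MvPolynomial.X 0 ^ 2 + MvPolynomial.X 1 ^ 2

theorem totalDegree_sqNorm_pow_le (k : ℕ) : (sqNorm ^ k).totalDegree ≤ 2 * k := by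
  refine (MvPolynomial.totalDegree_pow _ _).trans ?_
  have : sqNorm.totalDegree ≤ 2 := (MvPolynomial.totalDegree_add _ _).trans (by simp)
  nlinarith

theorem totalDegree_shift_pow_le (a : ℝ) (m : ℕ) :
    ((MvPolynomial.X 0 + MvPolynomial.C a : MvPolynomial (Fin 2) ℝ) ^ m).totalDegree ≤ m := by
  refine (MvPolynomial.totalDegree_pow _ _).trans ?_
  have : (MvPolynomial.X 0 + MvPolynomial.C a : MvPolynomial (Fin 2) ℝ).totalDegree ≤ 1 :=
    (MvPolynomial.totalDegree_add _ _).trans (by simp)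
  nlinarith

theorem coeff_sq_sub_pow_mul (a c : ℝ) (k m : ℕ) :
    (C c * ((C (a ^ 2) - X ^ 2) ^ k * X ^ m)).coeff (2 * k + m) = c * (-1) ^ k := by
  rw [coeff_C_mul, coeff_mul_X_pow]
  have h : (C (a ^ 2) - X ^ 2 : ℝ[X]).natDegree ≤ 2 := by compute_degree
  rw [mul_comm 2 k, coeff_pow_of_natDegree_le h, coeff_sub, coeff_C_of_ne_zero two_ne_zero,
    coeff_X_pow_self, zero_sub]

theorem isAdmissible_sq_sub_pow_mul (a c : ℝ) (k : ℕ) {m : ℕ} (hm : 2 ≤ m) :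
    IsAdmissible a (2 * (k + 1) + m) True (C c * ((C (a ^ 2) - X ^ 2) ^ (k + 1) * X ^ m)) := by
  refine IsAdmissible.const_mul ⟨?_, ?_, by simp⟩ c
  · refine natDegree_mul_le.trans (add_le_add ?_ (natDegree_X_pow_le m))
    refine natDegree_pow_le.trans ?_
    have : (C (a ^ 2) - X ^ 2 : ℝ[X]).natDegree ≤ 2 := by compute_degree
    nlinarith
  · rw [coeff_mul_X_pow', if_neg (by omega)]

/-- The perturbation `(x, y) (x + a) ^ m (x² + y²) ^ k`, of degree `2 k + m + 1`. -/
theorem isRealizable_radial (a : ℝ) (k m : ℕ) {W : ℝ[X]}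
    (hW : ∀ r, |r| < |a| → √(a ^ 2 - r ^ 2) ^ 3 * (r ^ (2 * (k + 1)) *
      ∫ θ in (0 : ℝ)..(2 * Real.pi), (r * Real.cos θ + a) ^ m / (r * Real.cos θ + a) ^ 2)
        = W.eval √(a ^ 2 - r ^ 2)) : IsRealizable a (2 * k + m + 1) W := by
  have hd : ∀ i : Fin 2, (MvPolynomial.X i * ((MvPolynomial.X 0 + MvPolynomial.C a) ^ m
      * sqNorm ^ k) : MvPolynomial (Fin 2) ℝ).totalDegree ≤ 2 * k + m + 1 := by
    intro i
    refine (MvPolynomial.totalDegree_mul _ _).trans ?_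
    have := MvPolynomial.totalDegree_mul
      ((MvPolynomial.X 0 + MvPolynomial.C a : MvPolynomial (Fin 2) ℝ) ^ m) (sqNorm ^ k)
    have := totalDegree_sqNorm_pow_le k
    have := totalDegree_shift_pow_le a m
    rw [MvPolynomial.totalDegree_X]; omega
  refine ⟨_, _, hd 0, hd 1, fun r hr => ?_⟩
  rw [← hW r hr, mul_averaged, polyIntegral]
  congr 1
  rw [← intervalIntegral.integral_const_mul]
  congr 1; ext θ
  have hs := Real.sin_sq_add_cos_sq θ
  simp only [radial, sqNorm, evalAt, map_add, map_mul, map_pow, MvPolynomial.eval_X,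
    MvPolynomial.eval_C, Matrix.cons_val_zero, Matrix.cons_val_one]
  have e : (r * Real.cos θ) ^ 2 + (r * Real.sin θ) ^ 2 = r ^ 2 := by
    linear_combination r ^ 2 * hs
  rw [e, ← pow_mul, mul_add 2 k 1, pow_add r]
  linear_combination (r ^ (2 * k) * (r * Real.cos θ + a) ^ m / (r * Real.cos θ + a) ^ 2) * e

theorem exists_isRealizable_coeff_ne_zero {a : ℝ} (ha : a ≠ 0) (n : ℕ) :
    ∃ W : ℝ[X], IsAdmissible a (n + 2) True W ∧ IsRealizable a n W ∧ W.coeff (n + 2) ≠ 0 := by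
  have hσ : |a| / a * (2 * Real.pi) ≠ 0 := by have := abs_pos.2 ha; positivity
  rcases n with _ | _ | n
  · refine ⟨C (|a| / a * (2 * Real.pi)) * X ^ 2 - C (2 * Real.pi * (a * |a|)),
      ⟨by compute_degree, ?_, ?_⟩, ⟨1, 0, by simp, by simp, fun r hr => ?_⟩, ?_⟩
    · rw [coeff_sub, coeff_C_mul_X_pow, coeff_C]; simp
    · intro _
      simp only [eval_mul, eval_C, eval_pow, eval_sub, eval_X, sq_abs]
      field_simp; ring
    · have hw := Real.sqrt_pos.2 (sq_sub_sq_pos hr)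
      have e : polyIntegral a (radial 1 0) r = circleIntegral a 1 0 r := by
        unfold polyIntegral circleIntegral; simp [radial, evalAt]
      rw [mul_averaged, e, circleIntegral_one hr, integral_inv_mul_cos_add hr,
        integral_inv_mul_cos_add_sq hr]
      simp only [eval_mul, eval_C, eval_pow, eval_sub, eval_X]
      field_simp
    · rw [coeff_sub, coeff_C_mul_X_pow, coeff_C]; simpa using ha
  · refine ⟨C (2 * Real.pi) * (X ^ 3 - C (2 * |a|) * X ^ 2 + C (|a| ^ 3)),
      ⟨by compute_degree, ?_, ?_⟩,
      ⟨MvPolynomial.X 0, 0, by simp, by simp, fun r hr => ?_⟩, ?_⟩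
    · rw [coeff_C_mul, coeff_add, coeff_sub, coeff_C_mul_X_pow, coeff_X_pow, coeff_C]; simp
    · intro _
      simp only [eval_mul, eval_C, eval_pow, eval_sub, eval_add, eval_X]
      ring
    · have hw := Real.sqrt_pos.2 (sq_sub_sq_pos hr)
      have e : polyIntegral a (radial (MvPolynomial.X 0) 0) r = circleIntegral a 2 0 r := by
        unfold polyIntegral circleIntegral; simp [radial, evalAt, pow_two]
      have e0 : circleIntegral a 0 0 r = |a| * (2 * Real.pi) / √(a ^ 2 - r ^ 2) ^ 3 := by
        rw [← integral_inv_mul_cos_add_sq hr]; simp [circleIntegral]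
      rw [mul_averaged, e, circleIntegral_add_two hr, circleIntegral_one hr, e0,
        integral_inv_mul_cos_add hr, integral_inv_mul_cos_add_sq hr]
      simp only [eval_mul, eval_C, eval_pow, eval_sub, eval_add, eval_X, pow_zero,
        intervalIntegral.integral_const, smul_eq_mul]
      have h3 : |a| ^ 3 = a ^ 2 * |a| := by rw [← sq_abs a]; ring
      rw [h3]
      field_simp
      ring
    · rw [coeff_C_mul, coeff_add, coeff_sub, coeff_C_mul_X_pow, coeff_X_pow, coeff_C]
      simp
  · rcases Nat.even_or_odd' n with ⟨k, rfl | rfl⟩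
    · refine ⟨C (|a| / a * (2 * Real.pi)) * ((C (a ^ 2) - X ^ 2) ^ (k + 1) * X ^ 2),
        isAdmissible_sq_sub_pow_mul a _ k le_rfl, ?_, ?_⟩
      · refine isRealizable_radial a k 1 fun r hr => ?_
        have hw := Real.sqrt_pos.2 (sq_sub_sq_pos hr)
        have e : ∀ θ, (r * Real.cos θ + a) ^ 1 / (r * Real.cos θ + a) ^ 2
            = (r * Real.cos θ + a)⁻¹ := fun θ => by
          have := mul_cos_add_ne_zero hr θ
          field_simp
        simp_rw [e]
        rw [integral_inv_mul_cos_add hr]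
        simp only [eval_mul, eval_C, eval_pow, eval_sub, eval_X]
        rw [Real.sq_sqrt (sq_sub_sq_pos hr).le, sub_sub_cancel, ← pow_mul]
        conv_rhs => rw [← Real.sq_sqrt (sq_sub_sq_pos hr).le]
        field_simp
      · rw [show 2 * k + 1 + 1 + 2 = 2 * (k + 1) + 2 by ring, coeff_sq_sub_pow_mul]
        exact mul_ne_zero hσ (pow_ne_zero _ (by norm_num))
    · refine ⟨C (2 * Real.pi) * ((C (a ^ 2) - X ^ 2) ^ (k + 1) * X ^ 3),
        (isAdmissible_sq_sub_pow_mul a _ k (by norm_num)).mono (by omega) id, ?_, ?_⟩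
      · refine IsRealizable.mono (isRealizable_radial a k 2 fun r hr => ?_) (by omega)
        have e : ∀ θ, (r * Real.cos θ + a) ^ 2 / (r * Real.cos θ + a) ^ 2 = 1 := fun θ =>
          div_self (pow_ne_zero 2 (mul_cos_add_ne_zero hr θ))
        simp_rw [e]
        simp only [eval_mul, eval_C, eval_pow, eval_sub, eval_X, intervalIntegral.integral_const,
          smul_eq_mul]
        rw [Real.sq_sqrt (sq_sub_sq_pos hr).le, sub_sub_cancel, ← pow_mul]
        ring
      · rw [show 2 * k + 1 + 1 + 1 + 2 = 2 * (k + 1) + 3 by ring, coeff_sq_sub_pow_mul]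
        exact mul_ne_zero (by positivity) (pow_ne_zero _ (by norm_num))

theorem IsAdmissible.isRealizable {a : ℝ} (ha : a ≠ 0) {n : ℕ} :
    ∀ {W : ℝ[X]}, IsAdmissible a (n + 2) True W → IsRealizable a n W := by
  induction n with
  | zero =>
    intro W h
    obtain ⟨V, hV, rV, cV⟩ := exists_isRealizable_coeff_ne_zero ha 0
    have h1 := h.sub (hV.const_mul (W.coeff 2 / V.coeff 2))
    have h2 : (W - C (W.coeff 2 / V.coeff 2) * V) = 0 := by
      have h3 : (W - C (W.coeff 2 / V.coeff 2) * V).coeff 2 = 0 := by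
        rw [coeff_sub, coeff_C_mul, div_mul_cancel₀ _ cV, sub_self]
      have h4 := h1.1
      generalize W - C (W.coeff 2 / V.coeff 2) * V = P at h1 h3 h4
      have h5 : P = C (P.coeff 0) := by
        ext i
        rcases i with _ | _ | _ | i
        · simp
        · rw [coeff_C_succ]; exact h1.2
        · rw [coeff_C_succ]; exact h3
        · rw [coeff_C_succ]; exact coeff_eq_zero_of_natDegree_lt (by omega)
      have h6 := h1.3 trivial
      rw [h5, eval_C] at h6
      rw [h5, h6, C_0]
    have h0 : IsRealizable a 0 0 := ⟨0, 0, by simp, by simp, fun r _ => by simp [averaged, evalAt]⟩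
    have := h0.add_const_mul rV (W.coeff 2 / V.coeff 2)
    rwa [zero_add, ← sub_eq_zero.1 h2] at this
  | succ n ih =>
    intro W h
    obtain ⟨V, hV, rV, cV⟩ := exists_isRealizable_coeff_ne_zero ha (n + 1)
    have h1 := h.sub (hV.const_mul (W.coeff (n + 1 + 2) / V.coeff (n + 1 + 2)))
    have h3 : (W - C (W.coeff (n + 1 + 2) / V.coeff (n + 1 + 2)) * V).coeff (n + 1 + 2) = 0 := by
      rw [coeff_sub, coeff_C_mul, div_mul_cancel₀ _ cV, sub_self]
    have h4 : IsAdmissible a (n + 2) True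
        (W - C (W.coeff (n + 1 + 2) / V.coeff (n + 1 + 2)) * V) := by
      refine ⟨?_, h1.2, h1.3⟩
      rw [natDegree_le_iff_coeff_eq_zero]
      intro N hN
      rcases Nat.lt_or_ge (n + 1 + 2) N with hlt | hge
      · exact coeff_eq_zero_of_natDegree_lt (h1.1.trans_lt hlt)
      · rw [show N = n + 1 + 2 by omega, h3]
    have := ((ih h4).mono n.le_succ).add_const_mul rV (W.coeff (n + 1 + 2) / V.coeff (n + 1 + 2))
    rwa [sub_add_cancel] at this

/-- Given positive numbers other than `|a|`, there is an admissible polynomial whose positive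
roots are these numbers and `|a|`, all of them simple. -/
theorem exists_isAdmissible_roots {a : ℝ} (ha : a ≠ 0) (S : Finset ℝ)
    (hS : ∀ z ∈ S, z ∈ Ioo 0 |a|) :
    ∃ W : ℝ[X], IsAdmissible a (S.card + 2) True W ∧
      (∀ w ∈ Ioo 0 |a|, W.eval w = 0 ↔ w ∈ S) ∧ ∀ w ∈ S, W.derivative.eval w ≠ 0 := by
  classical
  have ha' : 0 < |a| := abs_pos.2 ha
  set T : Finset ℝ := insert |a| S with hT
  have haS : |a| ∉ S := fun h => lt_irrefl _ (hS _ h).2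
  have hTpos : ∀ z ∈ T, 0 < z := by
    intro z hz
    rcases Finset.mem_insert.1 hz with rfl | hz
    · exact ha'
    · exact (hS z hz).1
  set σ : ℝ := ∑ z ∈ T, z⁻¹ with hσ
  have hσ0 : 0 < σ := Finset.sum_pos (fun z hz => inv_pos.2 (hTpos z hz)) ⟨_, Finset.mem_insert_self _ _⟩
  have hm : -σ⁻¹ < 0 := neg_lt_zero.2 (inv_pos.2 hσ0)
  have hmT : -σ⁻¹ ∉ T := fun h => (hTpos _ h).not_gt hm
  set R : Finset ℝ := insert (-σ⁻¹) T with hR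
  have hR0 : ∀ z ∈ R, z ≠ 0 := by
    intro z hz
    rcases Finset.mem_insert.1 hz with rfl | hz
    · exact hm.ne
    · exact (hTpos z hz).ne'
  have hcard : R.card = S.card + 2 := by
    rw [hR, Finset.card_insert_of_notMem hmT, hT, Finset.card_insert_of_notMem haS]
  refine ⟨Lagrange.nodal R id, ⟨?_, ?_, fun _ => ?_⟩, fun w hw => ?_, fun w hw => ?_⟩
  · rw [Lagrange.natDegree_nodal, hcard]
  · have h1 : (Lagrange.nodal R id : ℝ[X]).coeff 1
        = (Lagrange.nodal R id : ℝ[X]).derivative.eval 0 := by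
      rw [← coeff_zero_eq_eval_zero, coeff_derivative]; simp
    have h2 : ∀ z ∈ R, (Lagrange.nodal (R.erase z) id : ℝ[X]).eval 0
        = -(Lagrange.nodal R id : ℝ[X]).eval 0 * z⁻¹ := by
      intro z hz
      rw [Lagrange.nodal_eq_mul_nodal_erase hz]
      have := hR0 z hz
      simp only [id, eval_mul, eval_sub, eval_X, eval_C]
      field_simp; ring
    rw [h1, Lagrange.derivative_nodal, eval_finsetSum, Finset.sum_congr rfl h2,
      ← Finset.mul_sum, hR, Finset.sum_insert hmT, ← hσ]
    simp
  · exact Lagrange.eval_nodal_at_node (v := id)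
      (Finset.mem_insert_of_mem (Finset.mem_insert_self _ _))
  · constructor
    · intro h
      by_contra hwS
      refine Lagrange.eval_nodal_not_at_node (s := R) (v := id) (x := w) ?_ h
      rintro i hi rfl
      rcases Finset.mem_insert.1 hi with h | hi
      · exact hw.1.not_gt (h ▸ hm)
      · rcases Finset.mem_insert.1 hi with h | hi
        · exact hw.2.ne h
        · exact hwS hi
    · intro h
      exact Lagrange.eval_nodal_at_node (v := id)
        (Finset.mem_insert_of_mem (Finset.mem_insert_of_mem h))
  · have hwR : w ∈ R := Finset.mem_insert_of_mem (Finset.mem_insert_of_mem hw)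
    refine (Lagrange.eval_nodal_derivative_eval_node_eq (v := id) hwR).trans_ne ?_
    refine Lagrange.eval_nodal_not_at_node ?_
    intro i hi
    exact (Finset.ne_of_mem_erase hi).symm

end CubicDL

end

noncomputable section

namespace CubicDL

open Metric
open scoped NNReal

/-- A time dependent field, holomorphic, bounded by `L` and `K`-Lipschitz on the open set `U`. -/
structure IsHolomorphicField (v : ℝ → ℂ → ℂ) (U : Set ℂ) (L K : ℝ≥0) : Prop where
  isOpen : IsOpen U
  continuousOn : ContinuousOn (Function.uncurry v) (univ ×ˢ U)
  differentiableOn : ∀ t, DifferentiableOn ℂ (v t) U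
  lipschitzOnWith : ∀ t, LipschitzOnWith K (v t) U
  norm_le : ∀ t, ∀ z ∈ U, ‖v t z‖ ≤ L

/-- The curve `α` solves `z' = v t z` within `U` over the time interval `[0, T]`. -/
def IsSolutionOn (v : ℝ → ℂ → ℂ) (U : Set ℂ) (T : ℝ) (α : ℝ → ℂ) : Prop :=
  ∀ t ∈ Icc 0 T, HasDerivWithinAt α (v t (α t)) (Icc 0 T) t ∧ α t ∈ U

variable {v : ℝ → ℂ → ℂ} {U : Set ℂ} {L K : ℝ≥0} {T : ℝ} {α β : ℝ → ℂ}

theorem IsSolutionOn.continuousOn (h : IsSolutionOn v U T α) : ContinuousOn α (Icc 0 T) :=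
  fun t ht => (h t ht).1.continuousWithinAt

theorem IsSolutionOn.hasDerivWithinAt_Ici (h : IsSolutionOn v U T α) :
    ∀ t ∈ Ico 0 T, HasDerivWithinAt α (v t (α t)) (Ici t) t := fun t ht =>
  (h t (Ico_subset_Icc_self ht)).1.mono_of_mem_nhdsWithin (Icc_mem_nhdsGE_of_mem ht)

theorem IsSolutionOn.hasDerivWithinAt_Iic (h : IsSolutionOn v U T α) :
    ∀ t ∈ Ioc 0 T, HasDerivWithinAt α (v t (α t)) (Iic t) t := fun t ht =>
  (h t (Ioc_subset_Icc_self ht)).1.mono_of_mem_nhdsWithin (Icc_mem_nhdsLE_of_mem ht)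

theorem IsHolomorphicField.eqOn (hv : IsHolomorphicField v U L K) (hα : IsSolutionOn v U T α)
    (hβ : IsSolutionOn v U T β) (h0 : α 0 = β 0) : EqOn α β (Icc 0 T) :=
  ODE_solution_unique_of_mem_Icc_right (s := fun _ => U) (fun t _ => hv.lipschitzOnWith t)
    hα.continuousOn hα.hasDerivWithinAt_Ici (fun t ht => (hα t (Ico_subset_Icc_self ht)).2)
    hβ.continuousOn hβ.hasDerivWithinAt_Ici (fun t ht => (hβ t (Ico_subset_Icc_self ht)).2) h0

theorem IsHolomorphicField.ne (hv : IsHolomorphicField v U L K) (hα : IsSolutionOn v U T α)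
    (hβ : IsSolutionOn v U T β) (h0 : α 0 ≠ β 0) : ∀ t ∈ Icc 0 T, α t ≠ β t := by
  intro t ht he
  have hsub : Icc 0 t ⊆ Icc 0 T := Icc_subset_Icc_right ht.2
  have hsub' : Ioc 0 t ⊆ Ioc 0 T := Ioc_subset_Ioc_right ht.2
  exact h0 (ODE_solution_unique_of_mem_Icc_left (s := fun _ => U)
    (fun t _ => hv.lipschitzOnWith t)
    (hα.continuousOn.mono hsub) (fun s hs => hα.hasDerivWithinAt_Iic s (hsub' hs))
    (fun s hs => (hα s (hsub (Ioc_subset_Icc_self hs))).2)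
    (hβ.continuousOn.mono hsub) (fun s hs => hβ.hasDerivWithinAt_Iic s (hsub' hs))
    (fun s hs => (hβ s (hsub (Ioc_subset_Icc_self hs))).2) he (left_mem_Icc.2 ht.1))

theorem IsHolomorphicField.dist_le (hv : IsHolomorphicField v U L K) (hα : IsSolutionOn v U T α)
    (hβ : IsSolutionOn v U T β) :
    ∀ t ∈ Icc 0 T, dist (α t) (β t) ≤ dist (α 0) (β 0) * Real.exp (K * (t - 0)) :=
  dist_le_of_trajectories_ODE_of_mem (s := fun _ => U) (fun t _ => hv.lipschitzOnWith t)
    hα.continuousOn hα.hasDerivWithinAt_Ici (fun t ht => (hα t (Ico_subset_Icc_self ht)).2)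
    hβ.continuousOn hβ.hasDerivWithinAt_Ici (fun t ht => (hβ t (Ico_subset_Icc_self ht)).2) le_rfl

theorem IsHolomorphicField.continuousOn_comp (hv : IsHolomorphicField v U L K)
    (hα : IsSolutionOn v U T α) : ContinuousOn (fun t => v t (α t)) (Icc 0 T) :=
  hv.continuousOn.comp (continuousOn_id.prodMk hα.continuousOn)
    fun t ht => ⟨mem_univ _, (hα t ht).2⟩

theorem IsHolomorphicField.exists_isSolutionOn (hv : IsHolomorphicField v U L K) (hT : 0 ≤ T)
    {z : ℂ} (hz : closedBall z (L * T) ⊆ U) :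
    ∃ α : ℝ → ℂ, α 0 = z ∧ IsSolutionOn v U T α ∧ ∀ t ∈ Icc 0 T, α t ∈ closedBall z (L * T) := by
  have hLT : ((L * ⟨T, hT⟩ : ℝ≥0) : ℝ) = L * T := NNReal.coe_mul _ _
  have hpl : IsPicardLindelof v (tmin := 0) (tmax := T) ⟨0, left_mem_Icc.2 hT⟩ z
      (L * ⟨T, hT⟩) 0 L K :=
    { lipschitzOnWith := fun t _ => (hv.lipschitzOnWith t).mono (hLT ▸ hz)
      continuousOn := fun x hx => hv.continuousOn.comp
        (f := fun t => (t, x)) (by fun_prop) fun t _ => ⟨mem_univ _, hz (hLT ▸ hx)⟩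
      norm_le := fun t _ x hx => hv.norm_le t x (hz (hLT ▸ hx))
      mul_max_le := by simp [hT, hLT] }
  obtain ⟨α, hα⟩ := ODE.FunSpace.exists_isFixedPt_next hpl (mem_closedBall_self le_rfl)
  have hmem : ∀ t, α.compProj t ∈ closedBall z (L * T) := fun t =>
    hLT ▸ α.compProj_mem_closedBall hpl.mul_max_le
  refine ⟨α.compProj, ?_, fun t ht => ⟨?_, hz (hmem t)⟩, fun t _ => hmem t⟩
  · have h := ODE.FunSpace.compProj_val (α := α) (t := ⟨0, left_mem_Icc.2 hT⟩)
    rw [← hα, ODE.FunSpace.next_apply₀, hα] at h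
    exact h
  · refine (ODE.hasDerivWithinAt_picard_Icc (left_mem_Icc.2 hT) hpl.continuousOn_uncurry
      α.continuous_compProj.continuousOn (fun _ _ => hmem _) z ht).congr_of_mem ?_ ht
    intro t' ht'
    nth_rw 1 [← hα]
    rw [ODE.FunSpace.compProj_of_mem ht', ODE.FunSpace.next_apply]

theorem IsHolomorphicField.sub_eq_mul_exp (hv : IsHolomorphicField v U L K) (hT : 0 ≤ T)
    (hα : IsSolutionOn v U T α) (hβ : IsSolutionOn v U T β) (h0 : α 0 ≠ β 0) :
    β T - α T = (β 0 - α 0) * Complex.exp (∫ t in (0 : ℝ)..T, slope (v t) (α t) (β t)) := by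
  have hne := hv.ne hα hβ h0
  have hm : ContinuousOn (fun t => slope (v t) (α t) (β t)) (Icc 0 T) := by
    simp only [slope_def_field]
    exact ((hv.continuousOn_comp hβ).sub (hv.continuousOn_comp hα)).div
      (hβ.continuousOn.sub hα.continuousOn) fun t ht => sub_ne_zero.2 (hne t ht).symm
  set m := fun t => slope (v t) (α t) (β t) with hmdef
  have hint : IntervalIntegrable m MeasureTheory.volume 0 T :=
    (hm.mono (by rw [uIcc_of_le hT])).intervalIntegrable
  have hd : ∀ t ∈ Ioo 0 T, HasDerivAt
      (fun t => (β t - α t) * Complex.exp (-∫ s in (0 : ℝ)..t, m s)) 0 t := by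
    intro t ht
    have hnhds : Icc 0 T ∈ 𝓝 t := Icc_mem_nhds ht.1 ht.2
    have e1 := ((hβ t (Ioo_subset_Icc_self ht)).1.hasDerivAt hnhds).sub
      ((hα t (Ioo_subset_Icc_self ht)).1.hasDerivAt hnhds)
    have e2 : HasDerivAt (fun u => ∫ s in (0 : ℝ)..u, m s) (m t) t := by
      refine intervalIntegral.integral_hasDerivAt_right ?_ ?_ (hm.continuousAt hnhds)
      · exact hint.mono_set (by
          rw [uIcc_of_le hT, uIcc_of_le ht.1.le]; exact Icc_subset_Icc_right ht.2.le)
      · exact (hm.mono Ioo_subset_Icc_self).stronglyMeasurableAtFilter isOpen_Ioo t ht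
    refine (e1.mul e2.neg.cexp).congr_deriv ?_
    have hs : v t (β t) - v t (α t) = m t * (β t - α t) := by
      simp only [hmdef, slope_def_field]
      rw [div_mul_cancel₀ _ (sub_ne_zero.2 (hne t (Ioo_subset_Icc_self ht)).symm)]
    simp only [Pi.sub_apply, Pi.neg_apply]
    rw [hs]; ring
  have hc : ContinuousOn (fun t => (β t - α t) * Complex.exp (-∫ s in (0 : ℝ)..t, m s))
      (Icc 0 T) := by
    refine (hβ.continuousOn.sub hα.continuousOn).mul (Complex.continuous_exp.comp_continuousOn ?_)
    have := intervalIntegral.continuousOn_primitive_interval' hint (left_mem_uIcc)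
    rw [uIcc_of_le hT] at this
    exact this.neg
  have hconst := constant_of_has_deriv_right_zero hc (fun t ht => ?_) T (right_mem_Icc.2 hT)
  · simp only [intervalIntegral.integral_same, neg_zero, Complex.exp_zero, mul_one] at hconst
    rw [← hconst, mul_assoc, ← Complex.exp_add]
    simp
  · rcases eq_or_lt_of_le ht.1 with rfl | h
    · have hT' : 0 < T := ht.2
      have e1 := (hβ.hasDerivWithinAt_Ici 0 ⟨le_rfl, hT'⟩).sub
        (hα.hasDerivWithinAt_Ici 0 ⟨le_rfl, hT'⟩)
      have e2 : HasDerivWithinAt (fun u => ∫ s in (0 : ℝ)..u, m s) (m 0) (Ici 0) 0 := by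
        refine intervalIntegral.integral_hasDerivWithinAt_right (t := Ioi 0) (by simp) ?_ ?_
        · exact ⟨Icc 0 T, mem_of_superset (Ioo_mem_nhdsGT hT') Ioo_subset_Icc_self,
            hm.aestronglyMeasurable measurableSet_Icc⟩
        · exact (hm 0 (left_mem_Icc.2 hT)).mono_of_mem_nhdsWithin
            (mem_of_superset (Ioo_mem_nhdsGT hT') Ioo_subset_Icc_self)
      refine (e1.mul e2.neg.cexp).congr_deriv ?_
      have hs : v 0 (β 0) - v 0 (α 0) = m 0 * (β 0 - α 0) := by
        simp only [hmdef, slope_def_field]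
        rw [div_mul_cancel₀ _ (sub_ne_zero.2 h0.symm)]
      simp only [Pi.sub_apply, Pi.neg_apply]
      rw [hs]; ring
    · exact (hd t ⟨h, ht.2⟩).hasDerivWithinAt

/-- The time-`T` map of a holomorphic field is holomorphic. -/
theorem IsHolomorphicField.differentiableAt_flow (hv : IsHolomorphicField v U L K) (hT : 0 ≤ T)
    {V : Set ℂ} (hV : IsOpen V) {u : ℂ → ℝ → ℂ} (hu0 : ∀ z ∈ V, u z 0 = z)
    (hu : ∀ z ∈ V, IsSolutionOn v U T (u z)) {z₀ : ℂ} (hz₀ : z₀ ∈ V) :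
    DifferentiableAt ℂ (fun z => u z T) z₀ := by
  have hVn : ∀ᶠ z in 𝓝[≠] z₀, z ∈ V ∧ z ≠ z₀ :=
    (eventually_nhdsWithin_of_eventually_nhds (hV.mem_nhds hz₀)).and self_mem_nhdsWithin
  have hlim : ∀ t ∈ Icc 0 T, Tendsto (fun z => u z t) (𝓝[≠] z₀) (𝓝[≠] (u z₀ t)) := by
    intro t ht
    refine tendsto_nhdsWithin_iff.2 ⟨?_, ?_⟩
    · rw [tendsto_iff_dist_tendsto_zero]
      refine squeeze_zero' (Eventually.of_forall fun _ => dist_nonneg)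
        (g := fun z => dist z z₀ * Real.exp (K * (t - 0))) ?_ ?_
      · filter_upwards [hVn] with z hz
        have := hv.dist_le (hu z hz.1) (hu z₀ hz₀) t ht
        rwa [hu0 z hz.1, hu0 z₀ hz₀] at this
      · have : Tendsto (fun z => dist z z₀ * Real.exp (K * (t - 0))) (𝓝 z₀)
            (𝓝 (dist z₀ z₀ * Real.exp (K * (t - 0)))) := by
          apply Continuous.tendsto; fun_prop
        rw [dist_self, zero_mul] at this
        exact this.mono_left nhdsWithin_le_nhds
    · filter_upwards [hVn] with z hz
      exact hv.ne (hu z hz.1) (hu z₀ hz₀) (by rw [hu0 z hz.1, hu0 z₀ hz₀]; exact hz.2) t ht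
  have hI : Tendsto (fun z => ∫ t in (0 : ℝ)..T, slope (v t) (u z₀ t) (u z t)) (𝓝[≠] z₀)
      (𝓝 (∫ t in (0 : ℝ)..T, deriv (v t) (u z₀ t))) := by
    refine intervalIntegral.tendsto_integral_filter_of_dominated_convergence (fun _ => (K : ℝ))
      ?_ ?_ (by simp) ?_
    · filter_upwards [hVn] with z hz
      have hne := hv.ne (hu z hz.1) (hu z₀ hz₀) (by rw [hu0 z hz.1, hu0 z₀ hz₀]; exact hz.2)
      have hm : ContinuousOn (fun t => slope (v t) (u z₀ t) (u z t)) (Icc 0 T) := by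
        simp only [slope_def_field]
        exact ((hv.continuousOn_comp (hu z hz.1)).sub (hv.continuousOn_comp (hu z₀ hz₀))).div
          ((hu z hz.1).continuousOn.sub (hu z₀ hz₀).continuousOn)
          fun t ht => sub_ne_zero.2 (hne t ht)
      refine (hm.mono ?_).aestronglyMeasurable measurableSet_uIoc
      rw [uIoc_of_le hT]; exact Ioc_subset_Icc_self
    · filter_upwards [hVn] with z hz
      refine Eventually.of_forall fun t ht => ?_
      rw [uIoc_of_le hT] at ht
      have ht := Ioc_subset_Icc_self ht
      have h1 := (hv.lipschitzOnWith t).dist_le_mul _ (hu z hz.1 t ht).2 _ (hu z₀ hz₀ t ht).2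
      rw [dist_eq_norm, dist_eq_norm] at h1
      rw [slope_def_field, norm_div]
      exact div_le_of_le_mul₀ (norm_nonneg _) K.2 h1
    · refine Eventually.of_forall fun t ht => ?_
      rw [uIoc_of_le hT] at ht
      have ht := Ioc_subset_Icc_self ht
      have hmem := (hu z₀ hz₀ t ht).2
      exact (((hv.differentiableOn t).differentiableAt
        (hv.isOpen.mem_nhds hmem)).hasDerivAt.tendsto_slope).comp (hlim t ht)
  refine (hasDerivAt_iff_tendsto_slope.2 ?_ : HasDerivAt (fun z => u z T)
    (Complex.exp (∫ t in (0 : ℝ)..T, deriv (v t) (u z₀ t))) z₀).differentiableAt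
  refine ((Complex.continuous_exp.tendsto _).comp hI).congr' ?_
  filter_upwards [hVn] with z hz
  rw [slope_def_field, hv.sub_eq_mul_exp hT (hu z₀ hz₀) (hu z hz.1)
    (by rw [hu0 z hz.1, hu0 z₀ hz₀]; exact hz.2.symm), hu0 z hz.1, hu0 z₀ hz₀,
    mul_div_cancel_left₀ _ (sub_ne_zero.2 hz.2)]
  rfl

theorem IsSolutionOn.integral_eq (hv : IsHolomorphicField v U L K) (hT : 0 ≤ T)
    (hα : IsSolutionOn v U T α) : ∫ t in (0 : ℝ)..T, v t (α t) = α T - α 0 := by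
  refine intervalIntegral.integral_eq_sub_of_hasDeriv_right ?_ ?_ ?_
  · rw [uIcc_of_le hT]; exact hα.continuousOn
  · rw [min_eq_left hT, max_eq_right hT]
    exact fun t ht => (hα.hasDerivWithinAt_Ici t (Ioo_subset_Ico_self ht)).mono Ioi_subset_Ici_self
  · have := hv.continuousOn_comp hα
    rw [← uIcc_of_le hT] at this
    exact this.intervalIntegrable

end CubicDL

end

noncomputable section

namespace CubicDL

/-- Iterated Rolle: a function whose `k`-th derivative has no zero on an interval has at most `k`
zeros there. -/
theorem encard_zeros_le_of_iterated_deriv_ne_zero {s : Set ℝ} (hs : s.OrdConnected) (k : ℕ) :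
    ∀ φ : ℕ → ℝ → ℝ, (∀ j, ∀ x ∈ s, HasDerivAt (φ j) (φ (j + 1) x) x) →
      (∀ x ∈ s, φ k x ≠ 0) → {x | x ∈ s ∧ φ 0 x = 0}.encard ≤ k := by
  induction k with
  | zero =>
    intro φ _ h0
    have : {x | x ∈ s ∧ φ 0 x = 0} = ∅ := eq_empty_of_forall_notMem fun x hx => h0 x hx.1 hx.2
    simp [this]
  | succ k ih =>
    intro φ hd h0
    have h1 := ih (fun j => φ (j + 1)) (fun j => hd (j + 1)) h0
    have hfin := finite_of_encard_le_coe h1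
    by_contra! hlt
    obtain ⟨t, hts, htc⟩ := exists_subset_encard_eq (Order.add_one_le_of_lt hlt)
    have htf : t.Finite := finite_of_encard_eq_coe (k := k + 1 + 1) (by rw [htc]; rfl)
    have h2 := Finset.card_le_of_interleaved (s := htf.toFinset) (t := hfin.toFinset)
      fun x hx y hy hxy _ => by
        have hx' := hts (htf.mem_toFinset.1 hx)
        have hy' := hts (htf.mem_toFinset.1 hy)
        have hsub : Icc x y ⊆ s := hs.out hx'.1 hy'.1
        obtain ⟨z, hz, hz0⟩ := exists_hasDerivAt_eq_zero hxy
          (fun u hu => (hd 0 u (hsub hu)).continuousAt.continuousWithinAt)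
          (hx'.2.trans hy'.2.symm) (fun u hu => hd 0 u (hsub (Ioo_subset_Icc_self hu)))
        exact ⟨z, hfin.mem_toFinset.2 ⟨hsub (Ioo_subset_Icc_self hz), hz0⟩, hz⟩
    rw [htf.encard_eq_coe_toFinset_card] at htc
    rw [hfin.encard_eq_coe_toFinset_card] at h1
    norm_cast at htc h1
    omega

open Polynomial Metric

variable {l : Filter ℝ} {V : Set ℂ} {H : ℝ → ℂ → ℂ} {H₀ : ℂ → ℂ}

theorem DifferentiableOn.iterate_deriv {F : ℂ → ℂ} (hV : IsOpen V) (hF : DifferentiableOn ℂ F V)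
    (k : ℕ) : DifferentiableOn ℂ (deriv^[k] F) V := by
  induction k with
  | zero => exact hF
  | succ k ih => rw [Function.iterate_succ_apply']; exact ih.deriv hV

theorem TendstoLocallyUniformlyOn.iterate_deriv (hV : IsOpen V)
    (hH : ∀ᶠ ε in l, DifferentiableOn ℂ (H ε) V) (hlim : TendstoLocallyUniformlyOn H H₀ l V)
    (k : ℕ) : TendstoLocallyUniformlyOn (fun ε => deriv^[k] (H ε)) (deriv^[k] H₀) l V := by
  induction k with
  | zero => exact hlim
  | succ k ih =>
    simp only [Function.iterate_succ_apply']
    exact ih.deriv (hH.mono fun ε h => DifferentiableOn.iterate_deriv hV h k) hV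

theorem iterate_deriv_polynomial (P : ℂ[X]) (k : ℕ) :
    deriv^[k] (fun z => P.eval z) = fun z => (derivative^[k] P).eval z := by
  induction k with
  | zero => rfl
  | succ k ih =>
    rw [Function.iterate_succ_apply', ih, Function.iterate_succ_apply']
    ext z; simp

theorem iterate_deriv_eq_of_eq_on_reals (hV : IsOpen V) (hH₀ : DifferentiableOn ℂ H₀ V) {W : ℝ[X]}
    (hreal : ∀ x : ℝ, (x : ℂ) ∈ V → H₀ x = ((W.eval x : ℝ) : ℂ)) {p : ℝ} (hp : (p : ℂ) ∈ V)
    (k : ℕ) : deriv^[k] H₀ p = (((derivative^[k] W).eval p : ℝ) : ℂ) := by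
  set P : ℂ[X] := W.map Complex.ofRealHom with hP
  have hev : ∀ (Q : ℝ[X]) (x : ℝ), (Q.map Complex.ofRealHom).eval (x : ℂ) = ((Q.eval x : ℝ) : ℂ) :=
    fun Q x => by
      have := eval_map_apply (f := Complex.ofRealHom) (p := Q) x
      simpa using this
  have hA : AnalyticAt ℂ H₀ p := hH₀.analyticAt (hV.mem_nhds hp)
  have hB : AnalyticAt ℂ (fun z => P.eval z) (p : ℂ) :=
    (Polynomial.differentiable P).analyticAt _
  have hfreq : ∃ᶠ z in 𝓝[≠] (p : ℂ), H₀ z = P.eval z := by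
    have hmap : Tendsto (fun x : ℝ => (x : ℂ)) (𝓝[≠] p) (𝓝[≠] (p : ℂ)) :=
      tendsto_nhdsWithin_iff.2 ⟨Complex.continuous_ofReal.continuousAt.mono_left nhdsWithin_le_nhds,
        by filter_upwards [self_mem_nhdsWithin] with x hx; simpa using hx⟩
    refine hmap.frequently (Eventually.frequently ?_)
    have : ∀ᶠ x : ℝ in 𝓝 p, (x : ℂ) ∈ V :=
      Complex.continuous_ofReal.continuousAt.eventually (hV.mem_nhds hp)
    filter_upwards [nhdsWithin_le_nhds this] with x hx
    rw [hreal x hx, hP, hev]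
  have heq : H₀ =ᶠ[𝓝 (p : ℂ)] fun z => P.eval z := (hA.frequently_eq_iff_eventually_eq hB).1 hfreq
  have hk : deriv^[k] H₀ =ᶠ[𝓝 (p : ℂ)] deriv^[k] (fun z => P.eval z) := by
    induction k with
    | zero => exact heq
    | succ k ih => rw [Function.iterate_succ_apply', Function.iterate_succ_apply']; exact ih.deriv
  rw [hk.eq_of_nhds, iterate_deriv_polynomial, hP, iterate_derivative_map]
  exact hev _ p

theorem exists_eventually_encard_zeros_le [l.NeBot] (hV : IsOpen V)
    (hH : ∀ᶠ ε in l, DifferentiableOn ℂ (H ε) V) (hlim : TendstoLocallyUniformlyOn H H₀ l V)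
    {W : ℝ[X]} (hW : W ≠ 0) (hreal : ∀ x : ℝ, (x : ℂ) ∈ V → H₀ x = ((W.eval x : ℝ) : ℂ)) {p : ℝ}
    (hp : (p : ℂ) ∈ V) :
    ∃ N ∈ 𝓝 p, ∀ᶠ ε in l, {x | x ∈ N ∧ H ε (x : ℂ) = 0}.encard ≤ W.rootMultiplicity p := by
  set k := W.rootMultiplicity p with hk
  have hH₀ : DifferentiableOn ℂ H₀ V := hlim.differentiableOn hH hV
  set c : ℝ := (derivative^[k] W).eval p with hc
  have hc0 : c ≠ 0 := by
    rw [hc, hk, eval_iterate_derivative_rootMultiplicity, nsmul_eq_mul]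
    exact mul_ne_zero (by exact_mod_cast Nat.factorial_ne_zero _)
      (eval_divByMonic_pow_rootMultiplicity_ne_zero p hW)
  have hck : deriv^[k] H₀ p = (c : ℂ) := iterate_deriv_eq_of_eq_on_reals hV hH₀ hreal hp k
  have hcont : ContinuousAt (deriv^[k] H₀) (p : ℂ) :=
    ((DifferentiableOn.iterate_deriv hV hH₀ k).differentiableAt (hV.mem_nhds hp)).continuousAt
  have hpos : 0 < |c| / 2 := by have := abs_pos.2 hc0; positivity
  obtain ⟨t, ht, htl⟩ := Metric.tendstoLocallyUniformlyOn_iff.1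
    (TendstoLocallyUniformlyOn.iterate_deriv hV hH hlim k) _ hpos p hp
  rw [hV.nhdsWithin_eq hp] at ht
  have hnear := Metric.tendsto_nhds.1 hcont _ hpos
  have hall : ∀ᶠ z in 𝓝 (p : ℂ), z ∈ t ∧ z ∈ V ∧ dist (deriv^[k] H₀ z) (deriv^[k] H₀ p) < |c| / 2 :=
    (eventually_mem_set.2 ht).and ((eventually_mem_set.2 (hV.mem_nhds hp)).and hnear)
  have hall' := (Complex.continuous_ofReal.continuousAt (x := p)).eventually hall
  obtain ⟨η, hη, hball⟩ := Metric.eventually_nhds_iff_ball.1 hall'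
  refine ⟨ball p η, ball_mem_nhds p hη, ?_⟩
  filter_upwards [htl, hH] with ε hε hd
  have hzero := encard_zeros_le_of_iterated_deriv_ne_zero (s := ball p η)
    (by rw [Real.ball_eq_Ioo]; exact ordConnected_Ioo) k
    (fun j x => (deriv^[j] (H ε) (x : ℂ)).re) (fun j x hx => ?_) (fun x hx => ?_)
  · refine (encard_le_encard ?_).trans hzero
    rintro x ⟨hx, hx0⟩
    exact ⟨hx, by simp [hx0]⟩
  · have h1 := ((DifferentiableOn.iterate_deriv hV hd j).differentiableAt
      (hV.mem_nhds (hball x hx).2.1)).hasDerivAt.real_of_complex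
    rw [← Function.iterate_succ_apply' deriv j] at h1
    exact h1
  · intro h0
    have h1 := hε x (hball x hx).1
    have h2 := (hball x hx).2.2
    rw [hck] at h2
    have h3 : dist ((deriv^[k] (H ε)) (x : ℂ)) (c : ℂ) < |c| :=
      (dist_triangle_left _ _ _).trans_lt (by linarith)
    rw [dist_eq_norm] at h3
    have h4 := (Complex.abs_re_le_norm _).trans_lt h3
    rw [Complex.sub_re, h0, Complex.ofReal_re, zero_sub, abs_neg] at h4
    exact lt_irrefl _ h4

/-- If holomorphic functions converge locally uniformly to a function that restricts to a real
polynomial `W`, then eventually they have at most as many zeros in a compact interval as `W`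
has there, counted with multiplicity. -/
theorem eventually_encard_zeros_le [l.NeBot] (hV : IsOpen V)
    (hH : ∀ᶠ ε in l, DifferentiableOn ℂ (H ε) V) (hlim : TendstoLocallyUniformlyOn H H₀ l V)
    {W : ℝ[X]} (hW : W ≠ 0) (hreal : ∀ x : ℝ, (x : ℂ) ∈ V → H₀ x = ((W.eval x : ℝ) : ℂ)) {K : Set ℝ}
    (hK : IsCompact K) (hKV : ∀ x ∈ K, (x : ℂ) ∈ V) {m : Set ℝ} [DecidablePred (· ∈ m)]
    (hKm : K ⊆ m) :
    ∀ᶠ ε in l, {x | x ∈ K ∧ H ε (x : ℂ) = 0}.encard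
      ≤ (W.roots.filter (fun w => w ∈ m)).card := by
  choose! N hN hNl using fun p hp =>
    exists_eventually_encard_zeros_le hV hH hlim hW hreal (hKV p hp)
  obtain ⟨t, htK, hcov⟩ := hK.elim_nhds_subcover N hN
  have hev : ∀ᶠ ε in l, ∀ p ∈ t, {x | x ∈ N p ∧ H ε (x : ℂ) = 0}.encard ≤ W.rootMultiplicity p :=
    (Finset.eventually_all t).2 fun p hp => hNl p (htK p hp)
  filter_upwards [hev] with ε hε
  have h1 : {x | x ∈ K ∧ H ε (x : ℂ) = 0} ⊆ ⋃ p ∈ t, {x | x ∈ N p ∧ H ε (x : ℂ) = 0} := by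
    rintro x ⟨hx, hx0⟩
    obtain ⟨p, hp, hxp⟩ := mem_iUnion₂.1 (hcov hx)
    exact mem_iUnion₂.2 ⟨p, hp, hxp, hx0⟩
  refine (encard_le_encard h1).trans ((Finset.set_encard_biUnion_le _ _).trans
    ((Finset.sum_le_sum hε).trans ?_))
  norm_cast
  classical
  have h2 : ∀ p ∈ t, W.rootMultiplicity p = (W.roots.filter (fun w => w ∈ m)).count p := by
    intro p hp
    rw [Multiset.count_filter, if_pos (hKm (htK p hp)), count_roots]
  rw [Finset.sum_congr rfl h2]
  refine (Finset.sum_le_sum_of_subset (Finset.subset_union_left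
    (s₂ := (W.roots.filter (fun w => w ∈ m)).toFinset))).trans
    (Multiset.sum_count_eq_card fun x hx => ?_).le
  exact Finset.mem_union_right _ (Multiset.mem_toFinset.2 hx)

end CubicDL

end

noncomputable section

namespace CubicDL

theorem IsSolution.continuous {X : ℝ × ℝ → ℝ × ℝ} {γ : ℝ → ℝ × ℝ} (h : IsSolution X γ) :
    Continuous γ := continuous_iff_continuousAt.2 fun t => (h t).continuousAt

/-- Periodic orbits do not change when the field is divided by a positive function. -/
theorem IsPeriodicOrbit.of_smul {X Y : ℝ × ℝ → ℝ × ℝ} {Γ S : Set (ℝ × ℝ)}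
    (h : IsPeriodicOrbit X Γ) (hΓ : Γ ⊆ S) {c : ℝ × ℝ → ℝ} (hc : ContinuousOn c S)
    (hpos : ∀ p ∈ S, 0 < c p) (hXY : ∀ p ∈ S, X p = c p • Y p) : IsPeriodicOrbit Y Γ := by
  obtain ⟨γ, T, hT, hγ, hper, ⟨t₁, ht₁⟩, rfl⟩ := h
  have hmem : ∀ t, γ t ∈ S := fun t => hΓ (mem_range_self t)
  set m : ℝ → ℝ := fun t => c (γ t) with hm
  have hmc : Continuous m := hc.comp_continuous hγ.continuous hmem
  have hmper : Function.Periodic m T := fun t => by simp only [hm, hper]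
  have hmpos : ∀ t, 0 < m t := fun t => hpos _ (hmem t)
  obtain ⟨t₀, -, ht₀⟩ := (isCompact_Icc (a := (0 : ℝ)) (b := T)).exists_isMinOn
    (nonempty_Icc.2 hT.le) hmc.continuousOn
  have hbound : ∀ t, m t₀ ≤ m t := fun t => by
    obtain ⟨s, hs, hst⟩ := hmper.exists_mem_Ico₀ hT t
    rw [hst]; exact ht₀ (Ico_subset_Icc_self hs)
  set σ : ℝ → ℝ := fun t => ∫ s in (0 : ℝ)..t, m s with hσ
  have hσd : ∀ t, HasDerivAt σ (m t) t := fun t => hmc.integral_hasStrictDerivAt 0 t |>.hasDerivAt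
  have hσc : Continuous σ := continuous_iff_continuousAt.2 fun t => (hσd t).continuousAt
  have hσm : StrictMono σ := strictMono_of_hasDerivAt_pos hσd hmpos
  have hσ0 : σ 0 = 0 := by simp [hσ]
  have hmono : Monotone fun t => σ t - m t₀ * t :=
    monotone_of_hasDerivAt_nonneg (f' := fun t => m t - m t₀ * 1)
      (fun t => (hσd t).sub ((hasDerivAt_id t).const_mul (m t₀))) fun t => by
        simpa using hbound t
  have hσs : Function.Surjective σ := by
    refine hσc.surjective ?_ ?_
    · refine tendsto_atTop_mono' _ ?_ (tendsto_id.const_mul_atTop (hmpos t₀))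
      filter_upwards [eventually_ge_atTop 0] with t ht
      have := hmono ht
      simp only [hσ0, id] at this ⊢
      linarith
    · refine tendsto_atBot_mono' _ ?_ (tendsto_id.const_mul_atBot (hmpos t₀))
      filter_upwards [eventually_le_atBot 0] with t ht
      have := hmono ht
      simp only [hσ0, id] at this ⊢
      linarith
  set e : ℝ ≃o ℝ := hσm.orderIsoOfSurjective σ hσs with he
  have heσ : ∀ t, e t = σ t := fun t => rfl
  have hστ : ∀ s, σ (e.symm s) = s := fun s => e.apply_symm_apply s
  have hτσ : ∀ t, e.symm (σ t) = t := fun t => e.symm_apply_apply t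
  have hτd : ∀ s, HasDerivAt e.symm (m (e.symm s))⁻¹ s := fun s =>
    HasDerivAt.of_local_left_inverse e.symm.continuous.continuousAt (hσd _) (hmpos _).ne'
      (Eventually.of_forall hστ)
  have hσT : ∀ t, σ (t + T) = σ t + σ T := fun t => by
    have := hmper.intervalIntegral_add_eq_add 0 t fun _ _ => hmc.intervalIntegrable _ _
    simpa [hσ] using this
  refine ⟨fun s => γ (e.symm s), σ T, ?_, fun s => ?_, fun s => ?_, ⟨σ t₁, ?_⟩, ?_⟩
  · rw [← hσ0]; exact hσm hT
  · have h1 := HasDerivAt.scomp s (hγ (e.symm s)) (hτd s)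
    refine h1.congr_deriv ?_
    rw [hXY _ (hmem _), smul_smul, inv_mul_cancel₀ (hmpos _).ne', one_smul]
  · have : e.symm (s + σ T) = e.symm s + T := by
      rw [← hτσ (e.symm s + T), hσT, hστ]
    simp only [this, hper]
  · have : e.symm 0 = 0 := by have := hτσ 0; rwa [hσ0] at this
    simp only [hτσ, this]; exact ht₁
  · exact (e.symm.surjective.range_comp γ).symm

theorem exists_cos_sin_eq {u v : ℝ} (h : u ^ 2 + v ^ 2 = 1) :
    ∃ θ, u = Real.cos θ ∧ v = Real.sin θ := by
  have hn : ‖(⟨u, v⟩ : ℂ)‖ = 1 := by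
    rw [← sq_eq_sq₀ (norm_nonneg _) zero_le_one, ← Complex.normSq_eq_norm_sq,
      Complex.normSq_apply]
    simp only; linarith
  have h0 : (⟨u, v⟩ : ℂ) ≠ 0 := by rw [← norm_pos_iff, hn]; exact one_pos
  refine ⟨Complex.arg ⟨u, v⟩, ?_, ?_⟩
  · rw [Complex.cos_arg h0, hn, div_one]
  · rw [Complex.sin_arg, hn, div_one]

/-- In polar coordinates, the field `Y` is `r' = G θ r`, `θ' = 1` on `ρ₁ ≤ r ≤ ρ₂`. -/
def IsPolarField (Y : ℝ × ℝ → ℝ × ℝ) (G : ℝ → ℝ → ℝ) (ρ₁ ρ₂ : ℝ) : Prop :=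
  ∀ r ∈ Icc ρ₁ ρ₂, ∀ φ, Y (r * Real.cos φ, r * Real.sin φ)
    = (G φ r * Real.cos φ - r * Real.sin φ, G φ r * Real.sin φ + r * Real.cos φ)

/-- The curve with polar equation `r = R θ`. -/
def polarCurve (R : ℝ → ℝ) (t : ℝ) : ℝ × ℝ := (R t * Real.cos t, R t * Real.sin t)

/-- Solutions of `r' = G θ r` with values in `[ρ₁, ρ₂]`. -/
def IsRadialSolution (G : ℝ → ℝ → ℝ) (ρ₁ ρ₂ : ℝ) (R : ℝ → ℝ) : Prop :=
  ∀ t, HasDerivAt R (G t (R t)) t ∧ R t ∈ Icc ρ₁ ρ₂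

variable {Y : ℝ × ℝ → ℝ × ℝ} {G : ℝ → ℝ → ℝ} {ρ₁ ρ₂ : ℝ} {R : ℝ → ℝ}

theorem IsRadialSolution.continuous (h : IsRadialSolution G ρ₁ ρ₂ R) : Continuous R :=
  continuous_iff_continuousAt.2 fun t => (h t).1.continuousAt

theorem IsRadialSolution.isSolution (hY : IsPolarField Y G ρ₁ ρ₂)
    (h : IsRadialSolution G ρ₁ ρ₂ R) : IsSolution Y (polarCurve R) := fun t => by
  have h1 := ((h t).1.mul (Real.hasDerivAt_cos t)).prodMk ((h t).1.mul (Real.hasDerivAt_sin t))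
  refine h1.congr_deriv ?_
  rw [polarCurve, hY _ (h t).2]
  exact Prod.ext (by ring) (by ring)

theorem polarCurve_sq (R : ℝ → ℝ) (t : ℝ) :
    (polarCurve R t).1 ^ 2 + (polarCurve R t).2 ^ 2 = R t ^ 2 := by
  have := Real.sin_sq_add_cos_sq t
  simp only [polarCurve]
  linear_combination R t ^ 2 * this

theorem IsRadialSolution.range_subset_annulus (hρ : 0 < ρ₁) (h : IsRadialSolution G ρ₁ ρ₂ R) :
    range (polarCurve R) ⊆ annulus ρ₁ ρ₂ := by
  rintro _ ⟨t, rfl⟩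
  have h1 := (h t).2
  rw [annulus, mem_ofPred_eq, polarCurve_sq]
  exact ⟨pow_le_pow_left₀ hρ.le h1.1 2, pow_le_pow_left₀ (hρ.le.trans h1.1) h1.2 2⟩

theorem IsRadialSolution.isPeriodicOrbit (hρ : 0 < ρ₁) (hY : IsPolarField Y G ρ₁ ρ₂)
    (h : IsRadialSolution G ρ₁ ρ₂ R) (hper : Function.Periodic R (2 * Real.pi)) :
    IsPeriodicOrbit Y (range (polarCurve R)) := by
  refine ⟨polarCurve R, 2 * Real.pi, Real.two_pi_pos, h.isSolution hY, fun t => ?_,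
    ⟨Real.pi, fun he => ?_⟩, rfl⟩
  · simp only [polarCurve, hper t, Real.cos_add_two_pi, Real.sin_add_two_pi]
  · have h1 := congrArg Prod.fst he
    simp only [polarCurve, Real.cos_pi, Real.cos_zero] at h1
    have h2 := (h Real.pi).2.1
    have h3 := (h 0).2.1
    linarith

theorem mem_annulus_iff {p : ℝ × ℝ} (hρ : 0 < ρ₁) (hρ' : ρ₁ ≤ ρ₂) :
    p ∈ annulus ρ₁ ρ₂ ↔ √(p.1 ^ 2 + p.2 ^ 2) ∈ Icc ρ₁ ρ₂ := by
  rw [annulus, mem_ofPred_eq, mem_Icc, Real.le_sqrt' hρ, Real.sqrt_le_left (hρ.le.trans hρ')]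

theorem exists_eq_polar (p : ℝ × ℝ) (hp : 0 < p.1 ^ 2 + p.2 ^ 2) :
    ∃ θ, p = (√(p.1 ^ 2 + p.2 ^ 2) * Real.cos θ, √(p.1 ^ 2 + p.2 ^ 2) * Real.sin θ) := by
  have h0 := Real.sqrt_pos.2 hp
  have h2 := Real.sq_sqrt hp.le
  set r := √(p.1 ^ 2 + p.2 ^ 2)
  obtain ⟨θ, h3, h4⟩ := exists_cos_sin_eq (u := p.1 / r) (v := p.2 / r) (by
    rw [div_pow, div_pow, ← add_div, h2]; exact div_self hp.ne')
  refine ⟨θ, ?_⟩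
  rw [← h3, ← h4]
  ext
  · simp only; field_simp
  · simp only; field_simp

/-- A solution of a field with `θ' = 1` in polar coordinates. -/
theorem IsPolarField.exists_radialSolution (hρ : 0 < ρ₁) (hρ' : ρ₁ ≤ ρ₂)
    (hY : IsPolarField Y G ρ₁ ρ₂) {η : ℝ → ℝ × ℝ} (hη : IsSolution Y η)
    (hmem : ∀ t, η t ∈ annulus ρ₁ ρ₂) :
    ∃ R θ₀, IsRadialSolution G ρ₁ ρ₂ R ∧ ∀ t, η t = polarCurve R (t + θ₀) := by
  set r : ℝ → ℝ := fun t => √((η t).1 ^ 2 + (η t).2 ^ 2) with hr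
  have hrI : ∀ t, r t ∈ Icc ρ₁ ρ₂ := fun t => (mem_annulus_iff hρ hρ').1 (hmem t)
  have hrpos : ∀ t, 0 < r t := fun t => hρ.trans_le (hrI t).1
  have hspos : ∀ t, 0 < (η t).1 ^ 2 + (η t).2 ^ 2 := fun t => Real.sqrt_pos.1 (hrpos t)
  have hrsq : ∀ t, r t ^ 2 = (η t).1 ^ 2 + (η t).2 ^ 2 := fun t => Real.sq_sqrt (hspos t).le
  have hd1 : ∀ t, HasDerivAt (fun t => (η t).1) (Y (η t)).1 t := fun t => (hη t).fst
  have hd2 : ∀ t, HasDerivAt (fun t => (η t).2) (Y (η t)).2 t := fun t => (hη t).snd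
  have hdr : ∀ t, ∀ φ, η t = (r t * Real.cos φ, r t * Real.sin φ) →
      HasDerivAt r (G φ (r t)) t := by
    intro t φ hφ
    have h1 := (((hd1 t).pow 2).add ((hd2 t).pow 2)).sqrt (hspos t).ne'
    refine h1.congr_deriv ?_
    have hY' := hY _ (hrI t) φ
    rw [← hφ] at hY'
    have e1 : (η t).1 = r t * Real.cos φ := congrArg Prod.fst hφ
    have e2 : (η t).2 = r t * Real.sin φ := congrArg Prod.snd hφ
    have hsq : √((η t).1 ^ 2 + (η t).2 ^ 2) = r t := rfl
    have hs := Real.sin_sq_add_cos_sq φ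
    have := hrpos t
    simp only [Pi.add_apply, Pi.pow_apply]
    rw [hsq, hY', e1, e2]
    field_simp
    linear_combination (2 * r t * G φ (r t)) * hs
  have hpq : ∀ t, HasDerivAt (fun t => (η t).1 / r t) (-((η t).2 / r t)) t ∧
      HasDerivAt (fun t => (η t).2 / r t) ((η t).1 / r t) t := by
    intro t
    obtain ⟨φ, hφ⟩ := exists_eq_polar (η t) (hspos t)
    have hφ : η t = (r t * Real.cos φ, r t * Real.sin φ) := hφ
    have hd := hdr t φ hφ
    have hY' := hY _ (hrI t) φ
    rw [← hφ] at hY'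
    have e1 : (η t).1 = r t * Real.cos φ := congrArg Prod.fst hφ
    have e2 : (η t).2 = r t * Real.sin φ := congrArg Prod.snd hφ
    have := hrpos t
    refine ⟨((hd1 t).div hd this.ne').congr_deriv ?_, ((hd2 t).div hd this.ne').congr_deriv ?_⟩
    all_goals
      rw [hY', e1, e2]
      field_simp
      ring
  have hu : ∀ t, HasDerivAt (fun t => (η t).1 / r t * Real.cos t + (η t).2 / r t * Real.sin t) 0 t :=
    fun t => by
      refine (((hpq t).1.mul (Real.hasDerivAt_cos t)).add
        ((hpq t).2.mul (Real.hasDerivAt_sin t))).congr_deriv ?_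
      ring
  have hw : ∀ t, HasDerivAt (fun t => (η t).2 / r t * Real.cos t - (η t).1 / r t * Real.sin t) 0 t :=
    fun t => by
      refine (((hpq t).2.mul (Real.hasDerivAt_cos t)).sub
        ((hpq t).1.mul (Real.hasDerivAt_sin t))).congr_deriv ?_
      ring
  have hu0 := fun t => is_const_of_deriv_eq_zero (fun t => (hu t).differentiableAt)
    (fun t => (hu t).deriv) t 0
  have hw0 := fun t => is_const_of_deriv_eq_zero (fun t => (hw t).differentiableAt)
    (fun t => (hw t).deriv) t 0
  simp only [Real.cos_zero, Real.sin_zero, mul_one, mul_zero, add_zero, sub_zero] at hu0 hw0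
  obtain ⟨θ₀, h1, h2⟩ := exists_cos_sin_eq (u := (η 0).1 / r 0) (v := (η 0).2 / r 0) (by
    rw [div_pow, div_pow, ← add_div, ← hrsq]; exact div_self (pow_ne_zero 2 (hrpos 0).ne'))
  have hform : ∀ t, η t = (r t * Real.cos (t + θ₀), r t * Real.sin (t + θ₀)) := by
    intro t
    have hs := Real.sin_sq_add_cos_sq t
    have e1 := hu0 t
    have e2 := hw0 t
    rw [h1] at e1
    rw [h2] at e2
    have h3 := (hrpos t).ne'
    have f1 : (η t).1 / r t = Real.cos (t + θ₀) := by
      rw [Real.cos_add, ← e1, ← e2]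
      linear_combination -((η t).1 / r t) * hs
    have f2 : (η t).2 / r t = Real.sin (t + θ₀) := by
      rw [Real.sin_add, ← e1, ← e2]
      linear_combination -((η t).2 / r t) * hs
    rw [← f1, ← f2]
    ext <;> simp only <;> field_simp
  refine ⟨fun t => r (t - θ₀), θ₀, fun t => ⟨?_, hrI _⟩, fun t => ?_⟩
  · have h3 := hdr (t - θ₀) t (by rw [hform (t - θ₀), sub_add_cancel])
    have h4 := HasDerivAt.comp_sub_const t θ₀ h3
    exact h4
  · simp only [polarCurve, add_sub_cancel_right]
    exact hform t

/-- The property that solutions of `r' = G θ r` in `[ρ₁, ρ₂]` are determined by one value. -/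
def HasUniqueness (G : ℝ → ℝ → ℝ) (ρ₁ ρ₂ : ℝ) : Prop :=
  ∀ R R' : ℝ → ℝ, IsRadialSolution G ρ₁ ρ₂ R → IsRadialSolution G ρ₁ ρ₂ R' →
    ∀ t₀, R t₀ = R' t₀ → R = R'

/-- A scalar equation with `2π`-periodic coefficients has no subharmonic solutions. -/
theorem IsRadialSolution.periodic (hu : HasUniqueness G ρ₁ ρ₂)
    (hG : ∀ t r, G (t + 2 * Real.pi) r = G t r) (h : IsRadialSolution G ρ₁ ρ₂ R) {k : ℕ}
    (hk : k ≠ 0) (hper : ∀ t, R (t + k * (2 * Real.pi)) = R t) :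
    Function.Periodic R (2 * Real.pi) := by
  have h' : IsRadialSolution G ρ₁ ρ₂ fun t => R (t + 2 * Real.pi) := fun t =>
    ⟨by
      have := HasDerivAt.comp_add_const t (2 * Real.pi) (h (t + 2 * Real.pi)).1
      rwa [hG] at this, (h _).2⟩
  by_contra hne
  have hne' : ∀ t, R (t + 2 * Real.pi) - R t ≠ 0 := fun t ht =>
    hne fun s => congrFun (hu _ _ h' h t (sub_eq_zero.1 ht)) s
  have hcont : Continuous fun t => R (t + 2 * Real.pi) - R t :=
    h'.continuous.sub h.continuous
  have hsign : (∀ t, R t < R (t + 2 * Real.pi)) ∨ (∀ t, R (t + 2 * Real.pi) < R t) := by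
    rcases lt_or_gt_of_ne (hne' 0) with h0 | h0
    · refine Or.inr fun t => ?_
      by_contra! hge
      obtain ⟨s, hs⟩ := mem_range_of_exists_le_of_exists_ge hcont (c := 0) ⟨0, h0.le⟩
        ⟨t, sub_nonneg.2 hge⟩
      exact hne' s hs
    · refine Or.inl fun t => ?_
      by_contra! hge
      obtain ⟨s, hs⟩ := mem_range_of_exists_le_of_exists_ge hcont (c := 0) ⟨t, sub_nonpos.2 hge⟩
        ⟨0, h0.le⟩
      exact hne' s hs
  have hstep : ∀ n : ℕ, ((n + 1 : ℕ) : ℝ) * (2 * Real.pi)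
      = n * (2 * Real.pi) + 2 * Real.pi := fun n => by push_cast; ring
  rcases hsign with hs | hs
  · have hmono : StrictMono fun n : ℕ => R (n * (2 * Real.pi)) :=
      strictMono_nat_of_lt_succ fun n => by rw [hstep]; exact hs _
    have h1 := hmono (Nat.pos_of_ne_zero hk)
    have h2 := hper 0
    simp only [Nat.cast_zero, zero_mul, zero_add] at h1 h2
    exact h1.ne h2.symm
  · have hmono : StrictAnti fun n : ℕ => R (n * (2 * Real.pi)) :=
      strictAnti_nat_of_succ_lt fun n => by rw [hstep]; exact hs _
    have h1 := hmono (Nat.pos_of_ne_zero hk)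
    have h2 := hper 0
    simp only [Nat.cast_zero, zero_mul, zero_add] at h1 h2
    exact h1.ne h2

/-- The periodic orbits in an annulus are the `2π`-periodic solutions of the radial equation. -/
theorem IsPeriodicOrbit.exists_radialSolution (hρ : 0 < ρ₁) (hρ' : ρ₁ ≤ ρ₂)
    (hY : IsPolarField Y G ρ₁ ρ₂) (hu : HasUniqueness G ρ₁ ρ₂)
    (hG : ∀ t r, G (t + 2 * Real.pi) r = G t r) {Γ : Set (ℝ × ℝ)} (hΓ : IsPeriodicOrbit Y Γ)
    (hmem : Γ ⊆ annulus ρ₁ ρ₂) :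
    ∃ R, IsRadialSolution G ρ₁ ρ₂ R ∧ Function.Periodic R (2 * Real.pi) ∧
      Γ = range (polarCurve R) := by
  obtain ⟨η, T, hT, hη, hper, -, rfl⟩ := hΓ
  obtain ⟨R, θ₀, hR, hform⟩ := hY.exists_radialSolution hρ hρ' hη
    fun t => hmem (mem_range_self t)
  have hRpos : ∀ t, 0 < R t := fun t => hρ.trans_le (hR t).2.1
  have hP : ∀ t, polarCurve R (t + T) = polarCurve R t := fun t => by
    have h1 := hform (t - θ₀ + T)
    have h2 := hform (t - θ₀)
    rw [show t - θ₀ + T + θ₀ = t + T by ring] at h1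
    rw [sub_add_cancel] at h2
    rw [← h1, ← h2, hper]
  have hRT : ∀ t, R (t + T) = R t := fun t => by
    have h1 := polarCurve_sq R (t + T)
    rw [hP, polarCurve_sq] at h1
    exact (sq_eq_sq₀ (hRpos _).le (hRpos _).le).1 h1.symm
  have hcos : Real.cos T = 1 := by
    have h1 := congrArg Prod.fst (hP 0)
    simp only [polarCurve, zero_add, Real.cos_zero, mul_one] at h1
    have h2 := hRT 0
    rw [zero_add] at h2
    rw [h2] at h1
    exact mul_left_cancel₀ (hRpos 0).ne' (by rw [h1, mul_one])
  obtain ⟨n, hn⟩ := (Real.cos_eq_one_iff T).1 hcos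
  have hn0 : 0 < n := by
    by_contra! hle
    have : (n : ℝ) ≤ 0 := by exact_mod_cast hle
    nlinarith [Real.two_pi_pos]
  lift n to ℕ using hn0.le
  refine ⟨R, hR, hR.periodic hu hG (k := n) (by exact_mod_cast hn0.ne') fun t => ?_, ?_⟩
  · have : ((n : ℕ) : ℝ) * (2 * Real.pi) = T := by exact_mod_cast hn
    rw [this, hRT]
  · ext p
    constructor
    · rintro ⟨t, rfl⟩; exact ⟨t + θ₀, (hform t).symm⟩
    · rintro ⟨t, rfl⟩; exact ⟨t - θ₀, by rw [hform, sub_add_cancel]⟩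

/-- Periodic extension of a solution over `[0, 2π]` that returns to its initial value. -/
theorem exists_periodic_radialSolution (hG : ∀ t r, G (t + 2 * Real.pi) r = G t r) {u : ℝ → ℝ}
    (hu : ∀ t ∈ Icc 0 (2 * Real.pi), HasDerivWithinAt u (G t (u t)) (Icc 0 (2 * Real.pi)) t ∧
      u t ∈ Icc ρ₁ ρ₂) (h0 : u (2 * Real.pi) = u 0) :
    ∃ R, IsRadialSolution G ρ₁ ρ₂ R ∧ Function.Periodic R (2 * Real.pi) ∧
      EqOn R u (Icc 0 (2 * Real.pi)) := by
  have hpi := Real.two_pi_pos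
  set R : ℝ → ℝ := fun t => u (toIcoMod hpi 0 t) with hR
  have hper : Function.Periodic R (2 * Real.pi) := fun t => by
    simp only [hR, toIcoMod_add_right]
  have hIco : ∀ t ∈ Ico 0 (2 * Real.pi), R t = u t := fun t ht => by
    simp only [hR]
    rw [(toIcoMod_eq_self hpi).2 (by rwa [zero_add])]
  have heq : EqOn R u (Icc 0 (2 * Real.pi)) := fun t ht => by
    rcases eq_or_lt_of_le ht.2 with rfl | hlt
    · rw [h0, ← hIco 0 ⟨le_rfl, hpi⟩]
      have := hper 0
      rwa [zero_add] at this
    · exact hIco t ⟨ht.1, hlt⟩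
  have hwithin : ∀ t ∈ Icc 0 (2 * Real.pi),
      HasDerivWithinAt R (G t (R t)) (Icc 0 (2 * Real.pi)) t := fun t ht => by
    have h1 := (hu t ht).1.congr_of_mem (fun s hs => heq hs) ht
    rwa [← heq ht] at h1
  have hbase : ∀ t ∈ Ico 0 (2 * Real.pi), HasDerivAt R (G t (R t)) t := by
    intro t ht
    rcases eq_or_lt_of_le ht.1 with rfl | hlt
    · have h1 := hwithin 0 (left_mem_Icc.2 hpi.le)
      have h2 := hwithin _ (right_mem_Icc.2 hpi.le)
      have e0 : R (2 * Real.pi) = R 0 := by have := hper 0; rwa [zero_add] at this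
      have e1 : G (2 * Real.pi) (R 0) = G 0 (R 0) := by
        have := hG 0 (R 0); rwa [zero_add] at this
      rw [e0, e1] at h2
      have h3 : HasDerivWithinAt (fun s => R (s + 2 * Real.pi)) (G 0 (R 0))
          (Icc (-(2 * Real.pi)) 0) 0 := by
        have h4 : HasDerivWithinAt R (G 0 (R 0)) (Icc 0 (2 * Real.pi)) (0 + 2 * Real.pi) := by
          rwa [zero_add]
        have h5 := h4.scomp (h := fun s => s + 2 * Real.pi) (0 : ℝ)
          (s := Icc (-(2 * Real.pi)) 0) ((hasDerivAt_id (0 : ℝ)).add_const _).hasDerivWithinAt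
          fun s hs => ⟨by linarith [hs.1], by linarith [hs.2]⟩
        rw [one_smul] at h5
        exact h5
      have h6 : HasDerivWithinAt R (G 0 (R 0)) (Icc (-(2 * Real.pi)) 0) 0 :=
        h3.congr_of_mem (fun s _ => (hper s).symm) (right_mem_Icc.2 (by linarith))
      have h7 := h6.union h1
      rw [Icc_union_Icc_eq_Icc (by linarith) hpi.le] at h7
      exact h7.hasDerivAt (Icc_mem_nhds (by linarith) hpi)
    · exact (hwithin t (Ico_subset_Icc_self ht)).hasDerivAt (Icc_mem_nhds hlt ht.2)
  refine ⟨R, fun t => ?_, hper, heq⟩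
  have hGper : ∀ r, Function.Periodic (fun t => G t r) (2 * Real.pi) := fun r t => hG t r
  have hmod := toIcoMod_mem_Ico hpi 0 t
  rw [zero_add] at hmod
  set s := toIcoMod hpi 0 t with hs
  have ht : s = t - toIcoDiv hpi 0 t * (2 * Real.pi) := by
    have := toIcoMod_add_toIcoDiv_zsmul hpi 0 t
    rw [zsmul_eq_mul] at this
    rw [hs]; linarith
  constructor
  · have h1 := hbase s hmod
    rw [ht] at h1
    have h2 := HasDerivAt.comp_sub_const t (toIcoDiv hpi 0 t * (2 * Real.pi)) h1
    have h3 : (fun x => R (x - toIcoDiv hpi 0 t * (2 * Real.pi))) = R := by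
      ext x; exact hper.sub_int_mul_eq _
    rw [h3, hper.sub_int_mul_eq] at h2
    have h4 := (hGper (R t)).sub_int_mul_eq (x := t) (toIcoDiv hpi 0 t)
    rwa [h4] at h2
  · exact (hu s (Ico_subset_Icc_self hmod)).2

end CubicDL

end

noncomputable section

namespace CubicDL

open Metric
open scoped NNReal

theorem IsHolomorphicField.const_mul {v : ℝ → ℂ → ℂ} {U : Set ℂ} {L K : ℝ≥0}
    (h : IsHolomorphicField v U L K) (c : ℂ) :
    IsHolomorphicField (fun t z => c * v t z) U (‖c‖₊ * L) (‖c‖₊ * K) where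
  isOpen := h.isOpen
  continuousOn := continuousOn_const.mul h.continuousOn
  differentiableOn t := (h.differentiableOn t).const_mul c
  lipschitzOnWith t := LipschitzOnWith.of_dist_le_mul fun x hx y hy => by
    have := (h.lipschitzOnWith t).dist_le_mul x hx y hy
    rw [dist_eq_norm] at this ⊢
    rw [← mul_sub, norm_mul, NNReal.coe_mul, coe_nnnorm, mul_assoc]
    exact mul_le_mul_of_nonneg_left this (norm_nonneg c)
  norm_le t z hz := by
    rw [norm_mul, NNReal.coe_mul, coe_nnnorm]
    exact mul_le_mul_of_nonneg_left (h.norm_le t z hz) (norm_nonneg c)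

/-- First order averaging for a scalar holomorphic equation `z' = ε F ε t z`: the flow over
`[0, T]` is holomorphic, and its displacement divided by `ε` converges uniformly to
the averaged function. -/
theorem exists_flow_averaging {F : ℝ → ℝ → ℂ → ℂ} {U V : Set ℂ} {M K C : ℝ≥0} {δ ε₁ T : ℝ}
    (hT : 0 ≤ T) (hε₁ : 0 ≤ ε₁) (hF : ∀ ε, |ε| ≤ ε₁ → IsHolomorphicField (F ε) U M K)
    (hV : IsOpen V)
    (hVU : ∀ z ∈ V, closedBall z δ ⊆ U)
    (hC : ∀ ε, |ε| ≤ ε₁ → ∀ t, ∀ z ∈ U, ‖F ε t z - F 0 t z‖ ≤ C * |ε|) (hδ : ε₁ * M * T ≤ δ) :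
    ∃ u : ℝ → ℂ → ℝ → ℂ, ∀ ε, |ε| ≤ ε₁ →
      (∀ z ∈ V, u ε z 0 = z ∧ IsSolutionOn (fun t z => ε * F ε t z) U T (u ε z) ∧
        ∀ t ∈ Icc 0 T, ‖u ε z t - z‖ ≤ |ε| * M * T) ∧
      DifferentiableOn ℂ (fun z => u ε z T) V ∧
      (ε ≠ 0 → ∀ z ∈ V, ‖(u ε z T - z) / ε - ∫ t in (0 : ℝ)..T, F 0 t z‖
        ≤ T * (C + K * M * T) * |ε|) := by
  have hnn : ∀ ε : ℝ, ((‖(ε : ℂ)‖₊ : ℝ≥0) : ℝ) = |ε| := fun ε => by simp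
  have hex : ∀ ε : ℝ, ∀ z : ℂ, ∃ α : ℝ → ℂ, |ε| ≤ ε₁ → z ∈ V → α 0 = z ∧
      IsSolutionOn (fun t z => ε * F ε t z) U T α ∧
        ∀ t ∈ Icc 0 T, ‖α t - z‖ ≤ |ε| * M * T := by
    intro ε z
    by_cases hε : |ε| ≤ ε₁ ∧ z ∈ V
    · have hv := (hF ε hε.1).const_mul (ε : ℂ)
      have hle : |ε| * M * T ≤ δ := le_trans (by gcongr; exact hε.1) hδ
      obtain ⟨α, h0, h1, h2⟩ := hv.exists_isSolutionOn hT (z := z) (by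
        rw [NNReal.coe_mul, hnn]
        exact (closedBall_subset_closedBall hle).trans (hVU z hε.2))
      refine ⟨α, fun _ _ => ⟨h0, h1, fun t ht => ?_⟩⟩
      have := h2 t ht
      rwa [mem_closedBall, dist_eq_norm, NNReal.coe_mul, hnn] at this
    · exact ⟨fun _ => 0, fun h h' => absurd ⟨h, h'⟩ hε⟩
  choose u hu using hex
  refine ⟨u, fun ε hε => ⟨fun z hz => hu ε z hε hz, fun z hz => ?_, fun hε0 z hz => ?_⟩⟩
  · exact (((hF ε hε).const_mul (ε : ℂ)).differentiableAt_flow hT hV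
      (fun z hz => (hu ε z hε hz).1) (fun z hz => (hu ε z hε hz).2.1) hz).differentiableWithinAt
  · obtain ⟨h0, h1, h2⟩ := hu ε z hε hz
    have hv := (hF ε hε).const_mul (ε : ℂ)
    have hF0 := hF 0 (by simpa using hε₁)
    have hδ0 : 0 ≤ δ := le_trans (by positivity) hδ
    have hzU : z ∈ U := hVU z hz (mem_closedBall_self hδ0)
    have hε' : (ε : ℂ) ≠ 0 := by exact_mod_cast hε0
    have e1 := h1.integral_eq hv hT
    rw [intervalIntegral.integral_const_mul, h0] at e1
    have c1 : ContinuousOn (fun t => F ε t (u ε z t)) (uIcc 0 T) := by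
      rw [uIcc_of_le hT]
      exact (hF ε hε).continuousOn.comp (continuousOn_id.prodMk h1.continuousOn)
        fun t ht => ⟨mem_univ _, (h1 t ht).2⟩
    have c0 : ContinuousOn (fun t => F 0 t z) (uIcc 0 T) :=
      hF0.continuousOn.comp (f := fun t => (t, z)) (by fun_prop) fun t _ => ⟨mem_univ _, hzU⟩
    rw [← e1, mul_div_cancel_left₀ _ hε', ← intervalIntegral.integral_sub c1.intervalIntegrable
      c0.intervalIntegrable]
    have hb := intervalIntegral.norm_integral_le_of_norm_le_const (a := 0) (b := T)
      (f := fun t => F ε t (u ε z t) - F 0 t z) (C := (C + K * M * T) * |ε|) fun t ht => by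
        rw [uIoc_of_le hT] at ht
        have ht := Ioc_subset_Icc_self ht
        have b1 := hC ε hε t _ (h1 t ht).2
        have b2 := (hF0.lipschitzOnWith t).dist_le_mul _ (h1 t ht).2 _ hzU
        rw [dist_eq_norm, dist_eq_norm] at b2
        have b3 := mul_le_mul_of_nonneg_left (h2 t ht) K.2
        have b4 := norm_sub_le_norm_sub_add_norm_sub (F ε t (u ε z t)) (F 0 t (u ε z t)) (F 0 t z)
        calc _ ≤ _ := b4
          _ ≤ C * |ε| + K * (|ε| * M * T) := add_le_add b1 (b2.trans b3)
          _ = _ := by ring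
    refine hb.trans (le_of_eq ?_)
    rw [sub_zero, abs_of_nonneg hT]; ring

/-- The value at a complex point of a real polynomial in two variables. -/
def complexEvalAt (f : MvPolynomial (Fin 2) ℝ) (x y : ℂ) : ℂ :=
  ∑ d ∈ f.support, ((f.coeff d : ℝ) : ℂ) * (x ^ d 0 * y ^ d 1)

theorem complexEvalAt_ofReal (f : MvPolynomial (Fin 2) ℝ) (x y : ℝ) :
    complexEvalAt f x y = (evalAt f x y : ℂ) := by
  rw [evalAt_eq_sum, complexEvalAt]; push_cast; rfl

/-- The sum of `|coefficient| * ρ ^ degree` over the monomials of `f`. -/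
def coeffBound (f : MvPolynomial (Fin 2) ℝ) (ρ : ℝ) : ℝ :=
  ∑ d ∈ f.support, |f.coeff d| * (ρ ^ d 0 * ρ ^ d 1)

theorem coeffBound_nonneg (f : MvPolynomial (Fin 2) ℝ) {ρ : ℝ} (hρ : 0 ≤ ρ) :
    0 ≤ coeffBound f ρ := Finset.sum_nonneg fun d _ => by positivity

theorem norm_complexEvalAt_le (f : MvPolynomial (Fin 2) ℝ) {ρ : ℝ} {x y : ℂ} (hx : ‖x‖ ≤ ρ)
    (hy : ‖y‖ ≤ ρ) : ‖complexEvalAt f x y‖ ≤ coeffBound f ρ := by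
  refine (norm_sum_le _ _).trans (Finset.sum_le_sum fun d _ => ?_)
  have hρ : 0 ≤ ρ := (norm_nonneg x).trans hx
  rw [norm_mul, norm_mul, norm_pow, norm_pow, Complex.norm_real, Real.norm_eq_abs]
  gcongr

/-- The component along `(cos φ, sin φ)` of the vector `(f, g)` at `z (cos φ, sin φ)`. -/
def perturbationAlong (f g : MvPolynomial (Fin 2) ℝ) (θ φ : ℝ) (z : ℂ) : ℂ :=
  complexEvalAt f (z * Real.cos θ) (z * Real.sin θ) * Real.cos φ
    + complexEvalAt g (z * Real.cos θ) (z * Real.sin θ) * Real.sin φ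

/-- The angular velocity of the perturbed system, at complex radius `z`. -/
def angularSpeed (a : ℝ) (f g : MvPolynomial (Fin 2) ℝ) (ε θ : ℝ) (z : ℂ) : ℂ :=
  (z * Real.cos θ + a) ^ 2 + ε * (perturbationAlong f g θ (θ + Real.pi / 2) z / z)

/-- The perturbed system in polar coordinates is `dz/dθ = ε * radialField ε θ z`. -/
def radialField (a : ℝ) (f g : MvPolynomial (Fin 2) ℝ) (ε θ : ℝ) (z : ℂ) : ℂ :=
  perturbationAlong f g θ θ z / angularSpeed a f g ε θ z

theorem norm_mul_cos_le (z : ℂ) (θ : ℝ) : ‖z * Real.cos θ‖ ≤ ‖z‖ := by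
  rw [norm_mul, Complex.norm_real, Real.norm_eq_abs]
  exact mul_le_of_le_one_right (norm_nonneg _) (Real.abs_cos_le_one θ)

theorem norm_mul_sin_le (z : ℂ) (θ : ℝ) : ‖z * Real.sin θ‖ ≤ ‖z‖ := by
  rw [norm_mul, Complex.norm_real, Real.norm_eq_abs]
  exact mul_le_of_le_one_right (norm_nonneg _) (Real.abs_sin_le_one θ)

variable {a : ℝ} {f g : MvPolynomial (Fin 2) ℝ}

theorem norm_perturbationAlong_le {ρ : ℝ} {z : ℂ} (hz : ‖z‖ ≤ ρ) (θ φ : ℝ) :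
    ‖perturbationAlong f g θ φ z‖ ≤ coeffBound f ρ + coeffBound g ρ := by
  have h1 := norm_complexEvalAt_le f ((norm_mul_cos_le z θ).trans hz)
    ((norm_mul_sin_le z θ).trans hz)
  have h2 := norm_complexEvalAt_le g ((norm_mul_cos_le z θ).trans hz)
    ((norm_mul_sin_le z θ).trans hz)
  exact (norm_add_le _ _).trans (add_le_add ((norm_mul_cos_le _ φ).trans h1)
    ((norm_mul_sin_le _ φ).trans h2))

theorem continuous_perturbationAlong (φ : ℝ) :
    Continuous fun p : ℝ × ℂ => perturbationAlong f g p.1 (p.1 + φ) p.2 := by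
  unfold perturbationAlong complexEvalAt
  fun_prop

theorem differentiable_perturbationAlong (θ φ : ℝ) :
    Differentiable ℂ fun z => perturbationAlong f g θ φ z := by
  unfold perturbationAlong complexEvalAt
  fun_prop

theorem sq_le_norm_mul_cos_add_sq {ρ : ℝ} (hρ : ρ < |a|) {z : ℂ} (hz : ‖z‖ ≤ ρ) (θ : ℝ) :
    (|a| - ρ) ^ 2 ≤ ‖(z * Real.cos θ + a) ^ 2‖ := by
  rw [norm_pow]
  refine pow_le_pow_left₀ (by linarith) ?_ 2
  have h1 := norm_mul_cos_le z θ
  have h2 := norm_sub_norm_le (a : ℂ) (-(z * Real.cos θ))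
  rw [norm_neg, Complex.norm_real, Real.norm_eq_abs, sub_neg_eq_add, add_comm (a : ℂ)] at h2
  linarith

theorem exists_radialField_bounds {ρa ρb : ℝ} (hρa : 0 < ρa) (hρb : ρb < |a|) (hρb0 : 0 < ρb) :
    ∃ M > 0, ∃ ε₀ > 0, ∀ ε θ, |ε| ≤ ε₀ → ∀ z : ℂ, ρa ≤ ‖z‖ → ‖z‖ ≤ ρb →
      angularSpeed a f g ε θ z ≠ 0 ∧ ‖radialField a f g ε θ z‖ ≤ M ∧
      ‖radialField a f g ε θ z - radialField a f g 0 θ z‖ ≤ M * |ε| ∧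
      ‖angularSpeed a f g ε θ z - angularSpeed a f g 0 θ z‖ < (|a| - ρb) ^ 2 := by
  set B := coeffBound f ρb + coeffBound g ρb with hB
  have hB0 : 0 ≤ B := add_nonneg (coeffBound_nonneg f hρb0.le) (coeffBound_nonneg g hρb0.le)
  set c := (|a| - ρb) ^ 2 with hc
  have hc0 : 0 < c := by have := sub_pos.2 hρb; positivity
  refine ⟨2 * B / c + 2 * B ^ 2 / (ρa * c ^ 2) + 1, by positivity, c * ρa / (2 * (B + 1)),
    by positivity, fun ε θ hε z hz1 hz2 => ?_⟩
  have hz0 : 0 < ‖z‖ := hρa.trans_le hz1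
  have hdiff : ‖angularSpeed a f g ε θ z - angularSpeed a f g 0 θ z‖ ≤ |ε| * (B / ρa) := by
    simp only [angularSpeed, Complex.ofReal_zero, zero_mul, add_zero, add_sub_cancel_left]
    rw [norm_mul, norm_div, Complex.norm_real, Real.norm_eq_abs]
    have := norm_perturbationAlong_le (f := f) (g := g) hz2 θ (θ + Real.pi / 2)
    gcongr
  have hhalf : |ε| * (B / ρa) ≤ c / 2 := by
    calc |ε| * (B / ρa) ≤ c * ρa / (2 * (B + 1)) * ((B + 1) / ρa) := by gcongr; linarith
      _ = c / 2 := by field_simp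
  have h0 : c ≤ ‖angularSpeed a f g 0 θ z‖ := by
    simp only [angularSpeed, Complex.ofReal_zero, zero_mul, add_zero]
    exact sq_le_norm_mul_cos_add_sq hρb hz2 θ
  have h1 : c / 2 ≤ ‖angularSpeed a f g ε θ z‖ := by
    have := norm_sub_norm_le (angularSpeed a f g 0 θ z) (angularSpeed a f g ε θ z)
    rw [norm_sub_rev] at this
    linarith
  have hP := norm_perturbationAlong_le (f := f) (g := g) hz2 θ θ
  have hne : angularSpeed a f g ε θ z ≠ 0 := norm_pos_iff.1 (by linarith)
  have hne0 : angularSpeed a f g 0 θ z ≠ 0 := norm_pos_iff.1 (by linarith)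
  refine ⟨hne, ?_, ?_, by linarith⟩
  · rw [radialField, norm_div]
    calc _ ≤ B / (c / 2) := by gcongr
      _ = 2 * B / c := by field_simp
      _ ≤ _ := by
        have : 0 ≤ 2 * B ^ 2 / (ρa * c ^ 2) := by positivity
        linarith
  · rw [radialField, radialField, div_sub_div _ _ hne hne0, norm_div, norm_mul,
      mul_comm (angularSpeed a f g ε θ z), ← mul_sub, norm_mul, norm_sub_rev]
    calc _ ≤ B * (|ε| * (B / ρa)) / (c / 2 * c) := by gcongr
      _ = 2 * B ^ 2 / (ρa * c ^ 2) * |ε| := by field_simp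
      _ ≤ _ := by
        have : 0 ≤ 2 * B / c := by positivity
        gcongr
        linarith

theorem continuousOn_radialField {ε : ℝ} {U : Set ℂ}
    (hU : ∀ θ, ∀ z ∈ U, z ≠ 0 ∧ angularSpeed a f g ε θ z ≠ 0) :
    ContinuousOn (Function.uncurry (radialField a f g ε)) (univ ×ˢ U) := by
  have h1 := continuous_perturbationAlong (f := f) (g := g) 0
  simp only [add_zero] at h1
  have h2 := continuous_perturbationAlong (f := f) (g := g) (Real.pi / 2)
  refine h1.continuousOn.div (ContinuousOn.add (by fun_prop) (continuousOn_const.mul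
    (h2.continuousOn.div (by fun_prop) fun p hp => (hU p.1 p.2 hp.2).1)))
    fun p hp => (hU p.1 p.2 hp.2).2

theorem differentiableOn_radialField {ε θ : ℝ} {U : Set ℂ}
    (hU : ∀ z ∈ U, z ≠ 0 ∧ angularSpeed a f g ε θ z ≠ 0) :
    DifferentiableOn ℂ (radialField a f g ε θ) U := by
  refine (differentiable_perturbationAlong θ θ).differentiableOn.div
    (DifferentiableOn.add (by fun_prop) (DifferentiableOn.const_mul
    ((differentiable_perturbationAlong θ _).differentiableOn.div differentiableOn_id
      fun z hz => (hU z hz).1) _)) fun z hz => (hU z hz).2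

/-- The points at distance less than `δ` from the real interval `[ρ₁, ρ₂]`. -/
def nearInterval (ρ₁ ρ₂ δ : ℝ) : Set ℂ := thickening δ ((fun x : ℝ => (x : ℂ)) '' Icc ρ₁ ρ₂)

variable {ρ₁ ρ₂ δ : ℝ}

theorem mem_nearInterval {z : ℂ} :
    z ∈ nearInterval ρ₁ ρ₂ δ ↔ ∃ x ∈ Icc ρ₁ ρ₂, ‖z - x‖ < δ := by
  simp [nearInterval, mem_thickening_iff, dist_eq_norm]

theorem ofReal_mem_nearInterval (hδ : 0 < δ) {x : ℝ} (hx : x ∈ Icc ρ₁ ρ₂) :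
    (x : ℂ) ∈ nearInterval ρ₁ ρ₂ δ := mem_nearInterval.2 ⟨x, hx, by simpa using hδ⟩

theorem isOpen_nearInterval : IsOpen (nearInterval ρ₁ ρ₂ δ) := isOpen_thickening

theorem convex_nearInterval : Convex ℝ (nearInterval ρ₁ ρ₂ δ) :=
  ((convex_Icc ρ₁ ρ₂).linear_image Complex.ofRealCLM.toLinearMap).thickening δ

theorem closedBall_subset_nearInterval {z : ℂ} {η δ' : ℝ} (hz : z ∈ nearInterval ρ₁ ρ₂ δ)
    (h : η + δ ≤ δ') : closedBall z η ⊆ nearInterval ρ₁ ρ₂ δ' := by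
  obtain ⟨x, hx, hzx⟩ := mem_nearInterval.1 hz
  intro w hw
  rw [mem_closedBall, dist_eq_norm] at hw
  refine mem_nearInterval.2 ⟨x, hx, ?_⟩
  have := norm_sub_le_norm_sub_add_norm_sub w z (x : ℂ)
  linarith

theorem norm_mem_of_mem_nearInterval {z : ℂ} (hρ₁ : 0 < ρ₁) (hz : z ∈ nearInterval ρ₁ ρ₂ δ) :
    ρ₁ - δ < ‖z‖ ∧ ‖z‖ < ρ₂ + δ := by
  obtain ⟨x, hx, hzx⟩ := mem_nearInterval.1 hz
  have h1 := norm_sub_norm_le z (x : ℂ)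
  have h2 := norm_sub_norm_le (x : ℂ) z
  rw [norm_sub_rev] at h2
  rw [Complex.norm_real, Real.norm_of_nonneg (hρ₁.le.trans hx.1)] at h1 h2
  constructor <;> linarith [hx.1, hx.2]

theorem exists_isHolomorphicField (hρ₁ : 0 < ρ₁) (hρ : ρ₁ < ρ₂) (hρ₂ : ρ₂ < |a|) :
    ∃ δ > 0, ρ₂ + δ < |a| ∧ δ < ρ₁ ∧ ∃ M K C : ℝ≥0, ∃ ε₁ > 0, ε₁ * M * (2 * Real.pi) ≤ δ ∧
      ∀ ε, |ε| ≤ ε₁ →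
        IsHolomorphicField (radialField a f g ε) (nearInterval ρ₁ ρ₂ (2 * δ)) M K ∧
        (∀ θ, ∀ z ∈ nearInterval ρ₁ ρ₂ (2 * δ),
          ‖radialField a f g ε θ z - radialField a f g 0 θ z‖ ≤ C * |ε|) ∧
        ∀ θ, ∀ x ∈ Icc ρ₁ ρ₂, 0 < (angularSpeed a f g ε θ (x : ℝ)).re := by
  set δ := min ρ₁ (|a| - ρ₂) / 4 with hδ
  have hm : 0 < min ρ₁ (|a| - ρ₂) := lt_min hρ₁ (by linarith)
  have hδ0 : 0 < δ := by positivity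
  have hδ1 : 4 * δ ≤ ρ₁ := by rw [hδ]; linarith [min_le_left ρ₁ (|a| - ρ₂)]
  have hδ2 : 4 * δ ≤ |a| - ρ₂ := by rw [hδ]; linarith [min_le_right ρ₁ (|a| - ρ₂)]
  obtain ⟨M, hM, ε₀, hε₀, hb⟩ := exists_radialField_bounds (a := a) (f := f) (g := g)
    (ρa := ρ₁ - 3 * δ) (ρb := ρ₂ + 3 * δ) (by linarith) (by linarith) (by linarith)
  lift M to ℝ≥0 using hM.le
  obtain ⟨K, hK⟩ : ∃ K : ℝ≥0, (K : ℝ) = M / (δ / 2) := ⟨⟨_, by positivity⟩, rfl⟩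
  have hmem : ∀ z ∈ nearInterval ρ₁ ρ₂ (3 * δ), ρ₁ - 3 * δ ≤ ‖z‖ ∧ ‖z‖ ≤ ρ₂ + 3 * δ :=
    fun z hz => ⟨(norm_mem_of_mem_nearInterval hρ₁ hz).1.le,
      (norm_mem_of_mem_nearInterval hρ₁ hz).2.le⟩
  have hsub : nearInterval ρ₁ ρ₂ (2 * δ) ⊆ nearInterval ρ₁ ρ₂ (3 * δ) :=
    thickening_mono (by linarith) _
  refine ⟨δ, hδ0, by linarith, by linarith, M, K, M,
    min ε₀ (δ / (M * (2 * Real.pi))), lt_min hε₀ (by positivity), ?_, fun ε hε => ?_⟩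
  · rw [mul_assoc]
    exact (mul_le_mul_of_nonneg_right (min_le_right _ _) (by positivity)).trans
      (div_mul_cancel₀ _ (by positivity)).le
  have hε' : |ε| ≤ ε₀ := hε.trans (min_le_left _ _)
  have hne : ∀ θ, ∀ z ∈ nearInterval ρ₁ ρ₂ (3 * δ), z ≠ 0 ∧ angularSpeed a f g ε θ z ≠ 0 :=
    fun θ z hz => ⟨norm_pos_iff.1 (lt_of_lt_of_le (by linarith) (hmem z hz).1),
      (hb ε θ hε' z (hmem z hz).1 (hmem z hz).2).1⟩
  have hd : ∀ θ, DifferentiableOn ℂ (radialField a f g ε θ) (nearInterval ρ₁ ρ₂ (3 * δ)) :=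
    fun θ => differentiableOn_radialField (hne θ)
  refine ⟨⟨isOpen_nearInterval, continuousOn_radialField fun θ z hz => hne θ z (hsub hz),
    fun θ => (hd θ).mono hsub, fun θ => ?_, fun θ z hz =>
      (hb ε θ hε' z (hmem z (hsub hz)).1 (hmem z (hsub hz)).2).2.1⟩, fun θ z hz =>
      (hb ε θ hε' z (hmem z (hsub hz)).1 (hmem z (hsub hz)).2).2.2.1, fun θ x hx => ?_⟩
  · refine convex_nearInterval.lipschitzOnWith_of_nnnorm_deriv_le
      (fun z hz => (hd θ).differentiableAt (isOpen_nearInterval.mem_nhds (hsub hz)))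
      fun z hz => ?_
    have hball : closedBall z (δ / 2) ⊆ nearInterval ρ₁ ρ₂ (3 * δ) :=
      closedBall_subset_nearInterval hz (by linarith)
    rw [← NNReal.coe_le_coe, coe_nnnorm, hK]
    refine Complex.norm_deriv_le_of_forall_mem_sphere_norm_le (by positivity) ?_ fun w hw => ?_
    · refine DifferentiableOn.diffContOnCl_ball (U := nearInterval ρ₁ ρ₂ (3 * δ)) (hd θ) hball
    · have hw' := hmem w (hball (sphere_subset_closedBall hw))
      exact (hb ε θ hε' w hw'.1 hw'.2).2.1
  · have hx' := hmem x (ofReal_mem_nearInterval (by linarith) hx)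
    have h1 := (hb ε θ hε' x hx'.1 hx'.2).2.2.2
    have h2 := (Complex.abs_re_le_norm _).trans_lt h1
    have h3 := sq_le_norm_mul_cos_add_sq (a := a) (by linarith) hx'.2 θ
    have h4 : angularSpeed a f g 0 θ (x : ℂ) = (((x * Real.cos θ + a) ^ 2 : ℝ) : ℂ) := by
      simp [angularSpeed]
    have h5 : ‖((x : ℂ) * Real.cos θ + a) ^ 2‖ = (x * Real.cos θ + a) ^ 2 := by
      have : ((x : ℂ) * Real.cos θ + a) ^ 2 = (((x * Real.cos θ + a) ^ 2 : ℝ) : ℂ) := by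
        push_cast; rfl
      rw [this, Complex.norm_real, Real.norm_of_nonneg (sq_nonneg _)]
    rw [h4, Complex.sub_re, Complex.ofReal_re] at h2
    rw [h5] at h3
    have := (abs_lt.1 h2).1
    linarith

end CubicDL

end

noncomputable section

namespace CubicDL

open Metric
open scoped NNReal ComplexConjugate

variable {a : ℝ} {f g : MvPolynomial (Fin 2) ℝ} {ρ₁ ρ₂ δ ε : ℝ}

/-- The real counterpart of `perturbationAlong`. -/
def realAlong (f g : MvPolynomial (Fin 2) ℝ) (θ φ r : ℝ) : ℝ :=
  evalAt f (r * Real.cos θ) (r * Real.sin θ) * Real.cos φ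
    + evalAt g (r * Real.cos θ) (r * Real.sin θ) * Real.sin φ

/-- The real counterpart of `angularSpeed`. -/
def realSpeed (a : ℝ) (f g : MvPolynomial (Fin 2) ℝ) (ε θ r : ℝ) : ℝ :=
  (r * Real.cos θ + a) ^ 2 + ε * (realAlong f g θ (θ + Real.pi / 2) r / r)

/-- The right-hand side of the radial equation `dr/dθ = ε F(θ, r) + O(ε²)`. -/
def radialRate (a : ℝ) (f g : MvPolynomial (Fin 2) ℝ) (ε θ r : ℝ) : ℝ :=
  ε * (realAlong f g θ θ r / realSpeed a f g ε θ r)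

theorem perturbationAlong_ofReal (θ φ r : ℝ) :
    perturbationAlong f g θ φ r = (realAlong f g θ φ r : ℂ) := by
  rw [perturbationAlong, ← Complex.ofReal_mul, ← Complex.ofReal_mul, complexEvalAt_ofReal,
    complexEvalAt_ofReal, realAlong]
  push_cast; rfl

theorem angularSpeed_ofReal (θ r : ℝ) :
    angularSpeed a f g ε θ r = (realSpeed a f g ε θ r : ℂ) := by
  rw [angularSpeed, perturbationAlong_ofReal, realSpeed]
  push_cast; rfl

theorem mul_radialField_ofReal (θ r : ℝ) :
    ε * radialField a f g ε θ r = (radialRate a f g ε θ r : ℂ) := by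
  rw [radialField, perturbationAlong_ofReal, angularSpeed_ofReal, radialRate]
  push_cast; rfl

theorem radialField_zero_ofReal (θ r : ℝ) :
    radialField a f g 0 θ r = ((realAlong f g θ θ r / (r * Real.cos θ + a) ^ 2 : ℝ) : ℂ) := by
  rw [radialField, perturbationAlong_ofReal, angularSpeed_ofReal, realSpeed, zero_mul, add_zero]
  push_cast; rfl

theorem integral_radialField_zero_ofReal (r : ℝ) :
    ∫ θ in (0 : ℝ)..(2 * Real.pi), radialField a f g 0 θ r = (averaged a f g r : ℂ) := by
  simp_rw [radialField_zero_ofReal]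
  rw [intervalIntegral.integral_ofReal]
  rfl

theorem radialRate_add_two_pi (θ r : ℝ) :
    radialRate a f g ε (θ + 2 * Real.pi) r = radialRate a f g ε θ r := by
  simp only [radialRate, realSpeed, realAlong, Real.cos_add_pi_div_two, Real.sin_add_pi_div_two,
    Real.cos_add_two_pi, Real.sin_add_two_pi]

theorem complexEvalAt_conj (x y : ℂ) :
    complexEvalAt f (conj x) (conj y) = conj (complexEvalAt f x y) := by
  simp [complexEvalAt, map_sum]

theorem perturbationAlong_conj (θ φ : ℝ) (z : ℂ) :
    perturbationAlong f g θ φ (conj z) = conj (perturbationAlong f g θ φ z) := by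
  have h : ∀ r : ℝ, conj z * r = conj (z * r) := fun r => by simp
  rw [perturbationAlong, h, h, complexEvalAt_conj, complexEvalAt_conj, perturbationAlong, map_add,
    map_mul, map_mul, Complex.conj_ofReal, Complex.conj_ofReal]

theorem mul_radialField_conj (θ : ℝ) (z : ℂ) :
    ε * radialField a f g ε θ (conj z) = conj (ε * radialField a f g ε θ z) := by
  rw [radialField, angularSpeed, perturbationAlong_conj, perturbationAlong_conj, radialField,
    angularSpeed]
  simp only [map_mul, map_div₀, map_add, map_pow, Complex.conj_ofReal]

theorem conj_mem_nearInterval {z : ℂ} (hz : z ∈ nearInterval ρ₁ ρ₂ δ) :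
    conj z ∈ nearInterval ρ₁ ρ₂ δ := by
  obtain ⟨x, hx, h⟩ := mem_nearInterval.1 hz
  refine mem_nearInterval.2 ⟨x, hx, ?_⟩
  rwa [← Complex.conj_ofReal, ← map_sub, Complex.norm_conj]

theorem IsHolomorphicField.im_eq_zero {v : ℝ → ℂ → ℂ} {U : Set ℂ} {L K : ℝ≥0} {T : ℝ} {α : ℝ → ℂ}
    (hv : IsHolomorphicField v U L K) (hconj : ∀ t z, v t (conj z) = conj (v t z))
    (hU : ∀ z ∈ U, conj z ∈ U) (hα : IsSolutionOn v U T α) (h0 : (α 0).im = 0) :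
    ∀ t ∈ Icc 0 T, (α t).im = 0 := by
  have hβ : IsSolutionOn v U T fun t => conj (α t) := fun t ht => by
    refine ⟨?_, hU _ (hα t ht).2⟩
    rw [hconj]
    exact Complex.conjCLE.toContinuousLinearMap.hasFDerivAt.comp_hasDerivWithinAt t (hα t ht).1
  intro t ht
  have := hv.eqOn hβ hα (Complex.conj_eq_iff_im.2 h0) ht
  exact Complex.conj_eq_iff_im.1 this

/-- The angular velocity of the perturbed system at a point of the plane. -/
def planarSpeed (a : ℝ) (f g : MvPolynomial (Fin 2) ℝ) (ε : ℝ) (p : ℝ × ℝ) : ℝ :=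
  (p.1 + a) ^ 2 + ε * ((p.1 * evalAt g p.1 p.2 - p.2 * evalAt f p.1 p.2) / (p.1 ^ 2 + p.2 ^ 2))

/-- The perturbed system, with time rescaled so that the angular velocity is one. -/
def normalizedField (a : ℝ) (f g : MvPolynomial (Fin 2) ℝ) (ε : ℝ) (p : ℝ × ℝ) : ℝ × ℝ :=
  (planarSpeed a f g ε p)⁻¹ • field a f g ε p

theorem planarSpeed_polar {r : ℝ} (hr : 0 < r) (φ : ℝ) :
    planarSpeed a f g ε (r * Real.cos φ, r * Real.sin φ) = realSpeed a f g ε φ r := by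
  have hs := Real.sin_sq_add_cos_sq φ
  have h : (r * Real.cos φ) ^ 2 + (r * Real.sin φ) ^ 2 = r ^ 2 := by
    linear_combination r ^ 2 * hs
  simp only [planarSpeed, realSpeed, realAlong, Real.cos_add_pi_div_two, Real.sin_add_pi_div_two]
  rw [h]
  field_simp
  ring

theorem sq_pos_of_mem_annulus (hρ₁ : 0 < ρ₁) {p : ℝ × ℝ} (hp : p ∈ annulus ρ₁ ρ₂) :
    0 < p.1 ^ 2 + p.2 ^ 2 := lt_of_lt_of_le (by positivity) hp.1

theorem continuousOn_planarSpeed (hρ₁ : 0 < ρ₁) :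
    ContinuousOn (planarSpeed a f g ε) (annulus ρ₁ ρ₂) := by
  have h1 := continuous_evalAt f
  have h2 := continuous_evalAt g
  refine ContinuousOn.add (by fun_prop) (continuousOn_const.mul (ContinuousOn.div
    (by fun_prop) (by fun_prop) fun p hp => (sq_pos_of_mem_annulus hρ₁ hp).ne'))

theorem planarSpeed_pos (hρ₁ : 0 < ρ₁) (hρ : ρ₁ ≤ ρ₂)
    (hpos : ∀ θ, ∀ x ∈ Icc ρ₁ ρ₂, 0 < realSpeed a f g ε θ x) :
    ∀ p ∈ annulus ρ₁ ρ₂, 0 < planarSpeed a f g ε p := by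
  intro p hp
  obtain ⟨φ, hφ⟩ := exists_eq_polar p (sq_pos_of_mem_annulus hρ₁ hp)
  have hr := (mem_annulus_iff hρ₁ hρ).1 hp
  rw [hφ, planarSpeed_polar (hρ₁.trans_le hr.1)]
  exact hpos φ _ hr

theorem isPolarField_normalizedField (hρ₁ : 0 < ρ₁)
    (hpos : ∀ θ, ∀ x ∈ Icc ρ₁ ρ₂, 0 < realSpeed a f g ε θ x) :
    IsPolarField (normalizedField a f g ε) (radialRate a f g ε) ρ₁ ρ₂ := by
  intro r hr φ
  have hr0 := hρ₁.trans_le hr.1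
  have hω := hpos φ r hr
  rw [normalizedField, planarSpeed_polar hr0]
  have hs := Real.sin_sq_add_cos_sq φ
  have hω' : realSpeed a f g ε φ r * r = (r * Real.cos φ + a) ^ 2 * r +
      ε * (evalAt g (r * Real.cos φ) (r * Real.sin φ) * Real.cos φ
        - evalAt f (r * Real.cos φ) (r * Real.sin φ) * Real.sin φ) := by
    simp only [realSpeed, realAlong, Real.cos_add_pi_div_two, Real.sin_add_pi_div_two]
    field_simp
    ring
  simp only [field, radialRate]
  have e1 : ε * (realAlong f g φ φ r / realSpeed a f g ε φ r) * realSpeed a f g ε φ r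
      = ε * realAlong f g φ φ r := by field_simp
  refine Prod.ext ?_ ?_
  · rw [Prod.smul_fst, smul_eq_mul, inv_mul_eq_iff_eq_mul₀ hω.ne', mul_sub, ← mul_assoc,
      mul_comm (realSpeed a f g ε φ r) (ε * _), e1, ← mul_assoc, hω']
    simp only [realAlong]
    linear_combination (-ε * evalAt f (r * Real.cos φ) (r * Real.sin φ)) * hs
  · rw [Prod.smul_snd, smul_eq_mul, inv_mul_eq_iff_eq_mul₀ hω.ne', mul_add, ← mul_assoc,
      mul_comm (realSpeed a f g ε φ r) (ε * _), e1, ← mul_assoc, hω']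
    simp only [realAlong]
    linear_combination (-ε * evalAt g (r * Real.cos φ) (r * Real.sin φ)) * hs

theorem isPeriodicOrbit_normalizedField_iff (hρ₁ : 0 < ρ₁) (hρ : ρ₁ ≤ ρ₂)
    (hpos : ∀ θ, ∀ x ∈ Icc ρ₁ ρ₂, 0 < realSpeed a f g ε θ x) {Γ : Set (ℝ × ℝ)}
    (hΓ : Γ ⊆ annulus ρ₁ ρ₂) :
    IsPeriodicOrbit (normalizedField a f g ε) Γ ↔ IsPeriodicOrbit (field a f g ε) Γ := by
  have hp := planarSpeed_pos hρ₁ hρ hpos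
  refine ⟨fun h => h.of_smul hΓ ((continuousOn_planarSpeed hρ₁).inv₀ fun p h => (hp p h).ne')
    (fun p h => inv_pos.2 (hp p h)) fun p _ => rfl,
    fun h => h.of_smul hΓ (continuousOn_planarSpeed hρ₁) hp fun p h => ?_⟩
  rw [normalizedField, smul_smul, mul_inv_cancel₀ (hp p h).ne', one_smul]

theorem mem_range_polarCurve_iff {R : ℝ → ℝ} (hR : ∀ t, 0 < R t)
    (hper : Function.Periodic R (2 * Real.pi)) {s : ℝ} (hs : 0 < s) :
    (s, (0 : ℝ)) ∈ range (polarCurve R) ↔ s = R 0 := by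
  constructor
  · rintro ⟨t, ht⟩
    have h1 : R t * Real.cos t = s := congrArg Prod.fst ht
    have h2 : R t * Real.sin t = 0 := congrArg Prod.snd ht
    have h3 : Real.sin t = 0 := (mul_eq_zero.1 h2).resolve_left (hR t).ne'
    have h4 : 0 < Real.cos t := by
      by_contra! hle
      nlinarith [hR t]
    have h5 : Real.cos t = 1 := by
      have := Real.sin_sq_add_cos_sq t
      rw [h3] at this
      nlinarith
    obtain ⟨k, hk⟩ := (Real.cos_eq_one_iff t).1 h5
    have h6 := (hper.int_mul k) 0
    rw [zero_add, hk] at h6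
    rw [← h1, h5, mul_one, h6]
  · rintro rfl
    exact ⟨0, by simp [polarCurve]⟩

/-- The function `d` is a displacement function of the perturbed system on the annulus
`ρ₁ ≤ r ≤ ρ₂`, divided by `ε` and extended holomorphically to `V`: its zeros correspond to
the periodic orbits in the annulus. -/
structure IsDisplacement (a : ℝ) (f g : MvPolynomial (Fin 2) ℝ) (ρ₁ ρ₂ : ℝ) (V : Set ℂ)
    (C ε : ℝ) (d : ℂ → ℂ) : Prop where
  differentiableOn : DifferentiableOn ℂ d V
  norm_sub_le : ∀ z ∈ V,
    ‖d z - ∫ θ in (0 : ℝ)..(2 * Real.pi), radialField a f g 0 θ z‖ ≤ C * |ε|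
  im_eq_zero : ∀ x ∈ Icc ρ₁ ρ₂, (d (x : ℝ)).im = 0
  exists_zero : ∀ Γ, IsPeriodicOrbit (field a f g ε) Γ → Γ ⊆ annulus ρ₁ ρ₂ →
    ∃ x ∈ Icc ρ₁ ρ₂, d (x : ℝ) = 0 ∧ ∀ s > 0, (s, (0 : ℝ)) ∈ Γ ↔ s = x
  eq_of_mem : ∀ Γ Γ', IsPeriodicOrbit (field a f g ε) Γ → Γ ⊆ annulus ρ₁ ρ₂ →
    IsPeriodicOrbit (field a f g ε) Γ' → Γ' ⊆ annulus ρ₁ ρ₂ →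
      ∀ x > 0, (x, (0 : ℝ)) ∈ Γ → (x, (0 : ℝ)) ∈ Γ' → Γ = Γ'
  exists_orbit : ∀ x, ρ₁ + C * |ε| ≤ x → x ≤ ρ₂ - C * |ε| → d (x : ℝ) = 0 →
    ∃ R : ℝ → ℝ, IsPeriodicOrbit (field a f g ε) (range (polarCurve R)) ∧
      range (polarCurve R) ⊆ annulus ρ₁ ρ₂ ∧ R 0 = x ∧ ∀ t, |R t - x| ≤ C * |ε|

theorem IsHolomorphicField.hasUniqueness {U : Set ℂ} {M K : ℝ≥0}
    (hF : IsHolomorphicField (radialField a f g ε) U M K) (hU : ∀ x ∈ Icc ρ₁ ρ₂, (x : ℂ) ∈ U) :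
    HasUniqueness (radialRate a f g ε) ρ₁ ρ₂ := by
  intro R R' hR hR' t₀ h0
  have hv := hF.const_mul (ε : ℂ)
  have hc : ∀ R : ℝ → ℝ, IsRadialSolution (radialRate a f g ε) ρ₁ ρ₂ R →
      ∀ t, HasDerivAt (fun t => (R t : ℂ)) (ε * radialField a f g ε t (R t)) t ∧ (R t : ℂ) ∈ U :=
    fun R hR t => ⟨by rw [mul_radialField_ofReal]; exact (hR t).1.ofReal_comp, hU _ (hR t).2⟩
  have := ODE_solution_unique_univ (s := fun _ => U) (fun t => hv.lipschitzOnWith t) (hc R hR)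
    (hc R' hR') (t₀ := t₀) (by simp only [h0])
  ext t
  exact_mod_cast congrFun this t

theorem exists_isDisplacement (f g : MvPolynomial (Fin 2) ℝ) (hρ₁ : 0 < ρ₁) (hρ : ρ₁ < ρ₂)
    (hρ₂ : ρ₂ < |a|) :
    ∃ V : Set ℂ, IsOpen V ∧ (∀ x ∈ Icc ρ₁ ρ₂, (x : ℂ) ∈ V) ∧ (∀ z ∈ V, ‖z‖ < |a|) ∧
      (∀ x : ℝ, (x : ℂ) ∈ V → 0 < x) ∧ ∃ (C : ℝ) (d : ℝ → ℂ → ℂ),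
        ∀ᶠ ε in 𝓝[≠] (0 : ℝ), IsDisplacement a f g ρ₁ ρ₂ V C ε (d ε) := by
  obtain ⟨δ, hδ, hδ2, hδ1, M, K, C, ε₁, hε₁, hsmall, hF⟩ :=
    exists_isHolomorphicField (f := f) (g := g) hρ₁ hρ hρ₂
  have hpi := Real.two_pi_pos
  obtain ⟨u, hu⟩ := exists_flow_averaging hpi.le hε₁.le (fun ε hε => (hF ε hε).1)
    (isOpen_nearInterval (ρ₁ := ρ₁) (ρ₂ := ρ₂) (δ := δ))
    (fun z hz => closedBall_subset_nearInterval hz (by linarith : δ + δ ≤ 2 * δ))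
    (fun ε hε => (hF ε hε).2.1) hsmall
  set D : ℝ := max (2 * Real.pi * (C + K * M * (2 * Real.pi))) (M * (2 * Real.pi)) with hD
  refine ⟨nearInterval ρ₁ ρ₂ δ, isOpen_nearInterval, fun x hx => ofReal_mem_nearInterval hδ hx,
    fun z hz => (norm_mem_of_mem_nearInterval hρ₁ hz).2.trans hδ2, fun x hx => ?_, D,
    fun ε z => (u ε z (2 * Real.pi) - z) / ε, ?_⟩
  · obtain ⟨y, hy, hxy⟩ := mem_nearInterval.1 hx
    rw [← Complex.ofReal_sub, Complex.norm_real, Real.norm_eq_abs] at hxy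
    linarith [(abs_lt.1 hxy).1, hy.1]
  have hev : ∀ᶠ ε in 𝓝[≠] (0 : ℝ), |ε| ≤ ε₁ ∧ ε ≠ 0 := by
    refine (eventually_nhdsWithin_of_eventually_nhds ?_).and self_mem_nhdsWithin
    filter_upwards [Metric.ball_mem_nhds (0 : ℝ) hε₁] with ε hε
    rw [mem_ball_zero_iff, Real.norm_eq_abs] at hε
    exact hε.le
  filter_upwards [hev] with ε ⟨hε, hε0⟩
  obtain ⟨hflow, hdiff, hlim⟩ := hu ε hε
  obtain ⟨hfield, -, hpos⟩ := hF ε hε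
  have hpos : ∀ θ, ∀ x ∈ Icc ρ₁ ρ₂, 0 < realSpeed a f g ε θ x := fun θ x hx => by
    have := hpos θ x hx
    rwa [angularSpeed_ofReal, Complex.ofReal_re] at this
  have hε' : (ε : ℂ) ≠ 0 := by exact_mod_cast hε0
  have hv := hfield.const_mul (ε : ℂ)
  have hU : ∀ x ∈ Icc ρ₁ ρ₂, (x : ℂ) ∈ nearInterval ρ₁ ρ₂ (2 * δ) := fun x hx =>
    ofReal_mem_nearInterval (by linarith) hx
  have huniq := hfield.hasUniqueness hU
  have hpolar := isPolarField_normalizedField hρ₁ hpos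
  have hreal : ∀ x ∈ Icc ρ₁ ρ₂, ∀ t ∈ Icc 0 (2 * Real.pi), (u ε x t).im = 0 := fun x hx => by
    obtain ⟨h0, hsol, -⟩ := hflow x (ofReal_mem_nearInterval hδ hx)
    exact hv.im_eq_zero (fun t z => mul_radialField_conj t z) (fun z => conj_mem_nearInterval) hsol
      (by rw [h0, Complex.ofReal_im])
  have horb : ∀ Γ, IsPeriodicOrbit (field a f g ε) Γ → Γ ⊆ annulus ρ₁ ρ₂ →
      ∃ R, IsRadialSolution (radialRate a f g ε) ρ₁ ρ₂ R ∧ Function.Periodic R (2 * Real.pi) ∧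
        Γ = range (polarCurve R) ∧ ∀ s > 0, (s, (0 : ℝ)) ∈ Γ ↔ s = R 0 := fun Γ hΓ hsub => by
    obtain ⟨R, hR, hper, rfl⟩ := ((isPeriodicOrbit_normalizedField_iff hρ₁ hρ.le hpos hsub).2
      hΓ).exists_radialSolution hρ₁ hρ.le hpolar huniq radialRate_add_two_pi hsub
    exact ⟨R, hR, hper, rfl, fun s hs =>
      mem_range_polarCurve_iff (fun t => hρ₁.trans_le (hR t).2.1) hper hs⟩
  refine ⟨(hdiff.sub differentiableOn_id).div_const _, fun z hz => (hlim hε0 z hz).trans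
    (mul_le_mul_of_nonneg_right (le_max_left _ _) (abs_nonneg ε)), fun x hx => ?_,
    fun Γ hΓ hsub => ?_, fun Γ Γ' hΓ hsub hΓ' hsub' x hx h h' => ?_, fun x hx1 hx2 hdx => ?_⟩
  · have h1 := hreal x hx _ (right_mem_Icc.2 hpi.le)
    rw [Complex.div_ofReal_im, Complex.sub_im, h1, Complex.ofReal_im, sub_zero, zero_div]
  · obtain ⟨R, hR, hper, -, hmem⟩ := horb Γ hΓ hsub
    refine ⟨R 0, (hR 0).2, ?_, hmem⟩
    obtain ⟨h0, hsol, -⟩ := hflow (R 0) (ofReal_mem_nearInterval hδ (hR 0).2)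
    have hRsol : IsSolutionOn (fun t z => ε * radialField a f g ε t z)
        (nearInterval ρ₁ ρ₂ (2 * δ)) (2 * Real.pi) fun t => (R t : ℂ) := fun t _ =>
      ⟨by
        have h1 := (hR t).1.ofReal_comp.hasDerivWithinAt (s := Icc 0 (2 * Real.pi))
        rwa [← mul_radialField_ofReal] at h1, hU _ (hR t).2⟩
    have h1 := hv.eqOn hsol hRsol h0 (right_mem_Icc.2 hpi.le)
    have h2 := hper 0
    rw [zero_add] at h2
    simp only at h1
    rw [h1, h2, sub_self, zero_div]
  · obtain ⟨R, hR, -, hΓR, hmem⟩ := horb Γ hΓ hsub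
    obtain ⟨R', hR', -, hΓR', hmem'⟩ := horb Γ' hΓ' hsub'
    have h0 : R 0 = R' 0 := ((hmem x hx).1 h).symm.trans ((hmem' x hx).1 h')
    rw [hΓR, hΓR', huniq R R' hR hR' 0 h0]
  · have hDε : 0 ≤ D * |ε| := mul_nonneg (le_max_of_le_right (by positivity)) (abs_nonneg ε)
    have hx : x ∈ Icc ρ₁ ρ₂ := ⟨by linarith, by linarith⟩
    obtain ⟨h0, hsol, hclose⟩ := hflow x (ofReal_mem_nearInterval hδ hx)
    have hre : ∀ t ∈ Icc 0 (2 * Real.pi), u ε x t = ((u ε x t).re : ℂ) := fun t ht =>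
      Complex.ext rfl (by rw [hreal x hx t ht, Complex.ofReal_im])
    have hb : ∀ t ∈ Icc 0 (2 * Real.pi), |(u ε x t).re - x| ≤ D * |ε| := fun t ht => by
      have h1 := hclose t ht
      rw [hre t ht, ← Complex.ofReal_sub, Complex.norm_real, Real.norm_eq_abs] at h1
      refine h1.trans ?_
      rw [mul_assoc, mul_comm]
      exact mul_le_mul_of_nonneg_right (le_max_right _ _) (abs_nonneg ε)
    have hret : u ε x (2 * Real.pi) = x := sub_eq_zero.1 ((div_eq_zero_iff.1 hdx).resolve_right hε')
    obtain ⟨R, hR, hper, heq⟩ := exists_periodic_radialSolution (ρ₁ := ρ₁) (ρ₂ := ρ₂)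
      (G := radialRate a f g ε) radialRate_add_two_pi (u := fun t => (u ε x t).re)
      (fun t ht => ⟨by
        have h1 := Complex.reCLM.hasFDerivAt.comp_hasDerivWithinAt t (hsol t ht).1
        rw [hre t ht] at h1
        beta_reduce at h1
        rw [mul_radialField_ofReal] at h1
        exact h1, by
        have := abs_le.1 (hb t ht)
        constructor <;> linarith⟩) (by simp only [hret, h0])
    have hsub := hR.range_subset_annulus hρ₁
    refine ⟨R, (isPeriodicOrbit_normalizedField_iff hρ₁ hρ.le hpos hsub).1
      (hR.isPeriodicOrbit hρ₁ hpolar hper), hsub, ?_, fun t => ?_⟩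
    · rw [heq (left_mem_Icc.2 hpi.le)]
      simp only [h0, Complex.ofReal_re]
    · obtain ⟨s, hs, hst⟩ := hper.exists_mem_Ico₀ hpi t
      rw [hst, heq (Ico_subset_Icc_self hs)]
      exact hb s (Ico_subset_Icc_self hs)

end CubicDL

end

noncomputable section

namespace CubicDL

open Metric Polynomial

variable {a : ℝ} {f g : MvPolynomial (Fin 2) ℝ} {ρ₁ ρ₂ C : ℝ} {n : ℕ} {W : ℝ[X]} {V : Set ℂ}
  {d : ℝ → ℂ → ℂ}

/-- The branch of `√(a² - w²)` that is positive for real `w ∈ (-|a|, |a|)`. -/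
def complexRadius (a : ℝ) (w : ℂ) : ℂ := ((a : ℂ) ^ 2 - w ^ 2) ^ (((2 : ℕ) : ℂ)⁻¹)

theorem complexRadius_sq (w : ℂ) : complexRadius a w ^ 2 = (a : ℂ) ^ 2 - w ^ 2 :=
  Complex.cpow_nat_inv_pow _ two_ne_zero

theorem complexRadius_ofReal {w : ℝ} (h : 0 ≤ a ^ 2 - w ^ 2) :
    complexRadius a w = (√(a ^ 2 - w ^ 2) : ℂ) := by
  rw [Real.sqrt_eq_rpow, Complex.ofReal_cpow h, complexRadius]
  push_cast
  norm_num

theorem differentiableAt_complexRadius {w : ℂ} (h : (a : ℂ) ^ 2 - w ^ 2 ∈ Complex.slitPlane) :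
    DifferentiableAt ℂ (complexRadius a) w := by
  unfold complexRadius
  exact DifferentiableAt.cpow_const (by fun_prop) h

/-- The points `w` in the right half plane with `√(a² - w²) ∈ V`. -/
def radiusDomain (a : ℝ) (V : Set ℂ) : Set ℂ :=
  {w | 0 < w.re ∧ (a : ℂ) ^ 2 - w ^ 2 ∈ Complex.slitPlane} ∩ complexRadius a ⁻¹' V

theorem isOpen_radiusDomain (hV : IsOpen V) : IsOpen (radiusDomain a V) := by
  have hopen : IsOpen {w : ℂ | 0 < w.re ∧ (a : ℂ) ^ 2 - w ^ 2 ∈ Complex.slitPlane} :=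
    (isOpen_lt continuous_const Complex.continuous_re).inter
      (Complex.isOpen_slitPlane.preimage (by fun_prop : Continuous fun w : ℂ => (a : ℂ) ^ 2 - w ^ 2))
  exact ContinuousOn.isOpen_inter_preimage
    (fun w hw => (differentiableAt_complexRadius hw.2).continuousAt.continuousWithinAt) hopen hV

theorem sqrt_sq_sub_sqrt_sq {r : ℝ} (hr : 0 ≤ r) (hra : |r| ≤ |a|) :
    √(a ^ 2 - √(a ^ 2 - r ^ 2) ^ 2) = r := by
  rw [Real.sq_sqrt (sub_nonneg.2 (sq_le_sq.2 hra)), sub_sub_cancel, Real.sqrt_sq hr]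

theorem sqrt_sq_sub_mem_Ioo {r : ℝ} (hr : r ∈ Ioo 0 |a|) : √(a ^ 2 - r ^ 2) ∈ Ioo 0 |a| := by
  refine ⟨Real.sqrt_pos.2 (sq_sub_sq_pos (by rw [abs_of_pos hr.1]; exact hr.2)), ?_⟩
  rw [← Real.sqrt_sq_eq_abs]
  exact Real.sqrt_lt_sqrt (sub_nonneg.2 (sq_le_sq.2 (by rw [abs_of_pos hr.1]; exact hr.2.le)))
    (by have := pow_pos hr.1 2; linarith)

theorem injOn_sqrt_sq_sub : InjOn (fun r => √(a ^ 2 - r ^ 2)) (Ioo 0 |a|) :=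
  LeftInvOn.injOn (f₁' := fun w => √(a ^ 2 - w ^ 2))
    fun r hr => sqrt_sq_sub_sqrt_sq hr.1.le (by rw [abs_of_pos hr.1]; exact hr.2.le)

theorem ofReal_mem_radiusDomain {w : ℝ} (hw : w ∈ Ioo 0 |a|) (h : (√(a ^ 2 - w ^ 2) : ℂ) ∈ V) :
    (w : ℂ) ∈ radiusDomain a V := by
  have hpos : 0 < a ^ 2 - w ^ 2 := sq_sub_sq_pos (by rw [abs_of_pos hw.1]; exact hw.2)
  refine ⟨⟨by simpa using hw.1, ?_⟩, ?_⟩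
  · rw [← Complex.ofReal_pow, ← Complex.ofReal_pow, ← Complex.ofReal_sub,
      Complex.ofReal_mem_slitPlane]
    exact hpos
  · rw [mem_preimage, complexRadius_ofReal hpos.le]
    exact h

theorem Represents.eval_eq (hrep : Represents a f g W) {w : ℝ} (hw : w ∈ Ioo 0 |a|) :
    W.eval w = w ^ 3 * (√(a ^ 2 - w ^ 2) * averaged a f g √(a ^ 2 - w ^ 2)) := by
  have h1 := sqrt_sq_sub_mem_Ioo hw
  have h2 := hrep √(a ^ 2 - w ^ 2) (by rw [abs_of_pos h1.1]; exact h1.2)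
  rw [sqrt_sq_sub_sqrt_sq hw.1.le (by rw [abs_of_pos hw.1]; exact hw.2.le)] at h2
  exact h2.symm

theorem eventually_encard_displacement_zeros_le (ha : a ≠ 0) (hW : W ≠ 0)
    (hadm : IsAdmissible a (n + 2) True W) (hrep : Represents a f g W) (hρ₁ : 0 < ρ₁)
    (hρ₂ : ρ₂ < |a|) (hV : IsOpen V) (hVI : ∀ x ∈ Icc ρ₁ ρ₂, (x : ℂ) ∈ V)
    (hVa : ∀ z ∈ V, ‖z‖ < |a|)
    (hd : ∀ᶠ ε in 𝓝[≠] (0 : ℝ), IsDisplacement a f g ρ₁ ρ₂ V C ε (d ε)) :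
    ∀ᶠ ε in 𝓝[≠] (0 : ℝ), {x : ℝ | x ∈ Icc ρ₁ ρ₂ ∧ d ε x = 0}.encard ≤ n := by
  classical
  have hI : ∀ x ∈ Icc ρ₁ ρ₂, x ∈ Ioo 0 |a| := fun x hx =>
    ⟨hρ₁.trans_le hx.1, hx.2.trans_lt hρ₂⟩
  set K : Set ℝ := (fun x => √(a ^ 2 - x ^ 2)) '' Icc ρ₁ ρ₂ with hK
  have hKm : K ⊆ Ioo 0 |a| := by
    rintro _ ⟨x, hx, rfl⟩
    exact sqrt_sq_sub_mem_Ioo (hI x hx)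
  have hrad : ∀ x ∈ Icc ρ₁ ρ₂, complexRadius a (√(a ^ 2 - x ^ 2) : ℝ) = (x : ℂ) := fun x hx => by
    have h1 := hI x hx
    have h2 := sqrt_sq_sub_mem_Ioo h1
    rw [complexRadius_ofReal (sq_sub_sq_pos (by rw [abs_of_pos h2.1]; exact h2.2)).le,
      sqrt_sq_sub_sqrt_sq h1.1.le (by rw [abs_of_pos h1.1]; exact h1.2.le)]
  have hfac : ∀ w ∈ radiusDomain a V, ‖w ^ 3 * complexRadius a w‖ ≤ (1 + 2 * |a| ^ 2) ^ 3 * |a| := by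
    rintro w ⟨-, hw⟩
    have h1 := (hVa _ hw).le
    have h2 : ‖w‖ ^ 2 ≤ 2 * |a| ^ 2 := by
      have h3 : w ^ 2 = (a : ℂ) ^ 2 - complexRadius a w ^ 2 := by rw [complexRadius_sq]; ring
      rw [← norm_pow, h3]
      refine (norm_sub_le _ _).trans ?_
      rw [norm_pow, norm_pow, Complex.norm_real, Real.norm_eq_abs]
      have := pow_le_pow_left₀ (norm_nonneg _) h1 2
      linarith
    have h3 : ‖w‖ ≤ 1 + 2 * |a| ^ 2 := by nlinarith [sq_nonneg (‖w‖ - 1)]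
    rw [norm_mul, norm_pow]
    gcongr
  refine Filter.Eventually.mono ((eventually_encard_zeros_le (l := 𝓝[≠] (0 : ℝ))
    (H := fun ε w => w ^ 3 * complexRadius a w * d ε (complexRadius a w))
    (H₀ := fun w => w ^ 3 * complexRadius a w *
      ∫ θ in (0 : ℝ)..(2 * Real.pi), radialField a f g 0 θ (complexRadius a w))
    (isOpen_radiusDomain (a := a) hV) ?_ ?_ hW ?_ (K := K) ?_ ?_ (m := Ioo 0 |a|) hKm)) fun ε hε => ?_
  · filter_upwards [hd] with ε hε w hw
    have h1 := differentiableAt_complexRadius hw.1.2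
    have h2 := (hε.differentiableOn.differentiableAt (hV.mem_nhds hw.2)).comp w h1
    exact (((differentiableAt_id.pow 3).mul h1).mul h2).differentiableWithinAt
  · refine TendstoUniformlyOn.tendstoLocallyUniformlyOn (Metric.tendstoUniformlyOn_iff.2 ?_)
    intro η hη
    have hlim : Tendsto (fun ε : ℝ => (1 + 2 * |a| ^ 2) ^ 3 * |a| * (C * |ε|)) (𝓝[≠] 0) (𝓝 0) := by
      have h1 : Continuous fun ε : ℝ => (1 + 2 * |a| ^ 2) ^ 3 * |a| * (C * |ε|) := by fun_prop
      have h2 := h1.tendsto 0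
      simp only [abs_zero, mul_zero] at h2
      exact h2.mono_left nhdsWithin_le_nhds
    filter_upwards [hd, hlim.eventually (gt_mem_nhds hη)] with ε hε hs w hw
    rw [dist_comm, dist_eq_norm, ← mul_sub, norm_mul]
    refine lt_of_le_of_lt ?_ hs
    exact mul_le_mul (hfac w hw) (hε.norm_sub_le _ hw.2) (norm_nonneg _) (by positivity)
  · rintro w ⟨⟨hw0, hw1⟩, hw2⟩
    rw [← Complex.ofReal_pow, ← Complex.ofReal_pow, ← Complex.ofReal_sub,
      Complex.ofReal_mem_slitPlane] at hw1
    have hw : w ∈ Ioo 0 |a| := by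
      refine ⟨by simpa using hw0, ?_⟩
      exact (le_abs_self w).trans_lt (sq_lt_sq.1 (sub_pos.1 hw1))
    simp only [complexRadius_ofReal hw1.le]
    rw [integral_radialField_zero_ofReal, hrep.eval_eq hw]
    push_cast
    ring
  · exact isCompact_Icc.image (by fun_prop)
  · rintro _ ⟨x, hx, rfl⟩
    refine ofReal_mem_radiusDomain (hKm ⟨x, hx, rfl⟩) ?_
    have h1 := hI x hx
    rw [sqrt_sq_sub_sqrt_sq h1.1.le (by rw [abs_of_pos h1.1]; exact h1.2.le)]
    exact hVI x hx
  · have hcard : ((W.roots.filter (fun w => w ∈ Ioo 0 |a|)).card : ℕ∞) ≤ n :=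
      Nat.cast_le.2 (by convert card_filter_roots_le ha hW hadm)
    refine le_trans (encard_le_encard_of_injOn (f := fun x => √(a ^ 2 - x ^ 2)) ?_ ?_)
      (hε.trans hcard)
    · rintro x ⟨hx, hx0⟩
      refine ⟨⟨x, hx, rfl⟩, ?_⟩
      simp only [hrad x hx, hx0, mul_zero]
    · exact injOn_sqrt_sq_sub.mono fun x hx => hI x hx.1

theorem Represents.ne_zero (hrep : Represents a f g W)
    (hne : ∃ r ∈ Ioo 0 |a|, averaged a f g r ≠ 0) : W ≠ 0 := by
  rintro rfl
  obtain ⟨r, hr, h⟩ := hne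
  have h1 := hrep r (by rw [abs_of_pos hr.1]; exact hr.2)
  rw [eval_zero] at h1
  exact mul_ne_zero (pow_ne_zero 3 (sqrt_sq_sub_mem_Ioo hr).1.ne') (mul_ne_zero hr.1.ne' h) h1

theorem Represents.averaged_eq_zero_iff (hrep : Represents a f g W) {r : ℝ} (hr : r ∈ Ioo 0 |a|) :
    averaged a f g r = 0 ↔ W.eval √(a ^ 2 - r ^ 2) = 0 := by
  rw [← hrep r (by rw [abs_of_pos hr.1]; exact hr.2)]
  have h1 := (sqrt_sq_sub_mem_Ioo hr).1.ne'
  have h2 := hr.1.ne'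
  simp [h1, h2]

theorem encard_averaged_zeros_le (ha : a ≠ 0) (hf : f.totalDegree ≤ n) (hg : g.totalDegree ≤ n)
    (hne : ∃ r ∈ Ioo 0 |a|, averaged a f g r ≠ 0) :
    {r : ℝ | r ∈ Ioo 0 |a| ∧ averaged a f g r = 0}.encard ≤ n := by
  classical
  obtain ⟨W, hadm, hrep⟩ := exists_represents ha hf hg
  have hW := hrep.ne_zero hne
  have hcard : ((W.roots.filter (fun w => w ∈ Ioo 0 |a|)).toFinset.card : ℕ∞) ≤ n :=
    Nat.cast_le.2 ((Multiset.toFinset_card_le _).trans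
      (by convert card_filter_roots_le ha hW hadm))
  refine le_trans ?_ hcard
  rw [← encard_coe_eq_coe_finsetCard]
  refine encard_le_encard_of_injOn (f := fun r => √(a ^ 2 - r ^ 2)) ?_
    (injOn_sqrt_sq_sub.mono fun r hr => hr.1)
  rintro r ⟨hr, h0⟩
  rw [Finset.mem_coe, Multiset.mem_toFinset, Multiset.mem_filter, mem_roots hW]
  exact ⟨(hrep.averaged_eq_zero_iff hr).1 h0, sqrt_sq_sub_mem_Ioo hr⟩

theorem IsDisplacement.encard_limitCyclesIn_le {ε : ℝ} {d : ℂ → ℂ}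
    (hd : IsDisplacement a f g ρ₁ ρ₂ V C ε d) (hρ₁ : 0 < ρ₁) :
    (limitCyclesIn a f g ε ρ₁ ρ₂).encard ≤ {x : ℝ | x ∈ Icc ρ₁ ρ₂ ∧ d x = 0}.encard := by
  choose! x hx hx0 hmem using hd.exists_zero
  refine encard_le_encard_of_injOn (f := x) (fun Γ hΓ => ⟨hx Γ hΓ.1.1 hΓ.2, hx0 Γ hΓ.1.1 hΓ.2⟩) ?_
  intro Γ hΓ Γ' hΓ' he
  have hpos : 0 < x Γ := hρ₁.trans_le (hx Γ hΓ.1.1 hΓ.2).1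
  exact hd.eq_of_mem Γ Γ' hΓ.1.1 hΓ.2 hΓ'.1.1 hΓ'.2 (x Γ) hpos
    ((hmem Γ hΓ.1.1 hΓ.2 _ hpos).2 rfl) ((hmem Γ' hΓ'.1.1 hΓ'.2 _ hpos).2 he)

theorem eventually_encard_limitCyclesIn_le (ha : a ≠ 0) (hf : f.totalDegree ≤ n)
    (hg : g.totalDegree ≤ n) (hne : ∃ r ∈ Ioo 0 |a|, averaged a f g r ≠ 0) (hρ₁ : 0 < ρ₁)
    (hρ : ρ₁ < ρ₂) (hρ₂ : ρ₂ < |a|) :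
    ∀ᶠ ε in 𝓝[≠] (0 : ℝ), (limitCyclesIn a f g ε ρ₁ ρ₂).encard ≤ n := by
  obtain ⟨W, hadm, hrep⟩ := exists_represents ha hf hg
  obtain ⟨V, hV, hVI, hVa, -, C, d, hd⟩ := exists_isDisplacement f g hρ₁ hρ hρ₂
  filter_upwards [hd, eventually_encard_displacement_zeros_le ha (hrep.ne_zero hne) hadm hrep hρ₁
    hρ₂ hV hVI hVa hd] with ε hε hle
  exact (hε.encard_limitCyclesIn_le hρ₁).trans hle

/-- If the displacement function has finitely many zeros, then periodic orbits in the interior of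
the annulus are limit cycles. -/
theorem IsDisplacement.isLimitCycle {ε : ℝ} {d : ℂ → ℂ} (hd : IsDisplacement a f g ρ₁ ρ₂ V C ε d)
    (hρ₁ : 0 < ρ₁) (hfin : {x : ℝ | x ∈ Icc ρ₁ ρ₂ ∧ d x = 0}.Finite) {Γ : Set (ℝ × ℝ)}
    (hΓ : IsPeriodicOrbit (field a f g ε) Γ)
    (hsub : ∀ p ∈ Γ, ρ₁ ^ 2 < p.1 ^ 2 + p.2 ^ 2 ∧ p.1 ^ 2 + p.2 ^ 2 < ρ₂ ^ 2) :
    IsLimitCycle (field a f g ε) Γ := by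
  have hann : Γ ⊆ annulus ρ₁ ρ₂ := fun p hp => ⟨(hsub p hp).1.le, (hsub p hp).2.le⟩
  obtain ⟨x, hx, hx0, hmem⟩ := hd.exists_zero Γ hΓ hann
  have hxpos : 0 < x := hρ₁.trans_le hx.1
  set Z : Set (ℝ × ℝ) := (fun y => (y, (0 : ℝ))) '' ({y : ℝ | y ∈ Icc ρ₁ ρ₂ ∧ d y = 0} \ {x})
    with hZ
  have hZc : IsClosed Z := (hfin.sdiff.image _).isClosed
  refine ⟨hΓ, {p | ρ₁ ^ 2 < p.1 ^ 2 + p.2 ^ 2} ∩ {p | p.1 ^ 2 + p.2 ^ 2 < ρ₂ ^ 2} ∩ Zᶜ, ?_, ?_, ?_⟩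
  · exact ((isOpen_lt (by fun_prop) (by fun_prop)).inter
      (isOpen_lt (by fun_prop) (by fun_prop))).inter hZc.isOpen_compl
  · refine fun p hp => ⟨hsub p hp, ?_⟩
    rintro ⟨y, ⟨hy, hyx⟩, rfl⟩
    exact hyx ((hmem y (hρ₁.trans_le hy.1.1)).1 hp)
  · intro Γ' hΓ' hsub'
    have hann' : Γ' ⊆ annulus ρ₁ ρ₂ := fun p hp => ⟨(hsub' hp).1.1.le, (hsub' hp).1.2.le⟩
    obtain ⟨y, hy, hy0, hmem'⟩ := hd.exists_zero Γ' hΓ' hann'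
    have hypos : 0 < y := hρ₁.trans_le hy.1
    have hyΓ := (hmem' y hypos).2 rfl
    have hyx : y = x := by
      by_contra hne
      exact (hsub' hyΓ).2 ⟨y, ⟨⟨hy, hy0⟩, hne⟩, rfl⟩
    subst hyx
    exact hd.eq_of_mem Γ' Γ hΓ' hann' hΓ hann y hypos hyΓ ((hmem y hypos).2 rfl)

end CubicDL

end

noncomputable section

namespace CubicDL

open Metric Polynomial

variable {a : ℝ} {f g : MvPolynomial (Fin 2) ℝ} {ρ₁ ρ₂ C : ℝ} {n : ℕ} {W : ℝ[X]} {V : Set ℂ}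
  {d : ℝ → ℂ → ℂ}

/-- Choice of approximate solutions converging to `r`. -/
theorem exists_tendsto_of_forall_eventually {P : ℝ → ℝ → Prop} {r : ℝ}
    (h : ∀ η > 0, ∀ᶠ ε in 𝓝[≠] (0 : ℝ), ∃ z, |z - r| < η ∧ P ε z) :
    ∃ z : ℝ → ℝ, Tendsto z (𝓝[≠] 0) (𝓝 r) ∧ ∀ᶠ ε in 𝓝[≠] (0 : ℝ), P ε (z ε) := by
  have key : ∀ ε : ℝ, ε ≠ 0 → (∃ z, P ε z) →
      ∃ z, P ε z ∧ ∀ z', P ε z' → |z - r| < |z' - r| + |ε| := by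
    intro ε hε hex
    set S : Set ℝ := (fun z => |z - r|) '' {z | P ε z} with hS
    have hne : S.Nonempty := Set.Nonempty.image _ hex
    obtain ⟨_, ⟨z, hz, rfl⟩, hlt⟩ := exists_lt_of_csInf_lt hne
      (lt_add_of_pos_right (sInf S) (abs_pos.2 hε))
    refine ⟨z, hz, fun z' hz' => hlt.trans_le ?_⟩
    gcongr
    exact csInf_le ⟨0, by rintro _ ⟨y, -, rfl⟩; exact abs_nonneg _⟩ ⟨z', hz', rfl⟩
  choose! z hz hmin using key
  have hne : ∀ᶠ ε in 𝓝[≠] (0 : ℝ), ε ≠ 0 := self_mem_nhdsWithin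
  refine ⟨z, Metric.tendsto_nhds.2 fun η hη => ?_, ?_⟩
  · have habs : ∀ᶠ ε in 𝓝[≠] (0 : ℝ), |ε| < η / 2 := by
      refine eventually_nhdsWithin_of_eventually_nhds ?_
      exact (continuous_abs.tendsto' (0 : ℝ) 0 abs_zero).eventually (gt_mem_nhds (by positivity))
    filter_upwards [h (η / 2) (by positivity), hne, habs] with ε ⟨y, hy, hP⟩ hε hs
    have := hmin ε hε ⟨y, hP⟩ y hP
    rw [Real.dist_eq]
    linarith
  · filter_upwards [h 1 one_pos, hne] with ε hex hε
    obtain ⟨y, -, hP⟩ := hex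
    exact hz ε hε ⟨y, hP⟩

theorem tendsto_re_displacement
    (hd : ∀ᶠ ε in 𝓝[≠] (0 : ℝ), IsDisplacement a f g ρ₁ ρ₂ V C ε (d ε)) {x : ℝ}
    (hx : (x : ℂ) ∈ V) : Tendsto (fun ε => (d ε x).re) (𝓝[≠] 0) (𝓝 (averaged a f g x)) := by
  have hlim : Tendsto (fun ε : ℝ => C * |ε|) (𝓝[≠] 0) (𝓝 0) :=
    tendsto_nhdsWithin_of_tendsto_nhds
      ((by fun_prop : Continuous fun ε : ℝ => C * |ε|).tendsto' 0 0 (by simp))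
  refine tendsto_iff_dist_tendsto_zero.2 (squeeze_zero' (Eventually.of_forall fun _ => dist_nonneg)
    ?_ hlim)
  filter_upwards [hd] with ε hε
  have h1 := hε.norm_sub_le x hx
  rw [integral_radialField_zero_ofReal] at h1
  rw [Real.dist_eq]
  refine le_trans ?_ h1
  simpa using Complex.abs_re_le_norm (d ε x - averaged a f g x)

theorem eventually_exists_displacement_zero
    (hd : ∀ᶠ ε in 𝓝[≠] (0 : ℝ), IsDisplacement a f g ρ₁ ρ₂ V C ε (d ε))
    (hVI : ∀ x ∈ Icc ρ₁ ρ₂, (x : ℂ) ∈ V) {r c : ℝ} (hr : r ∈ Ioo ρ₁ ρ₂)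
    (h0 : averaged a f g r = 0) (hc : c ≠ 0) (hder : HasDerivAt (averaged a f g) c r) {η : ℝ}
    (hη : 0 < η) :
    ∀ᶠ ε in 𝓝[≠] (0 : ℝ), ∃ z, |z - r| < η ∧ z ∈ Ioo ρ₁ ρ₂ ∧ d ε (z : ℝ) = 0 := by
  have hslope : ∀ᶠ x in 𝓝[≠] r, 0 < c * slope (averaged a f g) r x :=
    ((hasDerivAt_iff_tendsto_slope.1 hder).const_mul c).eventually
      (lt_mem_nhds (mul_self_pos.2 hc))
  have hnear : ∀ᶠ x in 𝓝 r, x ∈ Ioo ρ₁ ρ₂ ∧ |x - r| < η :=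
    (eventually_mem_set.2 (isOpen_Ioo.mem_nhds hr)).and (Metric.ball_mem_nhds r hη)
  obtain ⟨s, hs, hball⟩ := Metric.eventually_nhds_iff_ball.1
    ((eventually_nhdsWithin_iff.1 hslope).and hnear)
  have hx : ∀ t, |t| = s / 2 → 0 < c * (t⁻¹ * averaged a f g (r + t)) ∧ r + t ∈ Ioo ρ₁ ρ₂ ∧
      |r + t - r| < η := by
    intro t ht
    have h1 := hball (r + t) (by rw [Metric.mem_ball, Real.dist_eq, add_sub_cancel_left, ht]; linarith)
    refine ⟨?_, h1.2⟩
    have h2 : t ≠ 0 := fun h => by rw [h, abs_zero] at ht; linarith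
    have h3 := h1.1 (by simpa using h2)
    rwa [slope_def_field, h0, sub_zero, add_sub_cancel_left, div_eq_inv_mul] at h3
  obtain ⟨p1, p2, p3⟩ := hx (s / 2) (abs_of_pos (by positivity))
  obtain ⟨m1, m2, m3⟩ := hx (-(s / 2)) (by rw [abs_neg, abs_of_pos (by positivity)])
  have p4 : 0 < c * averaged a f g (r + s / 2) := by
    have : c * averaged a f g (r + s / 2)
      = s / 2 * (c * ((s / 2)⁻¹ * averaged a f g (r + s / 2))) := by field_simp
    rw [this]; positivity
  have m4 : c * averaged a f g (r + -(s / 2)) < 0 := by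
    have : c * averaged a f g (r + -(s / 2))
      = -(s / 2 * (c * ((-(s / 2))⁻¹ * averaged a f g (r + -(s / 2))))) := by field_simp
    rw [this]; exact neg_neg_of_pos (mul_pos (by positivity) m1)
  filter_upwards [hd, ((tendsto_re_displacement hd (hVI _ (Ioo_subset_Icc_self p2))).const_mul
    c).eventually (lt_mem_nhds p4), ((tendsto_re_displacement hd
      (hVI _ (Ioo_subset_Icc_self m2))).const_mul c).eventually (gt_mem_nhds m4)] with ε hε hp hm
  have hle : r + -(s / 2) ≤ r + s / 2 := by linarith
  have hsub : Icc (r + -(s / 2)) (r + s / 2) ⊆ Ioo ρ₁ ρ₂ := fun x hx =>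
    ⟨m2.1.trans_le hx.1, hx.2.trans_lt p2.2⟩
  have hcont : ContinuousOn (fun x : ℝ => c * (d ε x).re) (Icc (r + -(s / 2)) (r + s / 2)) :=
    continuousOn_const.mul (Complex.continuous_re.comp_continuousOn
      (hε.differentiableOn.continuousOn.comp Complex.continuous_ofReal.continuousOn
        fun x hx => hVI x (Ioo_subset_Icc_self (hsub hx))))
  obtain ⟨z, hz, hz0⟩ := intermediate_value_Icc hle hcont ⟨hm.le, hp.le⟩
  refine ⟨z, ?_, hsub hz, Complex.ext ((mul_eq_zero.1 hz0).resolve_left hc)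
    (hε.im_eq_zero z (Ioo_subset_Icc_self (hsub hz)))⟩
  have h1 := (abs_lt.1 m3).1
  have h2 := (abs_lt.1 p3).2
  exact abs_lt.2 ⟨by linarith [hz.1], by linarith [hz.2]⟩

theorem hausdorffEDist_polarCurve_circle_le {R : ℝ → ℝ} {r κ : ℝ} (hr : 0 < r)
    (h : ∀ t, |R t - r| ≤ κ) :
    Metric.hausdorffEDist (range (polarCurve R)) (circle r) ≤ ENNReal.ofReal κ := by
  have hκ : 0 ≤ κ := (abs_nonneg _).trans (h 0)
  have hdist : ∀ t, edist (polarCurve R t) (polarCurve (fun _ => r) t) ≤ ENNReal.ofReal κ := by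
    intro t
    rw [edist_dist]
    refine ENNReal.ofReal_le_ofReal ?_
    rw [Prod.dist_eq, Real.dist_eq, Real.dist_eq]
    simp only [polarCurve, ← sub_mul, abs_mul]
    exact max_le ((mul_le_of_le_one_right (abs_nonneg _) (Real.abs_cos_le_one t)).trans (h t))
      ((mul_le_of_le_one_right (abs_nonneg _) (Real.abs_sin_le_one t)).trans (h t))
  refine Metric.hausdorffEDist_le_of_mem_edist ?_ ?_
  · rintro _ ⟨t, rfl⟩
    exact ⟨_, polarCurve_sq (fun _ => r) t, hdist t⟩
  · intro p hp
    obtain ⟨t, ht⟩ : ∃ t, p = polarCurve (fun _ => r) t := by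
      have hp' : p.1 ^ 2 + p.2 ^ 2 = r ^ 2 := hp
      obtain ⟨t, ht⟩ := exists_eq_polar p (hp' ▸ pow_pos hr 2)
      rw [hp', Real.sqrt_sq hr.le] at ht
      exact ⟨t, ht⟩
    refine ⟨_, ⟨t, rfl⟩, ?_⟩
    rw [ht, edist_comm]
    exact hdist t

/-- A simple zero of the averaged function gives rise to a family of limit cycles. -/
theorem exists_limitCycles_of_simple_zero
    (hd : ∀ᶠ ε in 𝓝[≠] (0 : ℝ), IsDisplacement a f g ρ₁ ρ₂ V C ε (d ε)) (hρ₁ : 0 < ρ₁)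
    (hVI : ∀ x ∈ Icc ρ₁ ρ₂, (x : ℂ) ∈ V)
    (hfin : ∀ᶠ ε in 𝓝[≠] (0 : ℝ), {x : ℝ | x ∈ Icc ρ₁ ρ₂ ∧ d ε x = 0}.Finite)
    {r c : ℝ} (hr : r ∈ Ioo ρ₁ ρ₂) (h0 : averaged a f g r = 0) (hc : c ≠ 0)
    (hder : HasDerivAt (averaged a f g) c r) :
    ∃ (Γ : ℝ → Set (ℝ × ℝ)) (z : ℝ → ℝ), Tendsto z (𝓝[≠] 0) (𝓝 r) ∧
      (∀ᶠ ε in 𝓝[≠] (0 : ℝ), IsLimitCycle (field a f g ε) (Γ ε) ∧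
        ∀ s > 0, (s, (0 : ℝ)) ∈ Γ ε ↔ s = z ε) ∧
      Tendsto (fun ε => Metric.hausdorffEDist (Γ ε) (circle r)) (𝓝[≠] 0) (𝓝 0) ∧
      ∀ σ₁ σ₂, 0 < σ₁ → r ∈ Ioo σ₁ σ₂ → ∀ᶠ ε in 𝓝[≠] (0 : ℝ), Γ ε ⊆ annulus σ₁ σ₂ := by
  have hrpos : 0 < r := hρ₁.trans hr.1
  obtain ⟨z, hz, hz0⟩ := exists_tendsto_of_forall_eventually fun η hη =>
    eventually_exists_displacement_zero hd hVI hr h0 hc hder hη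
  have hε0 : Tendsto (fun ε : ℝ => C * |ε|) (𝓝[≠] 0) (𝓝 0) :=
    tendsto_nhdsWithin_of_tendsto_nhds
      ((by fun_prop : Continuous fun ε : ℝ => C * |ε|).tendsto' 0 0 (by simp))
  have hκ : Tendsto (fun ε => C * |ε| + |z ε - r|) (𝓝[≠] 0) (𝓝 0) := by
    have h1 := hε0.add ((hz.sub_const r).abs)
    simpa using h1
  have hκ' : ∀ η > 0, ∀ᶠ ε in 𝓝[≠] (0 : ℝ), C * |ε| + |z ε - r| < η := fun η hη =>
    hκ.eventually (gt_mem_nhds hη)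
  have hlow : ∀ᶠ ε in 𝓝[≠] (0 : ℝ), ρ₁ + C * |ε| ≤ z ε := by
    have h1 : Tendsto (fun ε : ℝ => ρ₁ + C * |ε|) (𝓝[≠] 0) (𝓝 ρ₁) := by
      simpa using hε0.const_add ρ₁
    exact (h1.eventually_lt hz hr.1).mono fun _ => le_of_lt
  have hupp : ∀ᶠ ε in 𝓝[≠] (0 : ℝ), z ε ≤ ρ₂ - C * |ε| := by
    have h1 : Tendsto (fun ε : ℝ => ρ₂ - C * |ε|) (𝓝[≠] 0) (𝓝 ρ₂) := by
      simpa using hε0.const_sub ρ₂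
    exact (hz.eventually_lt h1 hr.2).mono fun _ => le_of_lt
  have hex : ∀ᶠ ε in 𝓝[≠] (0 : ℝ), ∃ R : ℝ → ℝ,
      IsPeriodicOrbit (field a f g ε) (range (polarCurve R)) ∧
      range (polarCurve R) ⊆ annulus ρ₁ ρ₂ ∧ R 0 = z ε ∧
      ∀ t, |R t - r| ≤ C * |ε| + |z ε - r| := by
    filter_upwards [hd, hz0, hlow, hupp] with ε hε hzε hl hu
    obtain ⟨R, h1, h2, h3, h4⟩ := hε.exists_orbit (z ε) hl hu hzε.2
    exact ⟨R, h1, h2, h3, fun t => (abs_sub_le _ (z ε) _).trans (by gcongr; exact h4 t)⟩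
  choose! R hR using fun ε (h : ∃ R : ℝ → ℝ,
      IsPeriodicOrbit (field a f g ε) (range (polarCurve R)) ∧
      range (polarCurve R) ⊆ annulus ρ₁ ρ₂ ∧ R 0 = z ε ∧
      ∀ t, |R t - r| ≤ C * |ε| + |z ε - r|) => h
  replace hR := hex.mono hR
  have hsq : ∀ σ₁ σ₂, 0 < σ₁ → r ∈ Ioo σ₁ σ₂ → ∀ᶠ ε in 𝓝[≠] (0 : ℝ),
      ∀ p ∈ range (polarCurve (R ε)),
        σ₁ ^ 2 < p.1 ^ 2 + p.2 ^ 2 ∧ p.1 ^ 2 + p.2 ^ 2 < σ₂ ^ 2 := by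
    intro σ₁ σ₂ hσ hrσ
    filter_upwards [hR, hκ' (r - σ₁) (sub_pos.2 hrσ.1), hκ' (σ₂ - r) (sub_pos.2 hrσ.2)]
      with ε hε h1 h2
    rintro _ ⟨t, rfl⟩
    have h3 := abs_le.1 (hε.2.2.2 t)
    rw [polarCurve_sq]
    exact ⟨pow_lt_pow_left₀ (by linarith) hσ.le two_ne_zero,
      pow_lt_pow_left₀ (by linarith) (by linarith) two_ne_zero⟩
  refine ⟨fun ε => range (polarCurve (R ε)), z, hz, ?_, ?_, fun σ₁ σ₂ hσ hrσ => ?_⟩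
  · filter_upwards [hd, hR, hfin, hsq ρ₁ ρ₂ hρ₁ hr, hlow, hz0] with ε hε hRε hf hs hl hzε
    refine ⟨hε.isLimitCycle hρ₁ hf hRε.1 hs, ?_⟩
    obtain ⟨x, hx, -, hmem⟩ := hε.exists_zero _ hRε.1 hRε.2.1
    have h1 : (z ε, (0 : ℝ)) ∈ range (polarCurve (R ε)) :=
      ⟨0, by simp [polarCurve, hRε.2.2.1]⟩
    rwa [← (hmem (z ε) (hρ₁.trans hzε.1.1)).1 h1] at hmem
  · have h1 : Tendsto (fun ε => ENNReal.ofReal (C * |ε| + |z ε - r|)) (𝓝[≠] 0) (𝓝 0) := by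
      simpa using ENNReal.tendsto_ofReal hκ
    refine tendsto_of_tendsto_of_tendsto_of_le_of_le' tendsto_const_nhds h1
      (Eventually.of_forall fun _ => zero_le) ?_
    filter_upwards [hR] with ε hε
    exact hausdorffEDist_polarCurve_circle_le hrpos hε.2.2.2
  · filter_upwards [hsq σ₁ σ₂ hσ hrσ] with ε hε p hp
    exact ⟨(hε p hp).1.le, (hε p hp).2.le⟩

theorem Represents.exists_hasDerivAt_averaged (hrep : Represents a f g W) {r : ℝ}
    (hr : r ∈ Ioo 0 |a|) (h0 : W.eval √(a ^ 2 - r ^ 2) = 0)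
    (h1 : W.derivative.eval √(a ^ 2 - r ^ 2) ≠ 0) :
    ∃ c : ℝ, c ≠ 0 ∧ HasDerivAt (averaged a f g) c r := by
  have hw := (sqrt_sq_sub_mem_Ioo hr).1.ne'
  have hpos : a ^ 2 - r ^ 2 ≠ 0 := (sq_sub_sq_pos (by rw [abs_of_pos hr.1]; exact hr.2)).ne'
  have hs : HasDerivAt (fun s => √(a ^ 2 - s ^ 2)) (-(2 * r) / (2 * √(a ^ 2 - r ^ 2))) r := by
    have h2 : HasDerivAt (fun s : ℝ => a ^ 2 - s ^ 2) (-(2 * r)) r := by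
      simpa using (hasDerivAt_pow 2 r).const_sub (a ^ 2)
    exact h2.sqrt hpos
  have hN := (W.hasDerivAt √(a ^ 2 - r ^ 2)).comp r hs
  have hD := (hs.pow 3).mul (hasDerivAt_id r)
  have hq := hN.div hD (mul_ne_zero (pow_ne_zero 3 hw) hr.1.ne')
  refine ⟨_, ?_, hq.congr_of_eventuallyEq ?_⟩
  · simp only [Function.comp_apply, h0, zero_mul, sub_zero, Pi.mul_apply, Pi.pow_apply, id]
    refine div_ne_zero (mul_ne_zero (mul_ne_zero h1 (div_ne_zero (neg_ne_zero.2
      (mul_ne_zero two_ne_zero hr.1.ne')) (mul_ne_zero two_ne_zero hw)))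
      (mul_ne_zero (pow_ne_zero 3 hw) hr.1.ne')) (pow_ne_zero 2 (mul_ne_zero (pow_ne_zero 3 hw) hr.1.ne'))
  · filter_upwards [isOpen_Ioo.mem_nhds hr] with s hs'
    have h3 := (sqrt_sq_sub_mem_Ioo hs').1.ne'
    have h4 := hrep s (by rw [abs_of_pos hs'.1]; exact hs'.2)
    simp only [Pi.div_apply, Function.comp_apply, Pi.mul_apply, Pi.pow_apply, id]
    rw [← h4, eq_div_iff (mul_ne_zero (pow_ne_zero 3 h3) hs'.1.ne')]
    ring

/-- Every strictly increasing list of radii is the list of zeros, all simple, of the averaged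
function of a perturbation whose degree is the number of radii. -/
theorem exists_averaged_zeros (ha : a ≠ 0) {r : Fin n → ℝ} (hr : StrictMono r)
    (hra : ∀ i, r i ∈ Ioo 0 |a|) :
    ∃ f g : MvPolynomial (Fin 2) ℝ, f.totalDegree ≤ n ∧ g.totalDegree ≤ n ∧
      (∃ s ∈ Ioo 0 |a|, averaged a f g s ≠ 0) ∧
      range r = {s : ℝ | s ∈ Ioo 0 |a| ∧ averaged a f g s = 0} ∧
      ∀ i, ∃ c : ℝ, c ≠ 0 ∧ HasDerivAt (averaged a f g) c (r i) := by
  classical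
  have hinj : Function.Injective fun i => √(a ^ 2 - r i ^ 2) := fun i j hij =>
    hr.injective (injOn_sqrt_sq_sub (hra i) (hra j) hij)
  set S : Finset ℝ := Finset.univ.image fun i => √(a ^ 2 - r i ^ 2) with hS
  have hcard : S.card = n := by rw [hS, Finset.card_image_of_injective _ hinj, Finset.card_fin]
  have hmem : ∀ i, √(a ^ 2 - r i ^ 2) ∈ S := fun i => Finset.mem_image_of_mem _ (Finset.mem_univ i)
  obtain ⟨W, hadm, hroots, hsimple⟩ := exists_isAdmissible_roots ha S fun z hz => by
    obtain ⟨i, -, rfl⟩ := Finset.mem_image.1 hz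
    exact sqrt_sq_sub_mem_Ioo (hra i)
  rw [hcard] at hadm
  obtain ⟨f, g, hf, hg, hrep⟩ := hadm.isRealizable ha
  have hzero : ∀ s ∈ Ioo 0 |a|, averaged a f g s = 0 ↔ s ∈ range r := by
    intro s hs
    rw [hrep.averaged_eq_zero_iff hs, hroots _ (sqrt_sq_sub_mem_Ioo hs), hS, Finset.mem_image]
    constructor
    · rintro ⟨i, -, hi⟩
      exact ⟨i, injOn_sqrt_sq_sub (hra i) hs hi⟩
    · rintro ⟨i, rfl⟩
      exact ⟨i, Finset.mem_univ i, rfl⟩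
  refine ⟨f, g, hf, hg, ?_, ?_, fun i => ?_⟩
  · obtain ⟨s, hs, hsr⟩ := ((Ioo_infinite (abs_pos.2 ha)).sdiff (finite_range r)).nonempty
    exact ⟨s, hs, fun h => hsr ((hzero s hs).1 h)⟩
  · ext s
    constructor
    · rintro ⟨i, rfl⟩
      exact ⟨hra i, (hzero _ (hra i)).2 ⟨i, rfl⟩⟩
    · rintro ⟨hs, h⟩
      exact (hzero s hs).1 h
  · exact hrep.exists_hasDerivAt_averaged (hra i)
      ((hroots _ (sqrt_sq_sub_mem_Ioo (hra i))).2 (hmem i)) (hsimple _ (hmem i))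

theorem exists_limitCycles (ha : a ≠ 0) (hf : f.totalDegree ≤ n) (hg : g.totalDegree ≤ n)
    (hne : ∃ s ∈ Ioo 0 |a|, averaged a f g s ≠ 0) (hρ₁ : 0 < ρ₁) (hρ : ρ₁ < ρ₂) (hρ₂ : ρ₂ < |a|)
    {r : Fin n → ℝ} (hr : StrictMono r) (hrρ : ∀ i, r i ∈ Ioo ρ₁ ρ₂)
    (h0 : ∀ i, averaged a f g (r i) = 0)
    (hder : ∀ i, ∃ c : ℝ, c ≠ 0 ∧ HasDerivAt (averaged a f g) c (r i)) :
    ∃ Γ : Fin n → ℝ → Set (ℝ × ℝ),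
      (∀ᶠ ε in 𝓝[≠] (0 : ℝ), (∀ i, IsLimitCycle (field a f g ε) (Γ i ε)) ∧
        Function.Injective fun i => Γ i ε) ∧
      (∀ i, Tendsto (fun ε => Metric.hausdorffEDist (Γ i ε) (circle (r i))) (𝓝[≠] 0) (𝓝 0)) ∧
      ∀ i σ₁ σ₂, 0 < σ₁ → r i ∈ Ioo σ₁ σ₂ → ∀ᶠ ε in 𝓝[≠] (0 : ℝ), Γ i ε ⊆ annulus σ₁ σ₂ := by
  obtain ⟨W, hadm, hrep⟩ := exists_represents ha hf hg
  obtain ⟨V, hV, hVI, hVa, -, C, d, hd⟩ := exists_isDisplacement f g hρ₁ hρ hρ₂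
  have hfin : ∀ᶠ ε in 𝓝[≠] (0 : ℝ), {x : ℝ | x ∈ Icc ρ₁ ρ₂ ∧ d ε x = 0}.Finite :=
    (eventually_encard_displacement_zeros_le ha (hrep.ne_zero hne) hadm hrep hρ₁ hρ₂ hV hVI hVa
      hd).mono fun ε hε => finite_of_encard_le_coe hε
  choose c hc hc' using hder
  choose Γ z hz hΓ hH hann using fun i =>
    exists_limitCycles_of_simple_zero hd hρ₁ hVI hfin (hrρ i) (h0 i) (hc i) (hc' i)
  refine ⟨Γ, ?_, hH, hann⟩
  have hdist : ∀ᶠ ε in 𝓝[≠] (0 : ℝ), ∀ i j, i ≠ j → z i ε ≠ z j ε := by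
    refine eventually_all.2 fun i => eventually_all.2 fun j => ?_
    rcases eq_or_ne i j with h | h
    · exact Eventually.of_forall fun _ h' => absurd h h'
    · have h1 := ((hz i).sub (hz j)).eventually_ne (sub_ne_zero.2 (hr.injective.ne h))
      exact h1.mono fun ε hε _ => sub_ne_zero.1 hε
  have hpos : ∀ᶠ ε in 𝓝[≠] (0 : ℝ), ∀ i, 0 < z i ε :=
    eventually_all.2 fun i => (hz i).eventually (lt_mem_nhds (hρ₁.trans (hrρ i).1))
  filter_upwards [eventually_all.2 hΓ, hdist, hpos] with ε hε hne' hp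
  refine ⟨fun i => (hε i).1, fun i j hij => ?_⟩
  by_contra h
  refine hne' i j h (((hε j).2 _ (hp i)).1 ?_)
  have h1 := ((hε i).2 _ (hp i)).2 rfl
  simp only at hij
  rwa [hij] at h1

end CubicDL

end

theorem theorem1p2 (a : ℝ) (ha : a ≠ 0) (n : ℕ) :
    (∀ f g : MvPolynomial (Fin 2) ℝ, f.totalDegree ≤ n → g.totalDegree ≤ n →
      (∃ r ∈ Ioo 0 |a|, CubicDL.averaged a f g r ≠ 0) →
        {r : ℝ | r ∈ Ioo 0 |a| ∧ CubicDL.averaged a f g r = 0}.encard ≤ n ∧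
        ∀ ρ₁ ρ₂ : ℝ, 0 < ρ₁ → ρ₁ < ρ₂ → ρ₂ < |a| →
          ∀ᶠ ε in 𝓝[≠] (0 : ℝ), (CubicDL.limitCyclesIn a f g ε ρ₁ ρ₂).encard ≤ n) ∧
    (∃ f g : MvPolynomial (Fin 2) ℝ, f.totalDegree ≤ n ∧ g.totalDegree ≤ n ∧
      (∃ r ∈ Ioo 0 |a|, CubicDL.averaged a f g r ≠ 0) ∧
      ∃ r : Fin n → ℝ, StrictMono r ∧
        range r = {s : ℝ | s ∈ Ioo 0 |a| ∧ CubicDL.averaged a f g s = 0} ∧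
        (∀ i, ∃ d : ℝ, d ≠ 0 ∧ HasDerivAt (CubicDL.averaged a f g) d (r i)) ∧
        (∃ Γ : Fin n → ℝ → Set (ℝ × ℝ),
          (∀ᶠ ε in 𝓝[≠] (0 : ℝ), (∀ i, CubicDL.IsLimitCycle (CubicDL.field a f g ε) (Γ i ε)) ∧
            Function.Injective fun i => Γ i ε) ∧
          ∀ i, Tendsto (fun ε => Metric.hausdorffEDist (Γ i ε) (CubicDL.circle (r i)))
            (𝓝[≠] (0 : ℝ)) (𝓝 0)) ∧
        ∀ ρ₁ ρ₂ : ℝ, 0 < ρ₁ → ρ₁ < ρ₂ → ρ₂ < |a| → (∀ i, r i ∈ Ioo ρ₁ ρ₂) →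
          ∀ᶠ ε in 𝓝[≠] (0 : ℝ), (CubicDL.limitCyclesIn a f g ε ρ₁ ρ₂).encard = n) := by
  refine ⟨fun f g hf hg hne => ⟨CubicDL.encard_averaged_zeros_le ha hf hg hne,
    fun ρ₁ ρ₂ hρ₁ hρ hρ₂ => CubicDL.eventually_encard_limitCyclesIn_le ha hf hg hne hρ₁ hρ hρ₂⟩, ?_⟩
  have haa := abs_pos.2 ha
  have hn : (0 : ℝ) < n + 1 := by positivity
  have hmono : StrictMono fun i : Fin n => |a| * ((i : ℝ) + 1) / (n + 1) := by
    intro i j hij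
    have : (i : ℝ) < j := by exact_mod_cast hij
    simp only
    gcongr
  have hr0 : ∀ i : Fin n, |a| / (3 * (n + 1)) < |a| * ((i : ℝ) + 1) / (n + 1) := fun i => by
    rw [div_lt_div_iff₀ (by positivity) hn]
    have : (0 : ℝ) ≤ i := by positivity
    nlinarith [mul_pos haa hn, mul_nonneg (mul_pos haa hn).le this]
  have hr1 : ∀ i : Fin n,
      |a| * ((i : ℝ) + 1) / (n + 1) < |a| * (3 * n + 2) / (3 * (n + 1)) := fun i => by
    rw [div_lt_div_iff₀ hn (by positivity)]
    have : (i : ℝ) + 1 ≤ n := by exact_mod_cast i.2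
    nlinarith [mul_pos haa hn, mul_nonneg (mul_pos haa hn).le (sub_nonneg.2 this)]
  have hρ₁ : 0 < |a| / (3 * ((n : ℝ) + 1)) := by positivity
  have hρ : |a| / (3 * ((n : ℝ) + 1)) < |a| * (3 * n + 2) / (3 * (n + 1)) := by
    gcongr
    have : (0 : ℝ) ≤ n := by positivity
    nlinarith
  have hρ₂ : |a| * (3 * (n : ℝ) + 2) / (3 * (n + 1)) < |a| := by
    rw [div_lt_iff₀ (by positivity)]
    nlinarith
  obtain ⟨f, g, hf, hg, hne, hrange, hder⟩ := CubicDL.exists_averaged_zeros ha hmono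
    fun i => ⟨hρ₁.trans (hr0 i), (hr1 i).trans hρ₂⟩
  obtain ⟨Γ, hΓ, hH, hann⟩ := CubicDL.exists_limitCycles ha hf hg hne hρ₁ hρ hρ₂ hmono
    (fun i => ⟨hr0 i, hr1 i⟩) (fun i => (hrange.subset (mem_range_self i)).2) hder
  refine ⟨f, g, hf, hg, hne, _, hmono, hrange, hder, ⟨Γ, hΓ, hH⟩, fun σ₁ σ₂ hσ₁ hσ hσ₂ hrσ => ?_⟩
  filter_upwards [hΓ, eventually_all.2 fun i => hann i σ₁ σ₂ hσ₁ (hrσ i),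
    CubicDL.eventually_encard_limitCyclesIn_le ha hf hg hne hσ₁ hσ hσ₂] with ε hε hsub hle
  refine le_antisymm hle ?_
  have h1 : (range fun i => Γ i ε).encard = n := by
    rw [← image_univ, hε.2.encard_image, encard_univ, ENat.card_eq_coe_fintype_card,
      Fintype.card_fin]
  rw [← h1]
  refine encard_le_encard ?_
  rintro _ ⟨i, rfl⟩
  exact ⟨hε.1 i, hsub i⟩
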